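/- **Theorem (Equivalence of relational higher-order logic with higher-order logic).** *Terms.* Simple types are $\tau,\sigma ::= \mathbb B\mid\mathbb N\mid \mathrm{list}_\tau\mid\tau\times\tau\mid\tau\to\tau$; the types $\mathbb N$ and $\mathrm{list}_\tau$ are denoted by $I$. Terms are those of the $\lambda$-calculus with pairs, projections $\pi_1,\pi_2$, $\lambda x{:}\tau.t$, the constants $\mathsf{tt},\mathsf{ff},0,[\,]$, the constructors $S\,t$ and $t::t$, case distinctions $\mathsf{case}\ t\ \mathsf{of}\ [\mathsf{tt}\mapsto u;\mathsf{ff}\mapsto v]$, $[0\mapsto u;S\mapsto v]$ and $[[\,]\mapsto u;\_::\_\mapsto v]$ (in the last two $v$ is a function, applied to the arguments of the constructor), and $\mathsf{letrec}\ f\ x=e$. Write $=_{\beta\iota\mu}$ for the equivalence relation generated by the contextual closure of $\beta$-reduction (for functions and pairs), of the usual reduction of case distinctions on constructors, and of $(\mathsf{letrec}\ f\ x=e)\,a\to e[a/x][\mathsf{letrec}\ f\ x=e/f]$ for $a$ with a constructor in head position. Typing $\Gamma\vdash t:\tau$ is standard, except that $\Gamma\vdash \mathsf{letrec}\ f\ x=e:I\to\sigma$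 requires $\Gamma,f:I\to\sigma,x:I\vdash e:\sigma$ and a guard condition $\mathrm{Def}(f,x,e)$ (meant to ensure that recursive calls are made on smaller arguments). The guard is a parameter: $\mathrm{Def}$ is any predicate of $\Gamma$, $I$, $\sigma$ and the body $e$ that is preserved by the substitution of well-typed terms for the variables of $\Gamma$. *HOL.* Assertions are built with $\top,\bot,\wedge,\vee,\Rightarrow,\forall x{:}\tau,\exists x{:}\tau$ from atoms $P(t_1,\dots,t_n)$, where $P$ is an equality $=_\tau$, a comparison of sizes $|t|\le|u|$ or $|t|<|u|$ at a type $I$, or one of an arbitrary family of typed predicate symbols, for which an arbitrary set of closed assertions is given as axioms. Here $|n|=n$ for naturals and $|l|$ is the length of a list. A judgment $\Gamma\mid\Psi\vdash\phi$ consists of a context $\Gamma$, a set $\Psi$ of assertions well typed in $\Gamma$ and an assertion $\phi$ well typed in $\Gamma$. Its rules are: natural deduction for (intuitionistic) many-sorted predicate logic; $t=t'$ whenever $t,t'$ have the same type and $t=_{\beta\iota\mu}t'$; from $\phi[t/x]$ and $t=u$ infer $\phi[u/x]$; structural induction over $\mathbb B$, $\mathbb N$ and $\mathrm{list}_\tau$;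 non-overlap of constructors ($\mathsf{tt}\neq\mathsf{ff}$, $0\neq S\,t$, $[\,]\neq h::t$) and injectivity of $S$ and $::$; the recursive clauses $\neg(|t|<|0|)$, $|t|<|S\,u|\Leftrightarrow|t|\le|u|$, $|0|\le|t|$, $|S\,t|\le|u|\Leftrightarrow|t|<|u|$, and the analogous four clauses for lists; and the given axioms. *UHOL.* Judgments $\Gamma\mid\Psi\vdash t:\sigma\mid\phi$ have $\Gamma\vdash t:\sigma$, $\Psi$ well typed in $\Gamma$ and $\phi$ well typed in $\Gamma,\mathbf r:\sigma$. There is one rule per term former and a subsumption rule. (VAR and constants) If $\phi[t/\mathbf r]$ is derivable in HOL, then so is $t:\sigma\mid\phi$. (ABS) From $\Gamma,x{:}\tau\mid\Psi,\phi'\vdash t:\sigma\mid\phi$ infer $\lambda x{:}\tau.t:\tau\to\sigma\mid\forall x.\,\phi'\Rightarrow\phi[\mathbf r\,x/\mathbf r]$. (APP) From $t:\tau\to\sigma\mid\forall x.\,\phi'[x/\mathbf r]\Rightarrow\phi[\mathbf r\,x/\mathbf r]$ and $u:\tau\mid\phi'$ infer $t\,u:\sigma\mid\phi[u/x]$. (Constructors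 with arguments, and pairs) From judgments $t_i:\tau_i\mid\phi_i$ on the arguments and, in HOL, $\forall\vec x.\ \phi_1[x_1/\mathbf r]\Rightarrow\cdots\Rightarrow\phi[C\,\vec x/\mathbf r]$ infer $C\,\vec t:\sigma\mid\phi$. (PROJ) From $t\mid\phi[\pi_i\mathbf r/\mathbf r]$ infer $\pi_i t\mid\phi$. (CASE) For $t$ typable, from $\Psi,t=C\vdash u\mid\phi$ for each constructor $C$ without arguments and $v\mid\forall\vec x.\,t=C\,\vec x\Rightarrow\phi[\mathbf r\,\vec x/\mathbf r]$ for each constructor with arguments, where $u$, $v$ are the respective branches, infer the judgment with $\phi$ on the case distinction. (LETREC) If $\mathrm{Def}(f,x,e)$, from $\Gamma,x{:}I,f{:}I\to\sigma\mid\Psi,\phi',\forall m.\,|m|<|x|\Rightarrow\phi'[m/x]\Rightarrow\phi[m/x][f\,m/\mathbf r]\vdash e:\sigma\mid\phi$ infer $\mathsf{letrec}\ f\ x=e:I\to\sigma\mid\forall x.\,\phi'\Rightarrow\phi[\mathbf r\,x/\mathbf r]$. (SUB) From $t\mid\phi'$ and, in HOL, $\phi'[t/\mathbf r]\Rightarrow\phi[t/\mathbf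 r]$ infer $t\mid\phi$. *RHOL.* Judgments $\Gamma\mid\Psi\vdash t_1:\sigma_1\sim t_2:\sigma_2\mid\phi$ have $\Gamma\vdash t_i:\sigma_i$, $\Psi$ well typed in $\Gamma$ and $\phi$ well typed in $\Gamma,\mathbf r_1:\sigma_1,\mathbf r_2:\sigma_2$. The rules are the following. (i) Two-sided rules for two variables, and for two terms with the same outermost constant, constructor, pairing, projection, abstraction or application: the relational versions of the above rules, with $\mathbf r_1,\mathbf r_2$ in place of $\mathbf r$ and with all bound variables doubled. (ii) One-sided left rules, which decompose only $t_1$ and keep $t_2$ fixed, in the same way (in APP-L the argument $u_1$ is handled by a UHOL premise; in the rules with an HOL premise for constructors with arguments and pairs, $\mathbf r_2$ is replaced by a universally quantified variable; the rule for a variable $x_1$ requires $\phi[x_1/\mathbf r_1]\in\Psi$ for a $\phi$ that does not mention $\mathbf r_2$), and the symmetric right rules. (iii) Structural rules: SUB; from $\phi$ and $\phi'$ for the same terms infer $\phi\wedge\phi'$; from $\Psi,\phi'[t_1/\mathbf r_1][t_2/\mathbf r_2]\vdash t_1\sim t_2\mid\phi$ infer $\phi'\Rightarrow\phi$; from the UHOL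 judgment $t_1:\sigma_1\mid\phi[\mathbf r/\mathbf r_1][t_2/\mathbf r_2]$ infer $t_1\sim t_2\mid\phi$, and symmetrically. (iv) Case rules: synchronous ones for two case distinctions over the same kind of type, whose first premise states that the two scrutinees have the same outermost constructor (for $\mathbb N$: $\mathbf r_1=0\Leftrightarrow\mathbf r_2=0$) and whose remaining premises treat the pairs of equal constructors; the variants of these for $\mathbb N$ and lists in which the first premise has in addition a conjunct $\phi'$ and the hypotheses $t_i=C_i\,\vec x_i$ are replaced by $\phi'[C_1\vec x_1/\mathbf r_1][C_2\vec x_2/\mathbf r_2]$; one-sided ones; and asynchronous ones, for two case distinctions over any of the types $\mathbb B,\mathbb N,\mathrm{list}$, with one premise for each pair of constructors (here $\mathsf{ff}$ is treated through $t_i\neq\mathsf{tt}$). (v) LETREC: if $\mathrm{Def}(f_i,x_i,e_i)$ for $i=1,2$, from $\Gamma,x_1{:}I_1,x_2{:}I_2,f_1{:}I_1\to\sigma_1,f_2{:}I_2\to\sigma_2\mid\Psi,\phi',\forall m_1m_2.\,(|m_1|,|m_2|)<(|x_1|,|x_2|)\Rightarrow\phi'[m_1/x_1][m_2/x_2]\Rightarrow\phi[m_1/x_1][m_2/x_2][f_1m_1/\mathbf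 r_1][f_2m_2/\mathbf r_2]\vdash e_1:\sigma_1\sim e_2:\sigma_2\mid\phi$ infer $\mathsf{letrec}\ f_1\ x_1=e_1:I_1\to\sigma_1\sim\mathsf{letrec}\ f_2\ x_2=e_2:I_2\to\sigma_2\mid\forall x_1x_2.\,\phi'\Rightarrow\phi[\mathbf r_1x_1/\mathbf r_1][\mathbf r_2x_2/\mathbf r_2]$, where $(a,b)<(c,d)$ means $a\le c$, $b\le d$ and ($a<c$ or $b<d$); and the one-sided rules LETREC-L, LETREC-R with induction hypothesis $\forall m_1.\,|m_1|<|x_1|\Rightarrow\phi'[m_1/x_1]\Rightarrow\phi[m_1/x_1][f_1m_1/\mathbf r_1][t_2/\mathbf r_2]$, respectively its mirror image. *Theorem.* Let $\Gamma$ be a context, $\sigma_1,\sigma_2$ simple types and $t_1,t_2$ terms with $\Gamma\vdash t_1:\sigma_1$ and $\Gamma\vdash t_2:\sigma_2$, let $\Psi$ be a set of assertions well typed in $\Gamma$, and let $\phi$ be an assertion well typed in $\Gamma,\mathbf r_1:\sigma_1,\mathbf r_2:\sigma_2$. Then the following are equivalent: 1. $\Gamma\mid\Psi\vdash t_1:\sigma_1\sim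 t_2:\sigma_2\mid\phi$ is derivable in RHOL; 2. $\Gamma\mid\Psi\vdash\phi[t_1/\mathbf r_1][t_2/\mathbf r_2]$ is derivable in HOL. -/

import Mathlib

/-! # PCF with guarded recursion, HOL, unary HOL and relational HOL

Variables are represented by de Bruijn indices; a context is the list of the types of its variables,
the most recently declared variable first: the context written `Γ, x : σ, y : τ` on paper
is `τ :: σ :: Γ`, in which `y` is the variable `0` and `x` the variable `1`. -/

namespace RelLogic

/-! ## Types and terms -/

/-- Simple types. -/
inductive Ty : Type
  | bool : Ty
  | nat : Ty
  | list : Ty → Ty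
  | prod : Ty → Ty → Ty
  | arr : Ty → Ty → Ty

/-- The inductive types over which recursive definitions are allowed: naturals and lists. -/
inductive Ind : Type
  | nat : Ind
  | list : Ty → Ind

/-- The simple type underlying an inductive type. -/
def Ind.ty : Ind → Ty
  | .nat => .nat
  | .list τ => .list τ

abbrev Ctx : Type := List Ty

/-- Raw terms. `lam τ t` is `λ x : τ. t` and binds the variable `0` in `t`. `letrec e` is
`letrec f x = e`; it binds `x` as the variable `0` and `f` as the variable `1` in `e`.
`caseN t u v` is `case t of [0 ↦ u; S ↦ v]`, `caseB t u v` is `case t of [tt ↦ u; ff ↦ v]` and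
`caseL t u v` is `case t of [[] ↦ u; _ :: _ ↦ v]`; the branch `v` for a successor or for
a non-empty list is a function, applied to the arguments of the constructor. -/
inductive Tm : Type
  | var : ℕ → Tm
  | pair : Tm → Tm → Tm
  | proj₁ : Tm → Tm
  | proj₂ : Tm → Tm
  | app : Tm → Tm → Tm
  | lam : Ty → Tm → Tm
  | tt : Tm
  | ff : Tm
  | zero : Tm
  | nil : Tm
  | succ : Tm → Tm
  | cons : Tm → Tm → Tm
  | caseN : Tm → Tm → Tm → Tm
  | caseB : Tm → Tm → Tm → Tm
  | caseL : Tm → Tm → Tm → Tm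
  | letrec : Tm → Tm

/-- Lifting of a renaming under one binder. -/
def upr (ρ : ℕ → ℕ) : ℕ → ℕ
  | 0 => 0
  | n + 1 => ρ n + 1

def Tm.rename : (ℕ → ℕ) → Tm → Tm
  | ρ, .var n => .var (ρ n)
  | ρ, .pair t u => .pair (t.rename ρ) (u.rename ρ)
  | ρ, .proj₁ t => .proj₁ (t.rename ρ)
  | ρ, .proj₂ t => .proj₂ (t.rename ρ)
  | ρ, .app t u => .app (t.rename ρ) (u.rename ρ)
  | ρ, .lam τ t => .lam τ (t.rename (upr ρ))
  | _, .tt => .tt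
  | _, .ff => .ff
  | _, .zero => .zero
  | _, .nil => .nil
  | ρ, .succ t => .succ (t.rename ρ)
  | ρ, .cons t u => .cons (t.rename ρ) (u.rename ρ)
  | ρ, .caseN t u v => .caseN (t.rename ρ) (u.rename ρ) (v.rename ρ)
  | ρ, .caseB t u v => .caseB (t.rename ρ) (u.rename ρ) (v.rename ρ)
  | ρ, .caseL t u v => .caseL (t.rename ρ) (u.rename ρ) (v.rename ρ)
  | ρ, .letrec e => .letrec (e.rename (upr (upr ρ)))

/-- Lifting of a substitution under one binder. -/
def up (s : ℕ → Tm) : ℕ → Tm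
  | 0 => .var 0
  | n + 1 => (s n).rename Nat.succ

/-- Capture-free simultaneous substitution. -/
def Tm.subst : (ℕ → Tm) → Tm → Tm
  | s, .var n => s n
  | s, .pair t u => .pair (t.subst s) (u.subst s)
  | s, .proj₁ t => .proj₁ (t.subst s)
  | s, .proj₂ t => .proj₂ (t.subst s)
  | s, .app t u => .app (t.subst s) (u.subst s)
  | s, .lam τ t => .lam τ (t.subst (up s))
  | _, .tt => .tt
  | _, .ff => .ff
  | _, .zero => .zero
  | _, .nil => .nil
  | s, .succ t => .succ (t.subst s)
  | s, .cons t u => .cons (t.subst s) (u.subst s)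
  | s, .caseN t u v => .caseN (t.subst s) (u.subst s) (v.subst s)
  | s, .caseB t u v => .caseB (t.subst s) (u.subst s) (v.subst s)
  | s, .caseL t u v => .caseL (t.subst s) (u.subst s) (v.subst s)
  | s, .letrec e => .letrec (e.subst (up (up s)))

/-- The substitution that replaces the first variables by the listed terms (the head of the list
replaces the variable `0`) and sends the `n`-th of the remaining variables to the variable
`n + k`. It takes terms and assertions over `Γ` extended by as many variables as there are listed
terms to terms and assertions over `Γ` extended by `k` variables. -/
def sb : List Tm → ℕ → ℕ → Tm
  | [], k, n => .var (n + k)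
  | t :: _, _, 0 => t
  | _ :: ts, k, n + 1 => sb ts k n

/-- Weakening by `k` new variables. -/
def Tm.wk (k : ℕ) (t : Tm) : Tm := t.subst (sb [] k)

/-! ## Reduction and conversion -/

/-- Terms with a constructor in head position. -/
inductive Tm.IsConstr : Tm → Prop
  | tt : IsConstr .tt
  | ff : IsConstr .ff
  | zero : IsConstr .zero
  | succ (t : Tm) : IsConstr (.succ t)
  | nil : IsConstr .nil
  | cons (t u : Tm) : IsConstr (.cons t u)

/-- One-step `βιμ`-reduction: the contextual closure of the reduction rules. -/
inductive Step : Tm → Tm → Prop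
  | beta (τ : Ty) (t u : Tm) : Step (.app (.lam τ t) u) (t.subst (sb [u] 0))
  | proj₁_pair (t u : Tm) : Step (.proj₁ (.pair t u)) t
  | proj₂_pair (t u : Tm) : Step (.proj₂ (.pair t u)) u
  | caseN_zero (u v : Tm) : Step (.caseN .zero u v) u
  | caseN_succ (t u v : Tm) : Step (.caseN (.succ t) u v) (.app v t)
  | caseB_tt (u v : Tm) : Step (.caseB .tt u v) u
  | caseB_ff (u v : Tm) : Step (.caseB .ff u v) v
  | caseL_nil (u v : Tm) : Step (.caseL .nil u v) u
  | caseL_cons (h t u v : Tm) : Step (.caseL (.cons h t) u v) (.app (.app v h) t)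
  | mu (e a : Tm) : a.IsConstr → Step (.app (.letrec e) a) (e.subst (sb [a, .letrec e] 0))
  | pair_left {t t' : Tm} (u : Tm) : Step t t' → Step (.pair t u) (.pair t' u)
  | pair_right (t : Tm) {u u' : Tm} : Step u u' → Step (.pair t u) (.pair t u')
  | proj₁_arg {t t' : Tm} : Step t t' → Step (.proj₁ t) (.proj₁ t')
  | proj₂_arg {t t' : Tm} : Step t t' → Step (.proj₂ t) (.proj₂ t')
  | app_left {t t' : Tm} (u : Tm) : Step t t' → Step (.app t u) (.app t' u)
  | app_right (t : Tm) {u u' : Tm} : Step u u' → Step (.app t u) (.app t u')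
  | lam_body (τ : Ty) {t t' : Tm} : Step t t' → Step (.lam τ t) (.lam τ t')
  | succ_arg {t t' : Tm} : Step t t' → Step (.succ t) (.succ t')
  | cons_left {t t' : Tm} (u : Tm) : Step t t' → Step (.cons t u) (.cons t' u)
  | cons_right (t : Tm) {u u' : Tm} : Step u u' → Step (.cons t u) (.cons t u')
  | caseN_arg {t t' : Tm} (u v : Tm) : Step t t' → Step (.caseN t u v) (.caseN t' u v)
  | caseN_left (t : Tm) {u u' : Tm} (v : Tm) : Step u u' → Step (.caseN t u v) (.caseN t u' v)
  | caseN_right (t u : Tm) {v v' : Tm} : Step v v' → Step (.caseN t u v) (.caseN t u v')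
  | caseB_arg {t t' : Tm} (u v : Tm) : Step t t' → Step (.caseB t u v) (.caseB t' u v)
  | caseB_left (t : Tm) {u u' : Tm} (v : Tm) : Step u u' → Step (.caseB t u v) (.caseB t u' v)
  | caseB_right (t u : Tm) {v v' : Tm} : Step v v' → Step (.caseB t u v) (.caseB t u v')
  | caseL_arg {t t' : Tm} (u v : Tm) : Step t t' → Step (.caseL t u v) (.caseL t' u v)
  | caseL_left (t : Tm) {u u' : Tm} (v : Tm) : Step u u' → Step (.caseL t u v) (.caseL t u' v)
  | caseL_right (t u : Tm) {v v' : Tm} : Step v v' → Step (.caseL t u v) (.caseL t u v')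
  | letrec_body {e e' : Tm} : Step e e' → Step (.letrec e) (.letrec e')

/-- `βιμ`-conversion: the reflexive, symmetric and transitive closure of reduction. -/
def Conv : Tm → Tm → Prop := Relation.EqvGen Step

/-! ## Typing -/

/-- The predicate that the typing rule of recursive definitions imposes on their bodies.
`D Γ I σ e` says that `letrec f x = e`, of type `I → σ` in `Γ`, only makes recursive calls that
the chosen discipline (a syntactic check, sized types, ...) accepts. The calculus is parametric
in it. -/
abbrev Guard : Type := Ctx → Ind → Ty → Tm → Prop

/-- The typing judgment `Γ ⊢ t : τ`. -/
inductive HasType (D : Guard) : Ctx → Tm → Ty → Prop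
  | var {Γ : Ctx} {n : ℕ} {τ : Ty} : Γ[n]? = some τ → HasType D Γ (.var n) τ
  | pair {Γ : Ctx} {t u : Tm} {σ τ : Ty} :
      HasType D Γ t σ → HasType D Γ u τ → HasType D Γ (.pair t u) (.prod σ τ)
  | proj₁ {Γ : Ctx} {t : Tm} {σ τ : Ty} : HasType D Γ t (.prod σ τ) → HasType D Γ (.proj₁ t) σ
  | proj₂ {Γ : Ctx} {t : Tm} {σ τ : Ty} : HasType D Γ t (.prod σ τ) → HasType D Γ (.proj₂ t) τ
  | app {Γ : Ctx} {t u : Tm} {σ τ : Ty} :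
      HasType D Γ t (.arr τ σ) → HasType D Γ u τ → HasType D Γ (.app t u) σ
  | lam {Γ : Ctx} {t : Tm} {σ τ : Ty} :
      HasType D (τ :: Γ) t σ → HasType D Γ (.lam τ t) (.arr τ σ)
  | tt {Γ : Ctx} : HasType D Γ .tt .bool
  | ff {Γ : Ctx} : HasType D Γ .ff .bool
  | zero {Γ : Ctx} : HasType D Γ .zero .nat
  | nil {Γ : Ctx} {τ : Ty} : HasType D Γ .nil (.list τ)
  | succ {Γ : Ctx} {t : Tm} : HasType D Γ t .nat → HasType D Γ (.succ t) .nat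
  | cons {Γ : Ctx} {h t : Tm} {τ : Ty} :
      HasType D Γ h τ → HasType D Γ t (.list τ) → HasType D Γ (.cons h t) (.list τ)
  | caseN {Γ : Ctx} {t u v : Tm} {σ : Ty} :
      HasType D Γ t .nat → HasType D Γ u σ → HasType D Γ v (.arr .nat σ) →
      HasType D Γ (.caseN t u v) σ
  | caseB {Γ : Ctx} {t u v : Tm} {σ : Ty} :
      HasType D Γ t .bool → HasType D Γ u σ → HasType D Γ v σ → HasType D Γ (.caseB t u v) σ
  | caseL {Γ : Ctx} {t u v : Tm} {τ σ : Ty} :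
      HasType D Γ t (.list τ) → HasType D Γ u σ → HasType D Γ v (.arr τ (.arr (.list τ) σ)) →
      HasType D Γ (.caseL t u v) σ
  | letrec {Γ : Ctx} {e : Tm} {I : Ind} {σ : Ty} :
      HasType D (I.ty :: .arr I.ty σ :: Γ) e σ → D Γ I σ e →
      HasType D Γ (.letrec e) (.arr I.ty σ)

/-- The guard predicate is preserved when well-typed terms are substituted for the variables of
the context. Without it a substitution instance of a typable term need not be typable. -/
def Guard.Stable (D : Guard) : Prop :=
  ∀ (Γ Δ : Ctx) (s : ℕ → Tm), (∀ n τ, Γ[n]? = some τ → HasType D Δ (s n) τ) →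
    ∀ (I : Ind) (σ : Ty) (e : Tm), HasType D (I.ty :: .arr I.ty σ :: Γ) e σ →
      D Γ I σ e → D Δ I σ (e.subst (up (up s)))

/-! ## Assertions -/

/-- The basic predicates: equality at each type, the comparison of sizes `|t| ≤ |u|` and
`|t| < |u|` at each inductive type, and the predicate symbols of a signature. -/
inductive PredSym (P : Type*) : Type _
  | eq : Ty → PredSym P
  | le : Ind → PredSym P
  | lt : Ind → PredSym P
  | sym : P → PredSym P

/-- Assertions. `all τ φ` and `ex τ φ` bind the variable `0` in `φ`. -/
inductive Fm (P : Type*) : Type _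
  | atom : PredSym P → List Tm → Fm P
  | top : Fm P
  | bot : Fm P
  | and : Fm P → Fm P → Fm P
  | or : Fm P → Fm P → Fm P
  | imp : Fm P → Fm P → Fm P
  | all : Ty → Fm P → Fm P
  | ex : Ty → Fm P → Fm P

/-- A family of predicate symbols with their arities and their axiomatization. -/
structure Sig where
  Pred : Type*
  arity : Pred → List Ty
  axioms : Set (Fm Pred)

namespace Fm

variable {P : Type*}

/-- Capture-free simultaneous substitution in assertions. -/
def subst : (ℕ → Tm) → Fm P → Fm P
  | s, .atom p ts => .atom p (ts.map (Tm.subst s))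
  | _, .top => .top
  | _, .bot => .bot
  | s, .and φ ψ => .and (φ.subst s) (ψ.subst s)
  | s, .or φ ψ => .or (φ.subst s) (ψ.subst s)
  | s, .imp φ ψ => .imp (φ.subst s) (ψ.subst s)
  | s, .all τ φ => .all τ (φ.subst (up s))
  | s, .ex τ φ => .ex τ (φ.subst (up s))

/-- Weakening by `k` new variables. -/
def wk (k : ℕ) (φ : Fm P) : Fm P := φ.subst (sb [] k)

def eq (τ : Ty) (t u : Tm) : Fm P := .atom (.eq τ) [t, u]
def le (I : Ind) (t u : Tm) : Fm P := .atom (.le I) [t, u]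
def lt (I : Ind) (t u : Tm) : Fm P := .atom (.lt I) [t, u]
def neg (φ : Fm P) : Fm P := .imp φ .bot
def iff (φ ψ : Fm P) : Fm P := .and (.imp φ ψ) (.imp ψ φ)

/-- `(|m₁|, |m₂|) < (|x₁|, |x₂|)`: both components are at most as large, one of them smaller. -/
def lt₂ (I₁ I₂ : Ind) (m₁ m₂ x₁ x₂ : Tm) : Fm P :=
  .and (.and (le I₁ m₁ x₁) (le I₂ m₂ x₂)) (.or (lt I₁ m₁ x₁) (lt I₂ m₂ x₂))

/-- For `φ` over `Γ, r`, the assertion `φ[a/r]` over `Γ` extended by `k` variables. -/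
def inst₁ (φ : Fm P) (k : ℕ) (a : Tm) : Fm P := φ.subst (sb [a] k)

/-- For `φ` over `Γ, r₁, r₂`, the assertion `φ[a/r₁][b/r₂]` over `Γ` extended by `k` variables. -/
def inst₂ (φ : Fm P) (k : ℕ) (a b : Tm) : Fm P := φ.subst (sb [b, a] k)

end Fm

/-- Weakening of a set of assertions by `k` new variables. -/
def wkSet {P : Type*} (k : ℕ) (Ψ : Set (Fm P)) : Set (Fm P) := Fm.wk k '' Ψ

def PredSym.arity (S : Sig) : PredSym S.Pred → List Ty
  | .eq τ => [τ, τ]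
  | .le I => [I.ty, I.ty]
  | .lt I => [I.ty, I.ty]
  | .sym p => S.arity p

/-- Well-typed assertions, `Γ ⊢ φ`. -/
inductive WfFm (D : Guard) (S : Sig) : Ctx → Fm S.Pred → Prop
  | atom {Γ : Ctx} {p : PredSym S.Pred} {ts : List Tm} :
      List.Forall₂ (HasType D Γ) ts (p.arity S) → WfFm D S Γ (.atom p ts)
  | top {Γ : Ctx} : WfFm D S Γ .top
  | bot {Γ : Ctx} : WfFm D S Γ .bot
  | and {Γ : Ctx} {φ ψ : Fm S.Pred} : WfFm D S Γ φ → WfFm D S Γ ψ → WfFm D S Γ (.and φ ψ)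
  | or {Γ : Ctx} {φ ψ : Fm S.Pred} : WfFm D S Γ φ → WfFm D S Γ ψ → WfFm D S Γ (.or φ ψ)
  | imp {Γ : Ctx} {φ ψ : Fm S.Pred} : WfFm D S Γ φ → WfFm D S Γ ψ → WfFm D S Γ (.imp φ ψ)
  | all {Γ : Ctx} {τ : Ty} {φ : Fm S.Pred} : WfFm D S (τ :: Γ) φ → WfFm D S Γ (.all τ φ)
  | ex {Γ : Ctx} {τ : Ty} {φ : Fm S.Pred} : WfFm D S (τ :: Γ) φ → WfFm D S Γ (.ex τ φ)

/-- `Ψ` is a valid set of assertions in `Γ`. -/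
def WfSet (D : Guard) (S : Sig) (Γ : Ctx) (Ψ : Set (Fm S.Pred)) : Prop := ∀ ψ ∈ Ψ, WfFm D S Γ ψ

/-! ## Higher-order logic -/

/-- Well-formed judgments `Γ | Ψ ⊢ φ`. -/
def WfHOL (D : Guard) (S : Sig) (Γ : Ctx) (Ψ : Set (Fm S.Pred)) (φ : Fm S.Pred) : Prop :=
  WfSet D S Γ Ψ ∧ WfFm D S Γ φ

open Tm Fm

/-- Derivability of `Γ | Ψ ⊢ φ` in higher-order logic. The first premise of each rule says that its
conclusion is a well-formed judgment. -/
inductive HOL (D : Guard) (S : Sig) : Ctx → Set (Fm S.Pred) → Fm S.Pred → Prop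
  | ax {Γ Ψ φ} : WfHOL D S Γ Ψ φ → φ ∈ Ψ → HOL D S Γ Ψ φ
  | conv {Γ Ψ τ t t'} : WfHOL D S Γ Ψ (eq τ t t') →
      HasType D Γ t τ → HasType D Γ t' τ → Conv t t' → HOL D S Γ Ψ (eq τ t t')
  | subst {Γ Ψ τ t u φ} : WfHOL D S Γ Ψ (φ.inst₁ 0 u) → WfFm D S (τ :: Γ) φ →
      HOL D S Γ Ψ (φ.inst₁ 0 t) → HOL D S Γ Ψ (eq τ t u) → HOL D S Γ Ψ (φ.inst₁ 0 u)
  | impI {Γ Ψ φ ψ} : WfHOL D S Γ Ψ (.imp ψ φ) →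
      HOL D S Γ (insert ψ Ψ) φ → HOL D S Γ Ψ (.imp ψ φ)
  | impE {Γ Ψ φ ψ} : WfHOL D S Γ Ψ φ →
      HOL D S Γ Ψ (.imp ψ φ) → HOL D S Γ Ψ ψ → HOL D S Γ Ψ φ
  | allI {Γ Ψ σ φ} : WfHOL D S Γ Ψ (.all σ φ) →
      HOL D S (σ :: Γ) (wkSet 1 Ψ) φ → HOL D S Γ Ψ (.all σ φ)
  | allE {Γ Ψ σ φ t} : WfHOL D S Γ Ψ (φ.inst₁ 0 t) →
      HOL D S Γ Ψ (.all σ φ) → HasType D Γ t σ → HOL D S Γ Ψ (φ.inst₁ 0 t)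
  | exI {Γ Ψ σ φ t} : WfHOL D S Γ Ψ (.ex σ φ) →
      HasType D Γ t σ → HOL D S Γ Ψ (φ.inst₁ 0 t) → HOL D S Γ Ψ (.ex σ φ)
  | exE {Γ Ψ σ φ χ} : WfHOL D S Γ Ψ χ →
      HOL D S Γ Ψ (.ex σ φ) → HOL D S (σ :: Γ) (insert φ (wkSet 1 Ψ)) (χ.wk 1) → HOL D S Γ Ψ χ
  | topI {Γ Ψ} : WfHOL D S Γ Ψ .top → HOL D S Γ Ψ .top
  | botE {Γ Ψ φ} : WfHOL D S Γ Ψ φ → HOL D S Γ Ψ .bot → HOL D S Γ Ψ φ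
  | andI {Γ Ψ φ ψ} : WfHOL D S Γ Ψ (.and φ ψ) →
      HOL D S Γ Ψ φ → HOL D S Γ Ψ ψ → HOL D S Γ Ψ (.and φ ψ)
  | andE₁ {Γ Ψ φ ψ} : WfHOL D S Γ Ψ φ → HOL D S Γ Ψ (.and φ ψ) → HOL D S Γ Ψ φ
  | andE₂ {Γ Ψ φ ψ} : WfHOL D S Γ Ψ ψ → HOL D S Γ Ψ (.and φ ψ) → HOL D S Γ Ψ ψ
  | orI₁ {Γ Ψ φ ψ} : WfHOL D S Γ Ψ (.or φ ψ) → HOL D S Γ Ψ φ → HOL D S Γ Ψ (.or φ ψ)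
  | orI₂ {Γ Ψ φ ψ} : WfHOL D S Γ Ψ (.or φ ψ) → HOL D S Γ Ψ ψ → HOL D S Γ Ψ (.or φ ψ)
  | orE {Γ Ψ φ ψ χ} : WfHOL D S Γ Ψ χ → HOL D S Γ Ψ (.or φ ψ) →
      HOL D S Γ (insert φ Ψ) χ → HOL D S Γ (insert ψ Ψ) χ → HOL D S Γ Ψ χ
  /- Induction for booleans, naturals and lists. -/
  | bool {Γ Ψ φ} : WfHOL D S Γ Ψ (.all .bool φ) →
      HOL D S Γ Ψ (φ.inst₁ 0 .tt) → HOL D S Γ Ψ (φ.inst₁ 0 .ff) → HOL D S Γ Ψ (.all .bool φ)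
  | nat {Γ Ψ φ} : WfHOL D S Γ Ψ (.all .nat φ) →
      HOL D S Γ Ψ (φ.inst₁ 0 .zero) →
      HOL D S (.nat :: Γ) (insert (φ.inst₁ 1 (var 0)) (wkSet 1 Ψ)) (φ.inst₁ 1 (.succ (var 0))) →
      HOL D S Γ Ψ (.all .nat φ)
  | list {Γ Ψ τ φ} : WfHOL D S Γ Ψ (.all (.list τ) φ) →
      HOL D S Γ Ψ (φ.inst₁ 0 .nil) →
      HOL D S (.list τ :: τ :: Γ) (insert (φ.inst₁ 2 (var 0)) (wkSet 2 Ψ))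
        (φ.inst₁ 2 (.cons (var 1) (var 0))) →
      HOL D S Γ Ψ (.all (.list τ) φ)
  /- Non-overlap and injectivity of constructors. -/
  | ncBool {Γ Ψ} : WfHOL D S Γ Ψ (neg (eq .bool .tt .ff)) → HOL D S Γ Ψ (neg (eq .bool .tt .ff))
  | ncNat {Γ Ψ t} : WfHOL D S Γ Ψ (neg (eq .nat .zero (.succ t))) →
      HOL D S Γ Ψ (neg (eq .nat .zero (.succ t)))
  | ncList {Γ Ψ τ h t} : WfHOL D S Γ Ψ (neg (eq (.list τ) .nil (.cons h t))) →
      HOL D S Γ Ψ (neg (eq (.list τ) .nil (.cons h t)))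
  | injSucc {Γ Ψ t t'} : WfHOL D S Γ Ψ (eq .nat t t') →
      HOL D S Γ Ψ (eq .nat (.succ t) (.succ t')) → HOL D S Γ Ψ (eq .nat t t')
  | injCons₁ {Γ Ψ τ h t h' t'} : WfHOL D S Γ Ψ (eq τ h h') →
      HOL D S Γ Ψ (eq (.list τ) (.cons h t) (.cons h' t')) → HOL D S Γ Ψ (eq τ h h')
  | injCons₂ {Γ Ψ τ h t h' t'} : WfHOL D S Γ Ψ (eq (.list τ) t t') →
      HOL D S Γ Ψ (eq (.list τ) (.cons h t) (.cons h' t')) → HOL D S Γ Ψ (eq (.list τ) t t')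
  /- The axioms that determine the comparison of sizes. -/
  | ltZero {Γ Ψ t} : WfHOL D S Γ Ψ (neg (lt .nat t .zero)) → HOL D S Γ Ψ (neg (lt .nat t .zero))
  | ltSucc {Γ Ψ t u} : WfHOL D S Γ Ψ (iff (lt .nat t (.succ u)) (le .nat t u)) →
      HOL D S Γ Ψ (iff (lt .nat t (.succ u)) (le .nat t u))
  | zeroLe {Γ Ψ t} : WfHOL D S Γ Ψ (le .nat .zero t) → HOL D S Γ Ψ (le .nat .zero t)
  | succLe {Γ Ψ t u} : WfHOL D S Γ Ψ (iff (le .nat (.succ t) u) (lt .nat t u)) →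
      HOL D S Γ Ψ (iff (le .nat (.succ t) u) (lt .nat t u))
  | ltNil {Γ Ψ τ t} : WfHOL D S Γ Ψ (neg (lt (.list τ) t .nil)) →
      HOL D S Γ Ψ (neg (lt (.list τ) t .nil))
  | ltCons {Γ Ψ τ t h u} : WfHOL D S Γ Ψ (iff (lt (.list τ) t (.cons h u)) (le (.list τ) t u)) →
      HOL D S Γ Ψ (iff (lt (.list τ) t (.cons h u)) (le (.list τ) t u))
  | nilLe {Γ Ψ τ t} : WfHOL D S Γ Ψ (le (.list τ) .nil t) → HOL D S Γ Ψ (le (.list τ) .nil t)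
  | consLe {Γ Ψ τ h t u} : WfHOL D S Γ Ψ (iff (le (.list τ) (.cons h t) u) (lt (.list τ) t u)) →
      HOL D S Γ Ψ (iff (le (.list τ) (.cons h t) u) (lt (.list τ) t u))
  /- The axioms of the predicates of the signature; they are closed assertions. -/
  | sig {Γ Ψ φ} : WfHOL D S Γ Ψ φ → φ ∈ S.axioms → WfFm D S [] φ → HOL D S Γ Ψ φ

/-! ## Unary higher-order logic -/

/-- Well-formed judgments `Γ | Ψ ⊢ t : σ | φ`; here `φ` is an assertion over `Γ, r : σ`. -/
def WfUHOL (D : Guard) (S : Sig) (Γ : Ctx) (Ψ : Set (Fm S.Pred)) (t : Tm) (σ : Ty)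
    (φ : Fm S.Pred) : Prop :=
  WfSet D S Γ Ψ ∧ HasType D Γ t σ ∧ WfFm D S (σ :: Γ) φ

/-- `∀ x : τ. φ' ⇒ φ[r x / r]` over `Γ, r`, for `φ'` over `Γ, x` and `φ` over `Γ, x, r`. -/
def funU {P : Type*} (τ : Ty) (φ' φ : Fm P) : Fm P :=
  .all τ (.imp (φ'.subst (sb [var 0] 2)) (φ.subst (sb [app (var 1) (var 0), var 0] 2)))

/-- `∀ x. t = S x ⇒ φ[r x / r]` over `Γ, r`, for `φ` over `Γ, r` and `t` over `Γ`. -/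
def branchNatU {P : Type*} (t : Tm) (φ : Fm P) : Fm P :=
  .all .nat (.imp (eq .nat (t.wk 2) (.succ (var 0))) (φ.inst₁ 2 (app (var 1) (var 0))))

/-- `∀ h l. t = h :: l ⇒ φ[r h l / r]` over `Γ, r`, for `φ` over `Γ, r` and `t` over `Γ`. -/
def branchListU {P : Type*} (τ : Ty) (t : Tm) (φ : Fm P) : Fm P :=
  .all τ (.all (.list τ) (.imp (eq (.list τ) (t.wk 3) (.cons (var 1) (var 0)))
    (φ.inst₁ 3 (app (app (var 2) (var 1)) (var 0)))))

/-- Derivability of `Γ | Ψ ⊢ t : σ | φ` in unary higher-order logic. The first premise of each rule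
says that its conclusion is a well-formed judgment. -/
inductive UHOL (D : Guard) (S : Sig) :
    Ctx → Set (Fm S.Pred) → Tm → Ty → Fm S.Pred → Prop
  | var {Γ Ψ n σ φ} : WfUHOL D S Γ Ψ (var n) σ φ →
      HOL D S Γ Ψ (φ.inst₁ 0 (var n)) → UHOL D S Γ Ψ (var n) σ φ
  | abs {Γ Ψ t τ σ φ' φ} : WfUHOL D S Γ Ψ (lam τ t) (.arr τ σ) (funU τ φ' φ) →
      UHOL D S (τ :: Γ) (insert φ' (wkSet 1 Ψ)) t σ φ →
      UHOL D S Γ Ψ (lam τ t) (.arr τ σ) (funU τ φ' φ)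
  /- `φ'` is over `Γ, r` and `φ` over `Γ, x, r`; the conclusion is about `φ[u/x]`. -/
  | app {Γ Ψ t u τ σ φ' φ} :
      WfUHOL D S Γ Ψ (app t u) σ (φ.subst (sb [.var 0, u.wk 1] 1)) →
      WfFm D S (σ :: τ :: Γ) φ →
      UHOL D S Γ Ψ t (.arr τ σ) (funU τ φ' φ) →
      UHOL D S Γ Ψ u τ φ' →
      UHOL D S Γ Ψ (app t u) σ (φ.subst (sb [.var 0, u.wk 1] 1))
  | tt {Γ Ψ φ} : WfUHOL D S Γ Ψ .tt .bool φ →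
      HOL D S Γ Ψ (φ.inst₁ 0 .tt) → UHOL D S Γ Ψ .tt .bool φ
  | ff {Γ Ψ φ} : WfUHOL D S Γ Ψ .ff .bool φ →
      HOL D S Γ Ψ (φ.inst₁ 0 .ff) → UHOL D S Γ Ψ .ff .bool φ
  | zero {Γ Ψ φ} : WfUHOL D S Γ Ψ .zero .nat φ →
      HOL D S Γ Ψ (φ.inst₁ 0 .zero) → UHOL D S Γ Ψ .zero .nat φ
  | nil {Γ Ψ σ φ} : WfUHOL D S Γ Ψ .nil (.list σ) φ →
      HOL D S Γ Ψ (φ.inst₁ 0 .nil) → UHOL D S Γ Ψ .nil (.list σ) φ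
  | succ {Γ Ψ t φ' φ} : WfUHOL D S Γ Ψ (.succ t) .nat φ →
      UHOL D S Γ Ψ t .nat φ' →
      HOL D S Γ Ψ (.all .nat (.imp (φ'.inst₁ 1 (.var 0)) (φ.inst₁ 1 (.succ (.var 0))))) →
      UHOL D S Γ Ψ (.succ t) .nat φ
  | cons {Γ Ψ h t σ φ' φ'' φ} : WfUHOL D S Γ Ψ (.cons h t) (.list σ) φ →
      UHOL D S Γ Ψ h σ φ' → UHOL D S Γ Ψ t (.list σ) φ'' →
      HOL D S Γ Ψ (.all σ (.all (.list σ) (.imp (φ'.inst₁ 2 (.var 1))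
        (.imp (φ''.inst₁ 2 (.var 0)) (φ.inst₁ 2 (.cons (.var 1) (.var 0))))))) →
      UHOL D S Γ Ψ (.cons h t) (.list σ) φ
  | pair {Γ Ψ t u σ τ φ' φ'' φ} : WfUHOL D S Γ Ψ (.pair t u) (.prod σ τ) φ →
      UHOL D S Γ Ψ t σ φ' → UHOL D S Γ Ψ u τ φ'' →
      HOL D S Γ Ψ (.all σ (.all τ (.imp (φ'.inst₁ 2 (.var 1))
        (.imp (φ''.inst₁ 2 (.var 0)) (φ.inst₁ 2 (.pair (.var 1) (.var 0))))))) →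
      UHOL D S Γ Ψ (.pair t u) (.prod σ τ) φ
  | proj₁ {Γ Ψ t σ τ φ} : WfUHOL D S Γ Ψ (.proj₁ t) σ φ →
      UHOL D S Γ Ψ t (.prod σ τ) (φ.inst₁ 1 (.proj₁ (.var 0))) → UHOL D S Γ Ψ (.proj₁ t) σ φ
  | proj₂ {Γ Ψ t σ τ φ} : WfUHOL D S Γ Ψ (.proj₂ t) τ φ →
      UHOL D S Γ Ψ t (.prod σ τ) (φ.inst₁ 1 (.proj₂ (.var 0))) → UHOL D S Γ Ψ (.proj₂ t) τ φ
  | sub {Γ Ψ t σ φ' φ} : WfUHOL D S Γ Ψ t σ φ →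
      UHOL D S Γ Ψ t σ φ' → HOL D S Γ Ψ (.imp (φ'.inst₁ 0 t) (φ.inst₁ 0 t)) →
      UHOL D S Γ Ψ t σ φ
  | boolCase {Γ Ψ t u v σ φ} : WfUHOL D S Γ Ψ (.caseB t u v) σ φ →
      HasType D Γ t .bool →
      UHOL D S Γ (insert (eq .bool t .tt) Ψ) u σ φ →
      UHOL D S Γ (insert (eq .bool t .ff) Ψ) v σ φ →
      UHOL D S Γ Ψ (.caseB t u v) σ φ
  | natCase {Γ Ψ t u v σ φ} : WfUHOL D S Γ Ψ (.caseN t u v) σ φ →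
      HasType D Γ t .nat →
      UHOL D S Γ (insert (eq .nat t .zero) Ψ) u σ φ →
      UHOL D S Γ Ψ v (.arr .nat σ) (branchNatU t φ) →
      UHOL D S Γ Ψ (.caseN t u v) σ φ
  | listCase {Γ Ψ t u v τ σ φ} : WfUHOL D S Γ Ψ (.caseL t u v) σ φ →
      HasType D Γ t (.list τ) →
      UHOL D S Γ (insert (eq (.list τ) t .nil) Ψ) u σ φ →
      UHOL D S Γ Ψ v (.arr τ (.arr (.list τ) σ)) (branchListU τ t φ) →
      UHOL D S Γ Ψ (.caseL t u v) σ φ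
  /- `φ'` is over `Γ, x` and `φ` over `Γ, x, r`; the premise is over `Γ, x, f`, with the hypotheses
  `φ'` and `∀ m. |m| < |x| ⇒ φ'[m/x] ⇒ φ[m/x][f m/r]`. -/
  | letrec {Γ Ψ e σ φ' φ} {I : Ind} :
      WfUHOL D S Γ Ψ (.letrec e) (.arr I.ty σ) (funU I.ty φ' φ) →
      WfFm D S (I.ty :: Γ) φ' → WfFm D S (σ :: I.ty :: Γ) φ →
      D Γ I σ e →
      UHOL D S (.arr I.ty σ :: I.ty :: Γ)
        (insert (φ'.subst (sb [.var 1] 2))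
          (insert (.all I.ty (.imp (lt I (.var 0) (.var 2)) (.imp (φ'.subst (sb [.var 0] 3))
              (φ.subst (sb [.app (.var 1) (.var 0), .var 0] 3)))))
            (wkSet 2 Ψ)))
        (e.subst (sb [.var 1, .var 0] 2)) σ (φ.subst (sb [.var 0, .var 2] 3)) →
      UHOL D S Γ Ψ (.letrec e) (.arr I.ty σ) (funU I.ty φ' φ)

/-! ## Relational higher-order logic -/

/-- Well-formed judgments `Γ | Ψ ⊢ t₁ : σ₁ ∼ t₂ : σ₂ | φ`; here `φ` is an assertion over
`Γ, r₁ : σ₁, r₂ : σ₂`. -/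
def WfRHOL (D : Guard) (S : Sig) (Γ : Ctx) (Ψ : Set (Fm S.Pred)) (t₁ : Tm) (σ₁ : Ty)
    (t₂ : Tm) (σ₂ : Ty) (φ : Fm S.Pred) : Prop :=
  WfSet D S Γ Ψ ∧ HasType D Γ t₁ σ₁ ∧ HasType D Γ t₂ σ₂ ∧ WfFm D S (σ₂ :: σ₁ :: Γ) φ

section

variable {P : Type*}

/-- `∀ x₁ : τ₁, x₂ : τ₂. φ' ⇒ φ[r₁ x₁ / r₁][r₂ x₂ / r₂]` over `Γ, r₁, r₂`, for `φ'` over `Γ, x₁, x₂`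
and `φ` over `Γ, x₁, x₂, r₁, r₂`. -/
def funLR (τ₁ τ₂ : Ty) (φ' φ : Fm P) : Fm P :=
  .all τ₁ (.all τ₂ (.imp (φ'.subst (sb [var 0, var 1] 4))
    (φ.subst (sb [app (var 2) (var 0), app (var 3) (var 1), var 0, var 1] 4))))

/-- `∀ x₁ : τ₁. φ' ⇒ φ[r₁ x₁ / r₁]` over `Γ, r₁, r₂`, for `φ'` over `Γ, x₁` and `φ` over
`Γ, x₁, r₁, r₂`. -/
def funL (τ₁ : Ty) (φ' φ : Fm P) : Fm P :=
  .all τ₁ (.imp (φ'.subst (sb [var 0] 3))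
    (φ.subst (sb [var 1, app (var 2) (var 0), var 0] 3)))

/-- `∀ x₂ : τ₂. φ' ⇒ φ[r₂ x₂ / r₂]` over `Γ, r₁, r₂`, for `φ'` over `Γ, x₂` and `φ` over
`Γ, x₂, r₁, r₂`. -/
def funR (τ₂ : Ty) (φ' φ : Fm P) : Fm P :=
  .all τ₂ (.imp (φ'.subst (sb [var 0] 3))
    (φ.subst (sb [app (var 1) (var 0), var 2, var 0] 3)))

/-! The assertions below are over `Γ, r₁, r₂`, for `φ` over `Γ, r₁, r₂` and `t₁`, `t₂` over `Γ`. -/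

/-- `∀ x₁. t₁ = S x₁ ⇒ φ[r₁ x₁ / r₁]` -/
def branchNatL (t₁ : Tm) (φ : Fm P) : Fm P :=
  .all .nat (.imp (eq .nat (t₁.wk 3) (.succ (var 0)))
    (φ.inst₂ 3 (app (var 2) (var 0)) (var 1)))

/-- `∀ x₂. t₂ = S x₂ ⇒ φ[r₂ x₂ / r₂]` -/
def branchNatR (t₂ : Tm) (φ : Fm P) : Fm P :=
  .all .nat (.imp (eq .nat (t₂.wk 3) (.succ (var 0)))
    (φ.inst₂ 3 (var 2) (app (var 1) (var 0))))

/-- `∀ h₁ l₁. t₁ = h₁ :: l₁ ⇒ φ[r₁ h₁ l₁ / r₁]` -/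
def branchListL (τ₁ : Ty) (t₁ : Tm) (φ : Fm P) : Fm P :=
  .all τ₁ (.all (.list τ₁) (.imp (eq (.list τ₁) (t₁.wk 4) (.cons (var 1) (var 0)))
    (φ.inst₂ 4 (app (app (var 3) (var 1)) (var 0)) (var 2))))

/-- `∀ h₂ l₂. t₂ = h₂ :: l₂ ⇒ φ[r₂ h₂ l₂ / r₂]` -/
def branchListR (τ₂ : Ty) (t₂ : Tm) (φ : Fm P) : Fm P :=
  .all τ₂ (.all (.list τ₂) (.imp (eq (.list τ₂) (t₂.wk 4) (.cons (var 1) (var 0)))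
    (φ.inst₂ 4 (var 3) (app (app (var 2) (var 1)) (var 0)))))

/-- `∀ x₁ x₂. t₁ = S x₁ ⇒ t₂ = S x₂ ⇒ φ[r₁ x₁ / r₁][r₂ x₂ / r₂]` -/
def branchNatNat (t₁ t₂ : Tm) (φ : Fm P) : Fm P :=
  .all .nat (.all .nat (.imp (eq .nat (t₁.wk 4) (.succ (var 1)))
    (.imp (eq .nat (t₂.wk 4) (.succ (var 0)))
      (φ.inst₂ 4 (app (var 3) (var 1)) (app (var 2) (var 0))))))

/-- `∀ h₁ h₂ l₁ l₂. t₁ = h₁ :: l₁ ⇒ t₂ = h₂ :: l₂ ⇒ φ[r₁ h₁ l₁ / r₁][r₂ h₂ l₂ / r₂]` -/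
def branchListList (τ₁ τ₂ : Ty) (t₁ t₂ : Tm) (φ : Fm P) : Fm P :=
  .all τ₁ (.all τ₂ (.all (.list τ₁) (.all (.list τ₂)
    (.imp (eq (.list τ₁) (t₁.wk 6) (.cons (var 3) (var 1)))
      (.imp (eq (.list τ₂) (t₂.wk 6) (.cons (var 2) (var 0)))
        (φ.inst₂ 6 (app (app (var 5) (var 3)) (var 1)) (app (app (var 4) (var 2)) (var 0))))))))

/-- `∀ x₁ h₂ l₂. t₁ = S x₁ ⇒ t₂ = h₂ :: l₂ ⇒ φ[r₁ x₁ / r₁][r₂ h₂ l₂ / r₂]` -/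
def branchNatList (τ₂ : Ty) (t₁ t₂ : Tm) (φ : Fm P) : Fm P :=
  .all .nat (.all τ₂ (.all (.list τ₂)
    (.imp (eq .nat (t₁.wk 5) (.succ (var 2)))
      (.imp (eq (.list τ₂) (t₂.wk 5) (.cons (var 1) (var 0)))
        (φ.inst₂ 5 (app (var 4) (var 2)) (app (app (var 3) (var 1)) (var 0)))))))

/-- `∀ h₁ l₁ x₂. t₁ = h₁ :: l₁ ⇒ t₂ = S x₂ ⇒ φ[r₁ h₁ l₁ / r₁][r₂ x₂ / r₂]` -/
def branchListNat (τ₁ : Ty) (t₁ t₂ : Tm) (φ : Fm P) : Fm P :=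
  .all τ₁ (.all (.list τ₁) (.all .nat
    (.imp (eq (.list τ₁) (t₁.wk 5) (.cons (var 2) (var 1)))
      (.imp (eq .nat (t₂.wk 5) (.succ (var 0)))
        (φ.inst₂ 5 (app (app (var 4) (var 2)) (var 1)) (app (var 3) (var 0)))))))

end

/-- Derivability of `Γ | Ψ ⊢ t₁ : σ₁ ∼ t₂ : σ₂ | φ` in relational higher-order logic. The first
premise of each rule says that its conclusion is a well-formed judgment. -/
inductive RHOL (D : Guard) (S : Sig) :
    Ctx → Set (Fm S.Pred) → Tm → Ty → Tm → Ty → Fm S.Pred → Prop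
  /- Two-sided rules. -/
  | abs {Γ Ψ t₁ τ₁ σ₁ t₂ τ₂ σ₂ φ' φ} :
      WfRHOL D S Γ Ψ (lam τ₁ t₁) (.arr τ₁ σ₁) (lam τ₂ t₂) (.arr τ₂ σ₂) (funLR τ₁ τ₂ φ' φ) →
      RHOL D S (τ₂ :: τ₁ :: Γ) (insert φ' (wkSet 2 Ψ))
        (t₁.subst (sb [.var 1] 2)) σ₁ (t₂.subst (sb [.var 0] 2)) σ₂ φ →
      RHOL D S Γ Ψ (lam τ₁ t₁) (.arr τ₁ σ₁) (lam τ₂ t₂) (.arr τ₂ σ₂) (funLR τ₁ τ₂ φ' φ)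
  /- `φ'` is over `Γ, r₁, r₂` and `φ` over `Γ, x₁, x₂, r₁, r₂`; the conclusion is about
  `φ[u₁/x₁][u₂/x₂]`. -/
  | app {Γ Ψ t₁ u₁ τ₁ σ₁ t₂ u₂ τ₂ σ₂ φ' φ} :
      WfRHOL D S Γ Ψ (app t₁ u₁) σ₁ (app t₂ u₂) σ₂
        (φ.subst (sb [.var 0, .var 1, u₂.wk 2, u₁.wk 2] 2)) →
      WfFm D S (σ₂ :: σ₁ :: τ₂ :: τ₁ :: Γ) φ →
      RHOL D S Γ Ψ t₁ (.arr τ₁ σ₁) t₂ (.arr τ₂ σ₂) (funLR τ₁ τ₂ φ' φ) →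
      RHOL D S Γ Ψ u₁ τ₁ u₂ τ₂ φ' →
      RHOL D S Γ Ψ (app t₁ u₁) σ₁ (app t₂ u₂) σ₂
        (φ.subst (sb [.var 0, .var 1, u₂.wk 2, u₁.wk 2] 2))
  | var {Γ Ψ n₁ σ₁ n₂ σ₂ φ} : WfRHOL D S Γ Ψ (.var n₁) σ₁ (.var n₂) σ₂ φ →
      HOL D S Γ Ψ (φ.inst₂ 0 (.var n₁) (.var n₂)) → RHOL D S Γ Ψ (.var n₁) σ₁ (.var n₂) σ₂ φ
  | tt {Γ Ψ φ} : WfRHOL D S Γ Ψ .tt .bool .tt .bool φ →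
      HOL D S Γ Ψ (φ.inst₂ 0 .tt .tt) → RHOL D S Γ Ψ .tt .bool .tt .bool φ
  | ff {Γ Ψ φ} : WfRHOL D S Γ Ψ .ff .bool .ff .bool φ →
      HOL D S Γ Ψ (φ.inst₂ 0 .ff .ff) → RHOL D S Γ Ψ .ff .bool .ff .bool φ
  | zero {Γ Ψ φ} : WfRHOL D S Γ Ψ .zero .nat .zero .nat φ →
      HOL D S Γ Ψ (φ.inst₂ 0 .zero .zero) → RHOL D S Γ Ψ .zero .nat .zero .nat φ
  | nil {Γ Ψ σ₁ σ₂ φ} : WfRHOL D S Γ Ψ .nil (.list σ₁) .nil (.list σ₂) φ →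
      HOL D S Γ Ψ (φ.inst₂ 0 .nil .nil) → RHOL D S Γ Ψ .nil (.list σ₁) .nil (.list σ₂) φ
  | succ {Γ Ψ t₁ t₂ φ' φ} : WfRHOL D S Γ Ψ (.succ t₁) .nat (.succ t₂) .nat φ →
      RHOL D S Γ Ψ t₁ .nat t₂ .nat φ' →
      HOL D S Γ Ψ (.all .nat (.all .nat (.imp (φ'.inst₂ 2 (.var 1) (.var 0))
        (φ.inst₂ 2 (.succ (.var 1)) (.succ (.var 0)))))) →
      RHOL D S Γ Ψ (.succ t₁) .nat (.succ t₂) .nat φ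
  | cons {Γ Ψ h₁ t₁ σ₁ h₂ t₂ σ₂ φ' φ'' φ} :
      WfRHOL D S Γ Ψ (.cons h₁ t₁) (.list σ₁) (.cons h₂ t₂) (.list σ₂) φ →
      RHOL D S Γ Ψ h₁ σ₁ h₂ σ₂ φ' →
      RHOL D S Γ Ψ t₁ (.list σ₁) t₂ (.list σ₂) φ'' →
      HOL D S Γ Ψ (.all σ₁ (.all σ₂ (.all (.list σ₁) (.all (.list σ₂)
        (.imp (φ'.inst₂ 4 (.var 3) (.var 2)) (.imp (φ''.inst₂ 4 (.var 1) (.var 0))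
          (φ.inst₂ 4 (.cons (.var 3) (.var 1)) (.cons (.var 2) (.var 0))))))))) →
      RHOL D S Γ Ψ (.cons h₁ t₁) (.list σ₁) (.cons h₂ t₂) (.list σ₂) φ
  | pair {Γ Ψ t₁ u₁ σ₁ τ₁ t₂ u₂ σ₂ τ₂ φ' φ'' φ} :
      WfRHOL D S Γ Ψ (.pair t₁ u₁) (.prod σ₁ τ₁) (.pair t₂ u₂) (.prod σ₂ τ₂) φ →
      RHOL D S Γ Ψ t₁ σ₁ t₂ σ₂ φ' →
      RHOL D S Γ Ψ u₁ τ₁ u₂ τ₂ φ'' →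
      HOL D S Γ Ψ (.all σ₁ (.all σ₂ (.all τ₁ (.all τ₂
        (.imp (φ'.inst₂ 4 (.var 3) (.var 2)) (.imp (φ''.inst₂ 4 (.var 1) (.var 0))
          (φ.inst₂ 4 (.pair (.var 3) (.var 1)) (.pair (.var 2) (.var 0))))))))) →
      RHOL D S Γ Ψ (.pair t₁ u₁) (.prod σ₁ τ₁) (.pair t₂ u₂) (.prod σ₂ τ₂) φ
  | proj₁ {Γ Ψ t₁ σ₁ τ₁ t₂ σ₂ τ₂ φ} : WfRHOL D S Γ Ψ (.proj₁ t₁) σ₁ (.proj₁ t₂) σ₂ φ →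
      RHOL D S Γ Ψ t₁ (.prod σ₁ τ₁) t₂ (.prod σ₂ τ₂)
        (φ.inst₂ 2 (.proj₁ (.var 1)) (.proj₁ (.var 0))) →
      RHOL D S Γ Ψ (.proj₁ t₁) σ₁ (.proj₁ t₂) σ₂ φ
  | proj₂ {Γ Ψ t₁ σ₁ τ₁ t₂ σ₂ τ₂ φ} : WfRHOL D S Γ Ψ (.proj₂ t₁) τ₁ (.proj₂ t₂) τ₂ φ →
      RHOL D S Γ Ψ t₁ (.prod σ₁ τ₁) t₂ (.prod σ₂ τ₂)
        (φ.inst₂ 2 (.proj₂ (.var 1)) (.proj₂ (.var 0))) →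
      RHOL D S Γ Ψ (.proj₂ t₁) τ₁ (.proj₂ t₂) τ₂ φ
  /- Structural rules. -/
  | sub {Γ Ψ t₁ σ₁ t₂ σ₂ φ' φ} : WfRHOL D S Γ Ψ t₁ σ₁ t₂ σ₂ φ →
      RHOL D S Γ Ψ t₁ σ₁ t₂ σ₂ φ' →
      HOL D S Γ Ψ (.imp (φ'.inst₂ 0 t₁ t₂) (φ.inst₂ 0 t₁ t₂)) →
      RHOL D S Γ Ψ t₁ σ₁ t₂ σ₂ φ
  | andI {Γ Ψ t₁ σ₁ t₂ σ₂ φ φ'} : WfRHOL D S Γ Ψ t₁ σ₁ t₂ σ₂ (.and φ φ') →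
      RHOL D S Γ Ψ t₁ σ₁ t₂ σ₂ φ → RHOL D S Γ Ψ t₁ σ₁ t₂ σ₂ φ' →
      RHOL D S Γ Ψ t₁ σ₁ t₂ σ₂ (.and φ φ')
  | impI {Γ Ψ t₁ σ₁ t₂ σ₂ φ' φ} : WfRHOL D S Γ Ψ t₁ σ₁ t₂ σ₂ (.imp φ' φ) →
      RHOL D S Γ (insert (φ'.inst₂ 0 t₁ t₂) Ψ) t₁ σ₁ t₂ σ₂ φ →
      RHOL D S Γ Ψ t₁ σ₁ t₂ σ₂ (.imp φ' φ)
  | uholL {Γ Ψ t₁ σ₁ t₂ σ₂ φ} : WfRHOL D S Γ Ψ t₁ σ₁ t₂ σ₂ φ →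
      UHOL D S Γ Ψ t₁ σ₁ (φ.inst₂ 1 (.var 0) (t₂.wk 1)) → RHOL D S Γ Ψ t₁ σ₁ t₂ σ₂ φ
  | uholR {Γ Ψ t₁ σ₁ t₂ σ₂ φ} : WfRHOL D S Γ Ψ t₁ σ₁ t₂ σ₂ φ →
      UHOL D S Γ Ψ t₂ σ₂ (φ.inst₂ 1 (t₁.wk 1) (.var 0)) → RHOL D S Γ Ψ t₁ σ₁ t₂ σ₂ φ
  /- One-sided rules, left. -/
  | absL {Γ Ψ t₁ τ₁ σ₁ t₂ σ₂ φ' φ} :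
      WfRHOL D S Γ Ψ (lam τ₁ t₁) (.arr τ₁ σ₁) t₂ σ₂ (funL τ₁ φ' φ) →
      RHOL D S (τ₁ :: Γ) (insert φ' (wkSet 1 Ψ)) t₁ σ₁ (t₂.wk 1) σ₂ φ →
      RHOL D S Γ Ψ (lam τ₁ t₁) (.arr τ₁ σ₁) t₂ σ₂ (funL τ₁ φ' φ)
  /- `φ'` is non-relational, over `Γ, r`, and `φ` is over `Γ, x₁, r₁, r₂`; the conclusion is about
  `φ[u₁/x₁]`. -/
  | appL {Γ Ψ t₁ u₁ τ₁ σ₁ u₂ σ₂ φ' φ} :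
      WfRHOL D S Γ Ψ (app t₁ u₁) σ₁ u₂ σ₂ (φ.subst (sb [.var 0, .var 1, u₁.wk 2] 2)) →
      WfFm D S (σ₂ :: σ₁ :: τ₁ :: Γ) φ →
      RHOL D S Γ Ψ t₁ (.arr τ₁ σ₁) u₂ σ₂ (funL τ₁ φ' φ) →
      UHOL D S Γ Ψ u₁ τ₁ φ' →
      RHOL D S Γ Ψ (app t₁ u₁) σ₁ u₂ σ₂ (φ.subst (sb [.var 0, .var 1, u₁.wk 2] 2))
  /- The assertion does not mention `r₂`: it is `φ` over `Γ, r₁`. -/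
  | varL {Γ Ψ n₁ σ₁ t₂ σ₂ φ} :
      WfRHOL D S Γ Ψ (.var n₁) σ₁ t₂ σ₂ (φ.inst₁ 2 (.var 1)) → WfFm D S (σ₁ :: Γ) φ →
      φ.inst₁ 0 (.var n₁) ∈ Ψ → RHOL D S Γ Ψ (.var n₁) σ₁ t₂ σ₂ (φ.inst₁ 2 (.var 1))
  | ttL {Γ Ψ t₂ σ₂ φ} : WfRHOL D S Γ Ψ .tt .bool t₂ σ₂ φ →
      HOL D S Γ Ψ (φ.inst₂ 0 .tt t₂) → RHOL D S Γ Ψ .tt .bool t₂ σ₂ φ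
  | ffL {Γ Ψ t₂ σ₂ φ} : WfRHOL D S Γ Ψ .ff .bool t₂ σ₂ φ →
      HOL D S Γ Ψ (φ.inst₂ 0 .ff t₂) → RHOL D S Γ Ψ .ff .bool t₂ σ₂ φ
  | zeroL {Γ Ψ t₂ σ₂ φ} : WfRHOL D S Γ Ψ .zero .nat t₂ σ₂ φ →
      HOL D S Γ Ψ (φ.inst₂ 0 .zero t₂) → RHOL D S Γ Ψ .zero .nat t₂ σ₂ φ
  | nilL {Γ Ψ σ₁ t₂ σ₂ φ} : WfRHOL D S Γ Ψ .nil (.list σ₁) t₂ σ₂ φ →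
      HOL D S Γ Ψ (φ.inst₂ 0 .nil t₂) → RHOL D S Γ Ψ .nil (.list σ₁) t₂ σ₂ φ
  | succL {Γ Ψ t₁ t₂ σ₂ φ' φ} : WfRHOL D S Γ Ψ (.succ t₁) .nat t₂ σ₂ φ →
      RHOL D S Γ Ψ t₁ .nat t₂ σ₂ φ' →
      HOL D S Γ Ψ (.all .nat (.all σ₂ (.imp (φ'.inst₂ 2 (.var 1) (.var 0))
        (φ.inst₂ 2 (.succ (.var 1)) (.var 0))))) →
      RHOL D S Γ Ψ (.succ t₁) .nat t₂ σ₂ φ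
  | consL {Γ Ψ h₁ t₁ σ₁ t₂ σ₂ φ' φ'' φ} : WfRHOL D S Γ Ψ (.cons h₁ t₁) (.list σ₁) t₂ σ₂ φ →
      RHOL D S Γ Ψ h₁ σ₁ t₂ σ₂ φ' →
      RHOL D S Γ Ψ t₁ (.list σ₁) t₂ σ₂ φ'' →
      HOL D S Γ Ψ (.all σ₁ (.all σ₂ (.all (.list σ₁)
        (.imp (φ'.inst₂ 3 (.var 2) (.var 1)) (.imp (φ''.inst₂ 3 (.var 0) (.var 1))
          (φ.inst₂ 3 (.cons (.var 2) (.var 0)) (.var 1))))))) →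
      RHOL D S Γ Ψ (.cons h₁ t₁) (.list σ₁) t₂ σ₂ φ
  | pairL {Γ Ψ t₁ u₁ σ₁ τ₁ t₂ σ₂ φ' φ'' φ} :
      WfRHOL D S Γ Ψ (.pair t₁ u₁) (.prod σ₁ τ₁) t₂ σ₂ φ →
      RHOL D S Γ Ψ t₁ σ₁ t₂ σ₂ φ' →
      RHOL D S Γ Ψ u₁ τ₁ t₂ σ₂ φ'' →
      HOL D S Γ Ψ (.all σ₁ (.all σ₂ (.all τ₁
        (.imp (φ'.inst₂ 3 (.var 2) (.var 1)) (.imp (φ''.inst₂ 3 (.var 0) (.var 1))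
          (φ.inst₂ 3 (.pair (.var 2) (.var 0)) (.var 1))))))) →
      RHOL D S Γ Ψ (.pair t₁ u₁) (.prod σ₁ τ₁) t₂ σ₂ φ
  | proj₁L {Γ Ψ t₁ σ₁ τ₁ t₂ σ₂ φ} : WfRHOL D S Γ Ψ (.proj₁ t₁) σ₁ t₂ σ₂ φ →
      RHOL D S Γ Ψ t₁ (.prod σ₁ τ₁) t₂ σ₂ (φ.inst₂ 2 (.proj₁ (.var 1)) (.var 0)) →
      RHOL D S Γ Ψ (.proj₁ t₁) σ₁ t₂ σ₂ φ
  | proj₂L {Γ Ψ t₁ σ₁ τ₁ t₂ σ₂ φ} : WfRHOL D S Γ Ψ (.proj₂ t₁) τ₁ t₂ σ₂ φ →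
      RHOL D S Γ Ψ t₁ (.prod σ₁ τ₁) t₂ σ₂ (φ.inst₂ 2 (.proj₂ (.var 1)) (.var 0)) →
      RHOL D S Γ Ψ (.proj₂ t₁) τ₁ t₂ σ₂ φ
  /- One-sided rules, right. -/
  | absR {Γ Ψ t₁ σ₁ t₂ τ₂ σ₂ φ' φ} :
      WfRHOL D S Γ Ψ t₁ σ₁ (lam τ₂ t₂) (.arr τ₂ σ₂) (funR τ₂ φ' φ) →
      RHOL D S (τ₂ :: Γ) (insert φ' (wkSet 1 Ψ)) (t₁.wk 1) σ₁ t₂ σ₂ φ →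
      RHOL D S Γ Ψ t₁ σ₁ (lam τ₂ t₂) (.arr τ₂ σ₂) (funR τ₂ φ' φ)
  | appR {Γ Ψ u₁ σ₁ t₂ u₂ τ₂ σ₂ φ' φ} :
      WfRHOL D S Γ Ψ u₁ σ₁ (app t₂ u₂) σ₂ (φ.subst (sb [.var 0, .var 1, u₂.wk 2] 2)) →
      WfFm D S (σ₂ :: σ₁ :: τ₂ :: Γ) φ →
      RHOL D S Γ Ψ u₁ σ₁ t₂ (.arr τ₂ σ₂) (funR τ₂ φ' φ) →
      UHOL D S Γ Ψ u₂ τ₂ φ' →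
      RHOL D S Γ Ψ u₁ σ₁ (app t₂ u₂) σ₂ (φ.subst (sb [.var 0, .var 1, u₂.wk 2] 2))
  /- The assertion does not mention `r₁`: it is `φ` over `Γ, r₂`. -/
  | varR {Γ Ψ t₁ σ₁ n₂ σ₂ φ} :
      WfRHOL D S Γ Ψ t₁ σ₁ (.var n₂) σ₂ (φ.inst₁ 2 (.var 0)) → WfFm D S (σ₂ :: Γ) φ →
      φ.inst₁ 0 (.var n₂) ∈ Ψ → RHOL D S Γ Ψ t₁ σ₁ (.var n₂) σ₂ (φ.inst₁ 2 (.var 0))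
  | ttR {Γ Ψ t₁ σ₁ φ} : WfRHOL D S Γ Ψ t₁ σ₁ .tt .bool φ →
      HOL D S Γ Ψ (φ.inst₂ 0 t₁ .tt) → RHOL D S Γ Ψ t₁ σ₁ .tt .bool φ
  | ffR {Γ Ψ t₁ σ₁ φ} : WfRHOL D S Γ Ψ t₁ σ₁ .ff .bool φ →
      HOL D S Γ Ψ (φ.inst₂ 0 t₁ .ff) → RHOL D S Γ Ψ t₁ σ₁ .ff .bool φ
  | zeroR {Γ Ψ t₁ σ₁ φ} : WfRHOL D S Γ Ψ t₁ σ₁ .zero .nat φ →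
      HOL D S Γ Ψ (φ.inst₂ 0 t₁ .zero) → RHOL D S Γ Ψ t₁ σ₁ .zero .nat φ
  | nilR {Γ Ψ t₁ σ₁ σ₂ φ} : WfRHOL D S Γ Ψ t₁ σ₁ .nil (.list σ₂) φ →
      HOL D S Γ Ψ (φ.inst₂ 0 t₁ .nil) → RHOL D S Γ Ψ t₁ σ₁ .nil (.list σ₂) φ
  | succR {Γ Ψ t₁ σ₁ t₂ φ' φ} : WfRHOL D S Γ Ψ t₁ σ₁ (.succ t₂) .nat φ →
      RHOL D S Γ Ψ t₁ σ₁ t₂ .nat φ' →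
      HOL D S Γ Ψ (.all σ₁ (.all .nat (.imp (φ'.inst₂ 2 (.var 1) (.var 0))
        (φ.inst₂ 2 (.var 1) (.succ (.var 0)))))) →
      RHOL D S Γ Ψ t₁ σ₁ (.succ t₂) .nat φ
  | consR {Γ Ψ t₁ σ₁ h₂ t₂ σ₂ φ' φ'' φ} : WfRHOL D S Γ Ψ t₁ σ₁ (.cons h₂ t₂) (.list σ₂) φ →
      RHOL D S Γ Ψ t₁ σ₁ h₂ σ₂ φ' →
      RHOL D S Γ Ψ t₁ σ₁ t₂ (.list σ₂) φ'' →
      HOL D S Γ Ψ (.all σ₁ (.all σ₂ (.all (.list σ₂)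
        (.imp (φ'.inst₂ 3 (.var 2) (.var 1)) (.imp (φ''.inst₂ 3 (.var 2) (.var 0))
          (φ.inst₂ 3 (.var 2) (.cons (.var 1) (.var 0)))))))) →
      RHOL D S Γ Ψ t₁ σ₁ (.cons h₂ t₂) (.list σ₂) φ
  | pairR {Γ Ψ t₁ σ₁ t₂ u₂ σ₂ τ₂ φ' φ'' φ} :
      WfRHOL D S Γ Ψ t₁ σ₁ (.pair t₂ u₂) (.prod σ₂ τ₂) φ →
      RHOL D S Γ Ψ t₁ σ₁ t₂ σ₂ φ' →
      RHOL D S Γ Ψ t₁ σ₁ u₂ τ₂ φ'' →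
      HOL D S Γ Ψ (.all σ₁ (.all σ₂ (.all τ₂
        (.imp (φ'.inst₂ 3 (.var 2) (.var 1)) (.imp (φ''.inst₂ 3 (.var 2) (.var 0))
          (φ.inst₂ 3 (.var 2) (.pair (.var 1) (.var 0)))))))) →
      RHOL D S Γ Ψ t₁ σ₁ (.pair t₂ u₂) (.prod σ₂ τ₂) φ
  | proj₁R {Γ Ψ t₁ σ₁ t₂ σ₂ τ₂ φ} : WfRHOL D S Γ Ψ t₁ σ₁ (.proj₁ t₂) σ₂ φ →
      RHOL D S Γ Ψ t₁ σ₁ t₂ (.prod σ₂ τ₂) (φ.inst₂ 2 (.var 1) (.proj₁ (.var 0))) →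
      RHOL D S Γ Ψ t₁ σ₁ (.proj₁ t₂) σ₂ φ
  | proj₂R {Γ Ψ t₁ σ₁ t₂ σ₂ τ₂ φ} : WfRHOL D S Γ Ψ t₁ σ₁ (.proj₂ t₂) τ₂ φ →
      RHOL D S Γ Ψ t₁ σ₁ t₂ (.prod σ₂ τ₂) (φ.inst₂ 2 (.var 1) (.proj₂ (.var 0))) →
      RHOL D S Γ Ψ t₁ σ₁ (.proj₂ t₂) τ₂ φ
  /- Synchronous case rules. -/
  | boolCase {Γ Ψ t₁ u₁ v₁ σ₁ t₂ u₂ v₂ σ₂ φ} :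
      WfRHOL D S Γ Ψ (.caseB t₁ u₁ v₁) σ₁ (.caseB t₂ u₂ v₂) σ₂ φ →
      RHOL D S Γ Ψ t₁ .bool t₂ .bool
        (.or (.and (eq .bool (.var 1) .tt) (eq .bool (.var 0) .tt))
          (.and (eq .bool (.var 1) .ff) (eq .bool (.var 0) .ff))) →
      RHOL D S Γ (insert (eq .bool t₁ .tt) (insert (eq .bool t₂ .tt) Ψ)) u₁ σ₁ u₂ σ₂ φ →
      RHOL D S Γ (insert (eq .bool t₁ .ff) (insert (eq .bool t₂ .ff) Ψ)) v₁ σ₁ v₂ σ₂ φ →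
      RHOL D S Γ Ψ (.caseB t₁ u₁ v₁) σ₁ (.caseB t₂ u₂ v₂) σ₂ φ
  | natCase {Γ Ψ t₁ u₁ v₁ σ₁ t₂ u₂ v₂ σ₂ φ} :
      WfRHOL D S Γ Ψ (.caseN t₁ u₁ v₁) σ₁ (.caseN t₂ u₂ v₂) σ₂ φ →
      RHOL D S Γ Ψ t₁ .nat t₂ .nat (iff (eq .nat (.var 1) .zero) (eq .nat (.var 0) .zero)) →
      RHOL D S Γ (insert (eq .nat t₁ .zero) (insert (eq .nat t₂ .zero) Ψ)) u₁ σ₁ u₂ σ₂ φ →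
      RHOL D S Γ Ψ v₁ (.arr .nat σ₁) v₂ (.arr .nat σ₂) (branchNatNat t₁ t₂ φ) →
      RHOL D S Γ Ψ (.caseN t₁ u₁ v₁) σ₁ (.caseN t₂ u₂ v₂) σ₂ φ
  | listCase {Γ Ψ t₁ u₁ v₁ τ₁ σ₁ t₂ u₂ v₂ τ₂ σ₂ φ} :
      WfRHOL D S Γ Ψ (.caseL t₁ u₁ v₁) σ₁ (.caseL t₂ u₂ v₂) σ₂ φ →
      RHOL D S Γ Ψ t₁ (.list τ₁) t₂ (.list τ₂)
        (iff (eq (.list τ₁) (.var 1) .nil) (eq (.list τ₂) (.var 0) .nil)) →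
      RHOL D S Γ (insert (eq (.list τ₁) t₁ .nil) (insert (eq (.list τ₂) t₂ .nil) Ψ))
        u₁ σ₁ u₂ σ₂ φ →
      RHOL D S Γ Ψ v₁ (.arr τ₁ (.arr (.list τ₁) σ₁)) v₂ (.arr τ₂ (.arr (.list τ₂) σ₂))
        (branchListList τ₁ τ₂ t₁ t₂ φ) →
      RHOL D S Γ Ψ (.caseL t₁ u₁ v₁) σ₁ (.caseL t₂ u₂ v₂) σ₂ φ
  /- One-sided case rules. -/
  | boolCaseL {Γ Ψ t₁ u₁ v₁ σ₁ t₂ σ₂ φ} : WfRHOL D S Γ Ψ (.caseB t₁ u₁ v₁) σ₁ t₂ σ₂ φ →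
      HasType D Γ t₁ .bool →
      RHOL D S Γ (insert (eq .bool t₁ .tt) Ψ) u₁ σ₁ t₂ σ₂ φ →
      RHOL D S Γ (insert (eq .bool t₁ .ff) Ψ) v₁ σ₁ t₂ σ₂ φ →
      RHOL D S Γ Ψ (.caseB t₁ u₁ v₁) σ₁ t₂ σ₂ φ
  | natCaseL {Γ Ψ t₁ u₁ v₁ σ₁ t₂ σ₂ φ} : WfRHOL D S Γ Ψ (.caseN t₁ u₁ v₁) σ₁ t₂ σ₂ φ →
      HasType D Γ t₁ .nat →
      RHOL D S Γ (insert (eq .nat t₁ .zero) Ψ) u₁ σ₁ t₂ σ₂ φ →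
      RHOL D S Γ Ψ v₁ (.arr .nat σ₁) t₂ σ₂ (branchNatL t₁ φ) →
      RHOL D S Γ Ψ (.caseN t₁ u₁ v₁) σ₁ t₂ σ₂ φ
  | listCaseL {Γ Ψ t₁ u₁ v₁ τ₁ σ₁ t₂ σ₂ φ} : WfRHOL D S Γ Ψ (.caseL t₁ u₁ v₁) σ₁ t₂ σ₂ φ →
      HasType D Γ t₁ (.list τ₁) →
      RHOL D S Γ (insert (eq (.list τ₁) t₁ .nil) Ψ) u₁ σ₁ t₂ σ₂ φ →
      RHOL D S Γ Ψ v₁ (.arr τ₁ (.arr (.list τ₁) σ₁)) t₂ σ₂ (branchListL τ₁ t₁ φ) →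
      RHOL D S Γ Ψ (.caseL t₁ u₁ v₁) σ₁ t₂ σ₂ φ
  | boolCaseR {Γ Ψ t₁ σ₁ t₂ u₂ v₂ σ₂ φ} : WfRHOL D S Γ Ψ t₁ σ₁ (.caseB t₂ u₂ v₂) σ₂ φ →
      HasType D Γ t₂ .bool →
      RHOL D S Γ (insert (eq .bool t₂ .tt) Ψ) t₁ σ₁ u₂ σ₂ φ →
      RHOL D S Γ (insert (eq .bool t₂ .ff) Ψ) t₁ σ₁ v₂ σ₂ φ →
      RHOL D S Γ Ψ t₁ σ₁ (.caseB t₂ u₂ v₂) σ₂ φ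
  | natCaseR {Γ Ψ t₁ σ₁ t₂ u₂ v₂ σ₂ φ} : WfRHOL D S Γ Ψ t₁ σ₁ (.caseN t₂ u₂ v₂) σ₂ φ →
      HasType D Γ t₂ .nat →
      RHOL D S Γ (insert (eq .nat t₂ .zero) Ψ) t₁ σ₁ u₂ σ₂ φ →
      RHOL D S Γ Ψ t₁ σ₁ v₂ (.arr .nat σ₂) (branchNatR t₂ φ) →
      RHOL D S Γ Ψ t₁ σ₁ (.caseN t₂ u₂ v₂) σ₂ φ
  | listCaseR {Γ Ψ t₁ σ₁ t₂ u₂ v₂ τ₂ σ₂ φ} : WfRHOL D S Γ Ψ t₁ σ₁ (.caseL t₂ u₂ v₂) σ₂ φ →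
      HasType D Γ t₂ (.list τ₂) →
      RHOL D S Γ (insert (eq (.list τ₂) t₂ .nil) Ψ) t₁ σ₁ u₂ σ₂ φ →
      RHOL D S Γ Ψ t₁ σ₁ v₂ (.arr τ₂ (.arr (.list τ₂) σ₂)) (branchListR τ₂ t₂ φ) →
      RHOL D S Γ Ψ t₁ σ₁ (.caseL t₂ u₂ v₂) σ₂ φ
  /- Asynchronous case rules. -/
  | boolBoolCase {Γ Ψ t₁ u₁ v₁ σ₁ t₂ u₂ v₂ σ₂ φ} :
      WfRHOL D S Γ Ψ (.caseB t₁ u₁ v₁) σ₁ (.caseB t₂ u₂ v₂) σ₂ φ →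
      RHOL D S Γ Ψ t₁ .bool t₂ .bool .top →
      RHOL D S Γ (insert (eq .bool t₁ .tt) (insert (eq .bool t₂ .tt) Ψ)) u₁ σ₁ u₂ σ₂ φ →
      RHOL D S Γ (insert (neg (eq .bool t₁ .tt)) (insert (eq .bool t₂ .tt) Ψ)) v₁ σ₁ u₂ σ₂ φ →
      RHOL D S Γ (insert (eq .bool t₁ .tt) (insert (neg (eq .bool t₂ .tt)) Ψ)) u₁ σ₁ v₂ σ₂ φ →
      RHOL D S Γ (insert (neg (eq .bool t₁ .tt)) (insert (neg (eq .bool t₂ .tt)) Ψ))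
        v₁ σ₁ v₂ σ₂ φ →
      RHOL D S Γ Ψ (.caseB t₁ u₁ v₁) σ₁ (.caseB t₂ u₂ v₂) σ₂ φ
  | boolNatCase {Γ Ψ t₁ u₁ v₁ σ₁ t₂ u₂ v₂ σ₂ φ} :
      WfRHOL D S Γ Ψ (.caseB t₁ u₁ v₁) σ₁ (.caseN t₂ u₂ v₂) σ₂ φ →
      RHOL D S Γ Ψ t₁ .bool t₂ .nat .top →
      RHOL D S Γ (insert (eq .bool t₁ .tt) (insert (eq .nat t₂ .zero) Ψ)) u₁ σ₁ u₂ σ₂ φ →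
      RHOL D S Γ (insert (neg (eq .bool t₁ .tt)) (insert (eq .nat t₂ .zero) Ψ)) v₁ σ₁ u₂ σ₂ φ →
      RHOL D S Γ (insert (eq .bool t₁ .tt) Ψ) u₁ σ₁ v₂ (.arr .nat σ₂) (branchNatR t₂ φ) →
      RHOL D S Γ (insert (neg (eq .bool t₁ .tt)) Ψ) v₁ σ₁ v₂ (.arr .nat σ₂) (branchNatR t₂ φ) →
      RHOL D S Γ Ψ (.caseB t₁ u₁ v₁) σ₁ (.caseN t₂ u₂ v₂) σ₂ φ
  | boolListCase {Γ Ψ t₁ u₁ v₁ σ₁ t₂ u₂ v₂ τ₂ σ₂ φ} :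
      WfRHOL D S Γ Ψ (.caseB t₁ u₁ v₁) σ₁ (.caseL t₂ u₂ v₂) σ₂ φ →
      RHOL D S Γ Ψ t₁ .bool t₂ (.list τ₂) .top →
      RHOL D S Γ (insert (eq .bool t₁ .tt) (insert (eq (.list τ₂) t₂ .nil) Ψ)) u₁ σ₁ u₂ σ₂ φ →
      RHOL D S Γ (insert (neg (eq .bool t₁ .tt)) (insert (eq (.list τ₂) t₂ .nil) Ψ))
        v₁ σ₁ u₂ σ₂ φ →
      RHOL D S Γ (insert (eq .bool t₁ .tt) Ψ) u₁ σ₁ v₂ (.arr τ₂ (.arr (.list τ₂) σ₂))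
        (branchListR τ₂ t₂ φ) →
      RHOL D S Γ (insert (neg (eq .bool t₁ .tt)) Ψ) v₁ σ₁ v₂ (.arr τ₂ (.arr (.list τ₂) σ₂))
        (branchListR τ₂ t₂ φ) →
      RHOL D S Γ Ψ (.caseB t₁ u₁ v₁) σ₁ (.caseL t₂ u₂ v₂) σ₂ φ
  | natBoolCase {Γ Ψ t₁ u₁ v₁ σ₁ t₂ u₂ v₂ σ₂ φ} :
      WfRHOL D S Γ Ψ (.caseN t₁ u₁ v₁) σ₁ (.caseB t₂ u₂ v₂) σ₂ φ →
      RHOL D S Γ Ψ t₁ .nat t₂ .bool .top →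
      RHOL D S Γ (insert (eq .nat t₁ .zero) (insert (eq .bool t₂ .tt) Ψ)) u₁ σ₁ u₂ σ₂ φ →
      RHOL D S Γ (insert (eq .nat t₁ .zero) (insert (neg (eq .bool t₂ .tt)) Ψ)) u₁ σ₁ v₂ σ₂ φ →
      RHOL D S Γ (insert (eq .bool t₂ .tt) Ψ) v₁ (.arr .nat σ₁) u₂ σ₂ (branchNatL t₁ φ) →
      RHOL D S Γ (insert (neg (eq .bool t₂ .tt)) Ψ) v₁ (.arr .nat σ₁) v₂ σ₂ (branchNatL t₁ φ) →
      RHOL D S Γ Ψ (.caseN t₁ u₁ v₁) σ₁ (.caseB t₂ u₂ v₂) σ₂ φ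
  | natNatCase {Γ Ψ t₁ u₁ v₁ σ₁ t₂ u₂ v₂ σ₂ φ} :
      WfRHOL D S Γ Ψ (.caseN t₁ u₁ v₁) σ₁ (.caseN t₂ u₂ v₂) σ₂ φ →
      RHOL D S Γ Ψ t₁ .nat t₂ .nat .top →
      RHOL D S Γ (insert (eq .nat t₁ .zero) (insert (eq .nat t₂ .zero) Ψ)) u₁ σ₁ u₂ σ₂ φ →
      RHOL D S Γ (insert (eq .nat t₂ .zero) Ψ) v₁ (.arr .nat σ₁) u₂ σ₂ (branchNatL t₁ φ) →
      RHOL D S Γ (insert (eq .nat t₁ .zero) Ψ) u₁ σ₁ v₂ (.arr .nat σ₂) (branchNatR t₂ φ) →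
      RHOL D S Γ Ψ v₁ (.arr .nat σ₁) v₂ (.arr .nat σ₂) (branchNatNat t₁ t₂ φ) →
      RHOL D S Γ Ψ (.caseN t₁ u₁ v₁) σ₁ (.caseN t₂ u₂ v₂) σ₂ φ
  | natListCase {Γ Ψ t₁ u₁ v₁ σ₁ t₂ u₂ v₂ τ₂ σ₂ φ} :
      WfRHOL D S Γ Ψ (.caseN t₁ u₁ v₁) σ₁ (.caseL t₂ u₂ v₂) σ₂ φ →
      RHOL D S Γ Ψ t₁ .nat t₂ (.list τ₂) .top →
      RHOL D S Γ (insert (eq .nat t₁ .zero) (insert (eq (.list τ₂) t₂ .nil) Ψ)) u₁ σ₁ u₂ σ₂ φ →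
      RHOL D S Γ (insert (eq (.list τ₂) t₂ .nil) Ψ) v₁ (.arr .nat σ₁) u₂ σ₂ (branchNatL t₁ φ) →
      RHOL D S Γ (insert (eq .nat t₁ .zero) Ψ) u₁ σ₁ v₂ (.arr τ₂ (.arr (.list τ₂) σ₂))
        (branchListR τ₂ t₂ φ) →
      RHOL D S Γ Ψ v₁ (.arr .nat σ₁) v₂ (.arr τ₂ (.arr (.list τ₂) σ₂))
        (branchNatList τ₂ t₁ t₂ φ) →
      RHOL D S Γ Ψ (.caseN t₁ u₁ v₁) σ₁ (.caseL t₂ u₂ v₂) σ₂ φ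
  | listBoolCase {Γ Ψ t₁ u₁ v₁ τ₁ σ₁ t₂ u₂ v₂ σ₂ φ} :
      WfRHOL D S Γ Ψ (.caseL t₁ u₁ v₁) σ₁ (.caseB t₂ u₂ v₂) σ₂ φ →
      RHOL D S Γ Ψ t₁ (.list τ₁) t₂ .bool .top →
      RHOL D S Γ (insert (eq (.list τ₁) t₁ .nil) (insert (eq .bool t₂ .tt) Ψ)) u₁ σ₁ u₂ σ₂ φ →
      RHOL D S Γ (insert (eq (.list τ₁) t₁ .nil) (insert (neg (eq .bool t₂ .tt)) Ψ))
        u₁ σ₁ v₂ σ₂ φ →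
      RHOL D S Γ (insert (eq .bool t₂ .tt) Ψ) v₁ (.arr τ₁ (.arr (.list τ₁) σ₁)) u₂ σ₂
        (branchListL τ₁ t₁ φ) →
      RHOL D S Γ (insert (neg (eq .bool t₂ .tt)) Ψ) v₁ (.arr τ₁ (.arr (.list τ₁) σ₁)) v₂ σ₂
        (branchListL τ₁ t₁ φ) →
      RHOL D S Γ Ψ (.caseL t₁ u₁ v₁) σ₁ (.caseB t₂ u₂ v₂) σ₂ φ
  | listNatCase {Γ Ψ t₁ u₁ v₁ τ₁ σ₁ t₂ u₂ v₂ σ₂ φ} :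
      WfRHOL D S Γ Ψ (.caseL t₁ u₁ v₁) σ₁ (.caseN t₂ u₂ v₂) σ₂ φ →
      RHOL D S Γ Ψ t₁ (.list τ₁) t₂ .nat .top →
      RHOL D S Γ (insert (eq (.list τ₁) t₁ .nil) (insert (eq .nat t₂ .zero) Ψ)) u₁ σ₁ u₂ σ₂ φ →
      RHOL D S Γ (insert (eq .nat t₂ .zero) Ψ) v₁ (.arr τ₁ (.arr (.list τ₁) σ₁)) u₂ σ₂
        (branchListL τ₁ t₁ φ) →
      RHOL D S Γ (insert (eq (.list τ₁) t₁ .nil) Ψ) u₁ σ₁ v₂ (.arr .nat σ₂) (branchNatR t₂ φ) →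
      RHOL D S Γ Ψ v₁ (.arr τ₁ (.arr (.list τ₁) σ₁)) v₂ (.arr .nat σ₂)
        (branchListNat τ₁ t₁ t₂ φ) →
      RHOL D S Γ Ψ (.caseL t₁ u₁ v₁) σ₁ (.caseN t₂ u₂ v₂) σ₂ φ
  | listListCase {Γ Ψ t₁ u₁ v₁ τ₁ σ₁ t₂ u₂ v₂ τ₂ σ₂ φ} :
      WfRHOL D S Γ Ψ (.caseL t₁ u₁ v₁) σ₁ (.caseL t₂ u₂ v₂) σ₂ φ →
      RHOL D S Γ Ψ t₁ (.list τ₁) t₂ (.list τ₂) .top →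
      RHOL D S Γ (insert (eq (.list τ₁) t₁ .nil) (insert (eq (.list τ₂) t₂ .nil) Ψ))
        u₁ σ₁ u₂ σ₂ φ →
      RHOL D S Γ (insert (eq (.list τ₂) t₂ .nil) Ψ) v₁ (.arr τ₁ (.arr (.list τ₁) σ₁)) u₂ σ₂
        (branchListL τ₁ t₁ φ) →
      RHOL D S Γ (insert (eq (.list τ₁) t₁ .nil) Ψ) u₁ σ₁ v₂ (.arr τ₂ (.arr (.list τ₂) σ₂))
        (branchListR τ₂ t₂ φ) →
      RHOL D S Γ Ψ v₁ (.arr τ₁ (.arr (.list τ₁) σ₁)) v₂ (.arr τ₂ (.arr (.list τ₂) σ₂))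
        (branchListList τ₁ τ₂ t₁ t₂ φ) →
      RHOL D S Γ Ψ (.caseL t₁ u₁ v₁) σ₁ (.caseL t₂ u₂ v₂) σ₂ φ
  /- Alternative synchronous case rules; `φ'` is over `Γ, r₁, r₂`. -/
  | natCaseAlt {Γ Ψ t₁ u₁ v₁ σ₁ t₂ u₂ v₂ σ₂ φ' φ} :
      WfRHOL D S Γ Ψ (.caseN t₁ u₁ v₁) σ₁ (.caseN t₂ u₂ v₂) σ₂ φ →
      RHOL D S Γ Ψ t₁ .nat t₂ .nat
        (.and φ' (iff (eq .nat (.var 1) .zero) (eq .nat (.var 0) .zero))) →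
      RHOL D S Γ (insert (φ'.inst₂ 0 .zero .zero) Ψ) u₁ σ₁ u₂ σ₂ φ →
      RHOL D S Γ Ψ v₁ (.arr .nat σ₁) v₂ (.arr .nat σ₂)
        (.all .nat (.all .nat (.imp (φ'.inst₂ 4 (.succ (.var 1)) (.succ (.var 0)))
          (φ.inst₂ 4 (.app (.var 3) (.var 1)) (.app (.var 2) (.var 0)))))) →
      RHOL D S Γ Ψ (.caseN t₁ u₁ v₁) σ₁ (.caseN t₂ u₂ v₂) σ₂ φ
  | listCaseAlt {Γ Ψ t₁ u₁ v₁ τ₁ σ₁ t₂ u₂ v₂ τ₂ σ₂ φ' φ} :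
      WfRHOL D S Γ Ψ (.caseL t₁ u₁ v₁) σ₁ (.caseL t₂ u₂ v₂) σ₂ φ →
      RHOL D S Γ Ψ t₁ (.list τ₁) t₂ (.list τ₂)
        (.and φ' (iff (eq (.list τ₁) (.var 1) .nil) (eq (.list τ₂) (.var 0) .nil))) →
      RHOL D S Γ (insert (φ'.inst₂ 0 .nil .nil) Ψ) u₁ σ₁ u₂ σ₂ φ →
      RHOL D S Γ Ψ v₁ (.arr τ₁ (.arr (.list τ₁) σ₁)) v₂ (.arr τ₂ (.arr (.list τ₂) σ₂))
        (.all τ₁ (.all τ₂ (.all (.list τ₁) (.all (.list τ₂)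
          (.imp (φ'.inst₂ 6 (.cons (.var 3) (.var 1)) (.cons (.var 2) (.var 0)))
            (φ.inst₂ 6 (.app (.app (.var 5) (.var 3)) (.var 1))
              (.app (.app (.var 4) (.var 2)) (.var 0)))))))) →
      RHOL D S Γ Ψ (.caseL t₁ u₁ v₁) σ₁ (.caseL t₂ u₂ v₂) σ₂ φ
  /- Recursion rules. `φ'` is over `Γ, x₁, x₂` and `φ` over `Γ, x₁, x₂, r₁, r₂`; the premise is over
  `Γ, x₁, x₂, f₁, f₂`, with the hypotheses `φ'` and
  `∀ m₁ m₂. (|m₁|, |m₂|) < (|x₁|, |x₂|) ⇒ φ'[m₁/x₁][m₂/x₂] ⇒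
    φ[m₁/x₁][m₂/x₂][f₁ m₁/r₁][f₂ m₂/r₂]`. -/
  | letrec {Γ Ψ e₁ σ₁ e₂ σ₂ φ' φ} {I₁ I₂ : Ind} :
      WfRHOL D S Γ Ψ (.letrec e₁) (.arr I₁.ty σ₁) (.letrec e₂) (.arr I₂.ty σ₂)
        (funLR I₁.ty I₂.ty φ' φ) →
      WfFm D S (I₂.ty :: I₁.ty :: Γ) φ' → WfFm D S (σ₂ :: σ₁ :: I₂.ty :: I₁.ty :: Γ) φ →
      D Γ I₁ σ₁ e₁ → D Γ I₂ σ₂ e₂ →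
      RHOL D S (.arr I₂.ty σ₂ :: .arr I₁.ty σ₁ :: I₂.ty :: I₁.ty :: Γ)
        (insert (φ'.subst (sb [.var 2, .var 3] 4))
          (insert (.all I₁.ty (.all I₂.ty
              (.imp (lt₂ I₁ I₂ (.var 1) (.var 0) (.var 5) (.var 4))
                (.imp (φ'.subst (sb [.var 0, .var 1] 6))
                  (φ.subst (sb [.app (.var 2) (.var 0), .app (.var 3) (.var 1),
                    .var 0, .var 1] 6))))))
            (wkSet 4 Ψ)))
        (e₁.subst (sb [.var 3, .var 1] 4)) σ₁ (e₂.subst (sb [.var 2, .var 0] 4)) σ₂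
        (φ.subst (sb [.var 0, .var 1, .var 4, .var 5] 6)) →
      RHOL D S Γ Ψ (.letrec e₁) (.arr I₁.ty σ₁) (.letrec e₂) (.arr I₂.ty σ₂)
        (funLR I₁.ty I₂.ty φ' φ)
  /- `φ'` is over `Γ, x₁` and `φ` over `Γ, x₁, r₁, r₂`; the premise is over `Γ, x₁, f₁`, with the
  hypotheses `φ'` and `∀ m₁. |m₁| < |x₁| ⇒ φ'[m₁/x₁] ⇒ φ[m₁/x₁][f₁ m₁/r₁][t₂/r₂]`. -/
  | letrecL {Γ Ψ e₁ σ₁ t₂ σ₂ φ' φ} {I₁ : Ind} :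
      WfRHOL D S Γ Ψ (.letrec e₁) (.arr I₁.ty σ₁) t₂ σ₂ (funL I₁.ty φ' φ) →
      WfFm D S (I₁.ty :: Γ) φ' → WfFm D S (σ₂ :: σ₁ :: I₁.ty :: Γ) φ →
      D Γ I₁ σ₁ e₁ →
      RHOL D S (.arr I₁.ty σ₁ :: I₁.ty :: Γ)
        (insert (φ'.subst (sb [.var 1] 2))
          (insert (.all I₁.ty (.imp (lt I₁ (.var 0) (.var 2)) (.imp (φ'.subst (sb [.var 0] 3))
              (φ.subst (sb [t₂.wk 3, .app (.var 1) (.var 0), .var 0] 3)))))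
            (wkSet 2 Ψ)))
        (e₁.subst (sb [.var 1, .var 0] 2)) σ₁ (t₂.wk 2) σ₂
        (φ.subst (sb [.var 0, .var 1, .var 3] 4)) →
      RHOL D S Γ Ψ (.letrec e₁) (.arr I₁.ty σ₁) t₂ σ₂ (funL I₁.ty φ' φ)
  /- `φ'` is over `Γ, x₂` and `φ` over `Γ, x₂, r₁, r₂`; the premise is over `Γ, x₂, f₂`, with the
  hypotheses `φ'` and `∀ m₂. |m₂| < |x₂| ⇒ φ'[m₂/x₂] ⇒ φ[m₂/x₂][t₁/r₁][f₂ m₂/r₂]`. -/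
  | letrecR {Γ Ψ t₁ σ₁ e₂ σ₂ φ' φ} {I₂ : Ind} :
      WfRHOL D S Γ Ψ t₁ σ₁ (.letrec e₂) (.arr I₂.ty σ₂) (funR I₂.ty φ' φ) →
      WfFm D S (I₂.ty :: Γ) φ' → WfFm D S (σ₂ :: σ₁ :: I₂.ty :: Γ) φ →
      D Γ I₂ σ₂ e₂ →
      RHOL D S (.arr I₂.ty σ₂ :: I₂.ty :: Γ)
        (insert (φ'.subst (sb [.var 1] 2))
          (insert (.all I₂.ty (.imp (lt I₂ (.var 0) (.var 2)) (.imp (φ'.subst (sb [.var 0] 3))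
              (φ.subst (sb [.app (.var 1) (.var 0), t₁.wk 3, .var 0] 3)))))
            (wkSet 2 Ψ)))
        (t₁.wk 2) σ₁ (e₂.subst (sb [.var 1, .var 0] 2)) σ₂
        (φ.subst (sb [.var 0, .var 1, .var 3] 4)) →
      RHOL D S Γ Ψ t₁ σ₁ (.letrec e₂) (.arr I₂.ty σ₂) (funR I₂.ty φ' φ)

end RelLogic

/-! From RHOL to HOL the theorem says that every relational rule is sound; from HOL to RHOL it needs
only one very weak relational derivation.

For soundness, a judgment is read at its points. A point of Γ | Ψ (`Env`) is a well-typed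
substitution s from Γ to some Δ, together with hypotheses Θ over Δ from which HOL derives ψ[s] for
every ψ in Ψ. A relational judgment holds (`RSem`) if HOL derives its instance at every point. HOL
admits substitution and cut (`HOL.at`), and the identity is a point (`HOL.of_points`), so this is
the same as derivability of φ[t₁/r₁][t₂/r₂] from Ψ. As in a Kripke model, quantifying over all
points lets implications and functions of the metalanguage stand for ⇒ and ∀; a variable bound in a
premise becomes a new entry of the point. Most term-forming rules then amount to instantiating their
premises and to replacing redexes by contracta, which are equal in HOL.

Two groups of rules need induction inside HOL. For the case rules, a scrutinee must be equal to a
constructor form. `HOL.cases_val` obtains this by proving ∀y. t = y ⇒ χ by structural induction on y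
and taking y to be t. For the recursion rules, the hypothesis concerns all arguments of smaller
size, whereas HOL offers only structural induction and recursive clauses for sizes. These clauses
yield reflexivity and transitivity of the comparison (`HOL.le_refl`, `HOL.le_trans`).
Course-of-values induction follows by proving ∀m. |m| ≤ |x| ⇒ χ(m) structurally
(`HOL.strong_induction`). The order on pairs of sizes is handled by nesting an induction on the
second argument inside one on the first (`HOL.strong_induction₂`). Since μ-reduction fires only on
constructors, equating a recursive call with its unfolding (`HOL.letrec_unfold`) uses case analysis
once more. `UHOL.sound` is the same argument for one term and serves the relational rules with UHOL
premises.

Conversely, every typable term satisfies ⊤ in UHOL (`UHOL.top`). The embedding of UHOL gives t₁ ∼ t₂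
| ⊤, and subsumption turns ⊤ into φ: its side condition ⊤ ⇒ φ[t₁/r₁][t₂/r₂] is the given HOL
judgment, weakened (`RHOL.complete`). -/

namespace RelLogic

/-! ## The calculus of substitutions -/

/-- The environment that maps `0` to `u` and `n + 1` to `s n`. -/
def scons (u : Tm) (s : ℕ → Tm) : ℕ → Tm
  | 0 => u
  | n + 1 => s n

infixr:67 " ∷ " => scons

/-- The environment without its first `k` entries. -/
def drop (k : ℕ) (s : ℕ → Tm) : ℕ → Tm := fun n => s (n + k)

/-- Composition of substitutions: first `s`, then `r`. -/
def cmp (s r : ℕ → Tm) : ℕ → Tm := fun n => (s n).subst r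

@[simp] theorem scons_zero (u : Tm) (s : ℕ → Tm) : (u ∷ s) 0 = u := rfl
@[simp] theorem scons_one (u : Tm) (s : ℕ → Tm) : (u ∷ s) 1 = s 0 := rfl
@[simp] theorem scons_two (u : Tm) (s : ℕ → Tm) : (u ∷ s) 2 = s 1 := rfl
@[simp] theorem scons_three (u : Tm) (s : ℕ → Tm) : (u ∷ s) 3 = s 2 := rfl
@[simp] theorem scons_four (u : Tm) (s : ℕ → Tm) : (u ∷ s) 4 = s 3 := rfl
@[simp] theorem scons_five (u : Tm) (s : ℕ → Tm) : (u ∷ s) 5 = s 4 := rfl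
@[simp] theorem drop_zero (s : ℕ → Tm) : drop 0 s = s := rfl
@[simp] theorem drop_one (u : Tm) (s : ℕ → Tm) : drop 1 (u ∷ s) = s := rfl
@[simp] theorem drop_two (u : Tm) (s : ℕ → Tm) : drop 2 (u ∷ s) = drop 1 s := rfl
@[simp] theorem drop_three (u : Tm) (s : ℕ → Tm) : drop 3 (u ∷ s) = drop 2 s := rfl
@[simp] theorem drop_four (u : Tm) (s : ℕ → Tm) : drop 4 (u ∷ s) = drop 3 s := rfl
@[simp] theorem drop_five (u : Tm) (s : ℕ → Tm) : drop 5 (u ∷ s) = drop 4 s := rfl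
@[simp] theorem drop_six (u : Tm) (s : ℕ → Tm) : drop 6 (u ∷ s) = drop 5 s := rfl

theorem scons_eta (s : ℕ → Tm) : s 0 ∷ drop 1 s = s := by
  funext n; cases n <;> rfl

@[simp] theorem sb_cons (t : Tm) (ts : List Tm) (k : ℕ) : sb (t :: ts) k = t ∷ sb ts k := by
  funext n; cases n <;> rfl

@[simp] theorem sb_nil_apply (k n : ℕ) : sb [] k n = .var (n + k) := rfl

theorem sb_nil_zero : sb [] 0 = Tm.var := rfl

@[simp] theorem cmp_scons (u : Tm) (s r : ℕ → Tm) : cmp (u ∷ s) r = u.subst r ∷ cmp s r := by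
  funext n; cases n <;> rfl

@[simp] theorem cmp_sb_nil (k : ℕ) (r : ℕ → Tm) : cmp (sb [] k) r = drop k r := rfl

@[simp] theorem cmp_var (r : ℕ → Tm) : cmp Tm.var r = r := rfl

theorem upr_var (ρ : ℕ → ℕ) : up (fun n => Tm.var (ρ n)) = fun n => Tm.var (upr ρ n) := by
  funext n; cases n <;> rfl

theorem Tm.rename_eq_subst (t : Tm) : ∀ ρ : ℕ → ℕ, t.rename ρ = t.subst (fun n => .var (ρ n)) := by
  induction t <;> intro ρ <;> simp_all [Tm.rename, Tm.subst, upr_var]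

theorem up_var : up Tm.var = Tm.var := by
  funext n; cases n <;> rfl

@[simp] theorem Tm.subst_var (t : Tm) : t.subst Tm.var = t := by
  induction t <;> simp_all [Tm.subst, up_var]

/-- Lifting a substitution renames its values, so composing substitutions under a binder first
requires the two mixed compositions, this one and `Tm.rename_subst`. -/
theorem Tm.subst_rename (t : Tm) : ∀ (ρ : ℕ → ℕ) (s : ℕ → Tm),
    (t.rename ρ).subst s = t.subst (fun n => s (ρ n)) := by
  have h : ∀ (ρ : ℕ → ℕ) (s : ℕ → Tm), (fun n => up s (upr ρ n)) = up (fun n => s (ρ n)) := by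
    intro ρ s; funext n; cases n <;> rfl
  induction t <;> intro ρ s <;> simp_all [Tm.rename, Tm.subst]

theorem Tm.rename_subst (t : Tm) : ∀ (s : ℕ → Tm) (ρ : ℕ → ℕ),
    (t.subst s).rename ρ = t.subst (fun n => (s n).rename ρ) := by
  have h : ∀ (s : ℕ → Tm) (ρ : ℕ → ℕ), (fun n => (up s n).rename (upr ρ)) =
      up (fun n => (s n).rename ρ) := by
    intro s ρ; funext n
    cases n with
    | zero => rfl
    | succ n =>
      -- Shifting and then renaming by `upr ρ` is renaming by `ρ` and then shifting.
      simp only [up, Tm.rename_eq_subst (s n) Nat.succ]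
      rw [Tm.rename_eq_subst, Tm.rename_eq_subst (Tm.rename _ _), ← Tm.rename_eq_subst (s n),
        Tm.subst_rename, Tm.subst_rename]
      rfl
  induction t <;> intro s ρ <;> simp_all [Tm.rename, Tm.subst]

theorem cmp_up_up (s r : ℕ → Tm) : cmp (up s) (up r) = up (cmp s r) := by
  funext n
  cases n with
  | zero => rfl
  | succ n =>
    simp only [cmp, up]
    rw [Tm.subst_rename, Tm.rename_subst]
    rfl

-- Collapses nested substitutions into one environment, on which the identities of terms and
-- assertions below are settled by computation.
@[simp] theorem Tm.subst_subst (t : Tm) : ∀ s r : ℕ → Tm,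
    (t.subst s).subst r = t.subst (cmp s r) := by
  induction t <;> intro s r <;> simp_all [Tm.subst, cmp_up_up]
  rfl

@[simp] theorem cmp_assoc (s r q : ℕ → Tm) : cmp (cmp s r) q = cmp s (cmp r q) := by
  funext n; simp [cmp]

/-- Brings a lifted substitution into the form of an explicit environment followed by a shift, whose
entries can be read off. -/
theorem up_eq (s : ℕ → Tm) : up s = .var 0 ∷ cmp s (sb [] 1) := by
  funext n
  cases n with
  | zero => rfl
  | succ n => simp only [up, Tm.rename_eq_subst]; rfl

-- This is the law that lets a binder be instantiated after a substitution has passed under it;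
-- β-reduction and universal elimination rest on it.
@[simp] theorem cmp_up_scons (s : ℕ → Tm) (u : Tm) (r : ℕ → Tm) :
    cmp (up s) (u ∷ r) = u ∷ cmp s r := by
  simp [up_eq, Tm.subst]

@[simp] theorem cmp_right_var (s : ℕ → Tm) : cmp s Tm.var = s := by
  funext n; simp [cmp]

@[simp] theorem cmp_right_sb_zero (s : ℕ → Tm) : cmp s (sb [] 0) = s := cmp_right_var s

@[simp] theorem drop_sb_nil (k l : ℕ) : drop k (sb [] l) = sb [] (k + l) := by
  funext n; simp [drop, Nat.add_assoc]

/-! ### Substitution in assertions -/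

namespace Fm

variable {P : Type*}

@[simp] theorem subst_var (φ : Fm P) : φ.subst Tm.var = φ := by
  induction φ with
  | atom p ts =>
    have : Tm.subst Tm.var = id := by funext t; simp
    simp [Fm.subst, this]
  | _ => simp_all [Fm.subst, up_var]

@[simp] theorem subst_subst (φ : Fm P) : ∀ s r : ℕ → Tm,
    (φ.subst s).subst r = φ.subst (cmp s r) := by
  induction φ <;> intro s r <;> simp_all [Fm.subst, cmp_up_up]

@[simp] theorem subst_eq (τ : Ty) (t u : Tm) (s : ℕ → Tm) :
    (eq τ t u : Fm P).subst s = eq τ (t.subst s) (u.subst s) := rfl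
@[simp] theorem subst_le (I : Ind) (t u : Tm) (s : ℕ → Tm) :
    (le I t u : Fm P).subst s = le I (t.subst s) (u.subst s) := rfl
@[simp] theorem subst_lt (I : Ind) (t u : Tm) (s : ℕ → Tm) :
    (lt I t u : Fm P).subst s = lt I (t.subst s) (u.subst s) := rfl
@[simp] theorem subst_iff (φ ψ : Fm P) (s : ℕ → Tm) :
    (iff φ ψ).subst s = iff (φ.subst s) (ψ.subst s) := rfl
@[simp] theorem subst_lt₂ (I J : Ind) (a b c d : Tm) (s : ℕ → Tm) :
    (lt₂ I J a b c d : Fm P).subst s =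
      lt₂ I J (a.subst s) (b.subst s) (c.subst s) (d.subst s) := rfl

end Fm

/-! ## Reduction under substitution -/

theorem Tm.IsConstr.subst {a : Tm} (h : a.IsConstr) (s : ℕ → Tm) : (a.subst s).IsConstr := by
  cases h <;> constructor

/-- Only β and μ need an argument: their contracta commute with `s` by composition of environments,
and for μ an instance of a constructor form is again one. -/
theorem Step.subst {t t' : Tm} (h : Step t t') : ∀ s : ℕ → Tm, Step (t.subst s) (t'.subst s) := by
  induction h with
  | beta τ t u =>
    intro s
    have := Step.beta τ (t.subst (up s)) (u.subst s)
    simpa [Tm.subst] using this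
  | mu e a ha =>
    intro s
    have := Step.mu (e.subst (up (up s))) (a.subst s) (ha.subst s)
    simpa [Tm.subst] using this
  | _ => intro s; first | (constructor; done) | (constructor; apply_assumption)

theorem Conv.subst {t t' : Tm} (h : Conv t t') (s : ℕ → Tm) : Conv (t.subst s) (t'.subst s) := by
  induction h with
  | rel _ _ h => exact .rel _ _ (h.subst s)
  | refl _ => exact .refl _
  | symm _ _ _ ih => exact .symm _ _ ih
  | trans _ _ _ _ _ ih₁ ih₂ => exact .trans _ _ _ ih₁ ih₂

variable {D : Guard} {S : Sig}

/-! ## Typing under substitution -/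

/-- `s` is a well-typed substitution from `Γ` to `Δ`. -/
def Typed (D : Guard) (Γ Δ : Ctx) (s : ℕ → Tm) : Prop :=
  ∀ n τ, Γ[n]? = some τ → HasType D Δ (s n) τ

theorem Typed.var {Γ : Ctx} : Typed D Γ Γ Tm.var := fun _ _ h => .var h

theorem Typed.scons {Γ Δ : Ctx} {s : ℕ → Tm} {u : Tm} {τ : Ty} (hs : Typed D Γ Δ s)
    (hu : HasType D Δ u τ) : Typed D (τ :: Γ) Δ (u ∷ s) := by
  intro n σ h
  cases n with
  | zero => simp at h; subst h; exact hu
  | succ n => exact hs n σ (by simpa using h)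

theorem Typed.tail {Γ Δ : Ctx} {s : ℕ → Tm} {τ : Ty} (hs : Typed D (τ :: Γ) Δ s) :
    Typed D Γ Δ (drop 1 s) := fun n σ h => hs (n + 1) σ (by simpa using h)

theorem Typed.head {Γ Δ : Ctx} {s : ℕ → Tm} {τ : Ty} (hs : Typed D (τ :: Γ) Δ s) :
    HasType D Δ (s 0) τ := hs 0 τ rfl

theorem Typed.shift {Γ Δ : Ctx} {ρ : ℕ → ℕ}
    (hρ : ∀ n τ, Γ[n]? = some τ → Δ[ρ n]? = some τ) (τ : Ty) :
    ∀ n σ, (τ :: Γ)[n]? = some σ → (τ :: Δ)[upr ρ n]? = some σ := by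
  intro n σ h
  cases n with
  | zero => exact h
  | succ n => exact hρ n σ (by simpa using h)

/-- Comes before substitution because lifting a substitution renames its values. At a recursive
definition, stability of the guard is applied to the renaming viewed as a substitution of variables.
-/
theorem HasType.rename (hD : D.Stable) {Γ : Ctx} {t : Tm} {τ : Ty} (h : HasType D Γ t τ) :
    ∀ {Δ : Ctx} {ρ : ℕ → ℕ}, (∀ n τ, Γ[n]? = some τ → Δ[ρ n]? = some τ) →
      HasType D Δ (t.rename ρ) τ := by
  induction h with
  | var h => intro Δ ρ hρ; exact .var (hρ _ _ h)
  | lam _ ih => intro Δ ρ hρ; exact .lam (ih (Typed.shift hρ _))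
  | @letrec Γ e I σ he hd ih =>
    intro Δ ρ hρ
    refine .letrec (ih (Typed.shift (Typed.shift hρ _) _)) ?_
    have := hD Γ Δ (fun n => .var (ρ n)) (fun n τ h => .var (hρ n τ h)) I σ e he hd
    rwa [upr_var, upr_var, ← Tm.rename_eq_subst] at this
  | _ => intro Δ ρ hρ; constructor <;> apply_assumption <;> assumption

theorem Typed.up (hD : D.Stable) {Γ Δ : Ctx} {s : ℕ → Tm} (hs : Typed D Γ Δ s) (τ : Ty) :
    Typed D (τ :: Γ) (τ :: Δ) (up s) := by
  intro n σ h
  cases n with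
  | zero => exact .var h
  | succ n => exact (hs n σ (by simpa using h)).rename hD (fun _ _ h => by simpa using h)

theorem HasType.subst (hD : D.Stable) {Γ : Ctx} {t : Tm} {τ : Ty} (h : HasType D Γ t τ) :
    ∀ {Δ : Ctx} {s : ℕ → Tm}, Typed D Γ Δ s → HasType D Δ (t.subst s) τ := by
  induction h with
  | var h => intro Δ s hs; exact hs _ _ h
  | lam _ ih => intro Δ s hs; exact .lam (ih (hs.up hD _))
  | @letrec Γ e I σ he hd ih =>
    intro Δ s hs
    exact .letrec (ih ((hs.up hD _).up hD _)) (hD Γ Δ s hs I σ e he hd)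
  | _ => intro Δ s hs; constructor <;> apply_assumption <;> assumption

theorem Typed.comp (hD : D.Stable) {Γ Δ Θ : Ctx} {s r : ℕ → Tm} (hs : Typed D Γ Δ s)
    (hr : Typed D Δ Θ r) : Typed D Γ Θ (cmp s r) := fun n τ h => (hs n τ h).subst hD hr

theorem Typed.wk {Γ : Ctx} (Γ' : Ctx) : Typed D Γ (Γ' ++ Γ) (sb [] Γ'.length) := by
  intro n τ h
  refine .var ?_
  rw [List.getElem?_append_right (by omega)]
  simpa using h

theorem Typed.wk_one {Γ : Ctx} {τ : Ty} : Typed D Γ (τ :: Γ) (sb [] 1) := Typed.wk [τ]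

theorem Typed.wk_two {Γ : Ctx} {τ σ : Ty} : Typed D Γ (τ :: σ :: Γ) (sb [] 2) := Typed.wk [τ, σ]

/-- A typable term has free variables only in its context, so later values of the substitution do
not matter. The purpose is to see that closed axioms are fixed by every substitution. -/
theorem HasType.subst_congr {Γ : Ctx} {t : Tm} {τ : Ty} (h : HasType D Γ t τ) :
    ∀ {s r : ℕ → Tm}, (∀ n < Γ.length, s n = r n) → t.subst s = t.subst r := by
  have hup : ∀ {s r : ℕ → Tm} {k : ℕ}, (∀ n < k, s n = r n) → ∀ n < k + 1, up s n = up r n := by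
    intro s r k h n hn
    cases n with
    | zero => rfl
    | succ n => simp [RelLogic.up, h n (by omega)]
  induction h with
  | var h => intro s r hsr; exact hsr _ (List.getElem?_eq_some_iff.1 h).1
  | lam _ ih => intro s r hsr; exact congrArg _ (ih (hup hsr))
  | letrec _ _ ih => intro s r hsr; exact congrArg _ (ih (hup (hup hsr)))
  | _ => intro s r hsr; simp only [Tm.subst]; try congr 1 <;> apply_assumption <;> assumption

/-! ## Well-typed assertions under substitution -/

theorem WfFm.subst (hD : D.Stable) {Γ : Ctx} {φ : Fm S.Pred} (h : WfFm D S Γ φ) :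
    ∀ {Δ : Ctx} {s : ℕ → Tm}, Typed D Γ Δ s → WfFm D S Δ (φ.subst s) := by
  induction h with
  | atom h =>
    intro Δ s hs
    refine .atom ?_
    rw [List.forall₂_map_left_iff]
    exact h.imp fun _ _ h => h.subst hD hs
  | all _ ih => intro Δ s hs; exact .all (ih (hs.up hD _))
  | ex _ ih => intro Δ s hs; exact .ex (ih (hs.up hD _))
  | _ => intro Δ s hs; constructor <;> apply_assumption <;> assumption

theorem WfFm.subst_congr {Γ : Ctx} {φ : Fm S.Pred} (h : WfFm D S Γ φ) :
    ∀ {s r : ℕ → Tm}, (∀ n < Γ.length, s n = r n) → φ.subst s = φ.subst r := by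
  have hup : ∀ {s r : ℕ → Tm} {k : ℕ}, (∀ n < k, s n = r n) → ∀ n < k + 1, up s n = up r n := by
    intro s r k h n hn
    cases n with
    | zero => rfl
    | succ n => simp [RelLogic.up, h n (by omega)]
  induction h with
  | @atom Γ p ts h =>
    intro s r hsr
    have : ts.map (Tm.subst s) = ts.map (Tm.subst r) := by
      generalize p.arity S = as at h
      induction h with
      | nil => rfl
      | cons h _ ih => simp only [List.map_cons, ih, h.subst_congr hsr]
    simp only [Fm.subst, this]
  | all _ ih => intro s r hsr; exact congrArg _ (ih (hup hsr))
  | ex _ ih => intro s r hsr; exact congrArg _ (ih (hup hsr))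
  | _ => intro s r hsr; simp only [Fm.subst]; try (congr 1 <;> apply_assumption <;> assumption)

theorem WfFm.subst_closed {φ : Fm S.Pred} (h : WfFm D S [] φ) (s : ℕ → Tm) : φ.subst s = φ :=
  (h.subst_congr (r := Tm.var) (by simp)).trans φ.subst_var

theorem WfFm.eq_iff {Γ : Ctx} {τ : Ty} {t u : Tm} :
    WfFm D S Γ (Fm.eq τ t u) ↔ HasType D Γ t τ ∧ HasType D Γ u τ := by
  constructor
  · rintro ⟨h⟩; simpa [PredSym.arity] using h
  · intro h; exact .atom (by simpa [PredSym.arity] using h)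

theorem WfFm.le_iff {Γ : Ctx} {I : Ind} {t u : Tm} :
    WfFm D S Γ (Fm.le I t u) ↔ HasType D Γ t I.ty ∧ HasType D Γ u I.ty := by
  constructor
  · rintro ⟨h⟩; simpa [PredSym.arity] using h
  · intro h; exact .atom (by simpa [PredSym.arity] using h)

theorem WfFm.lt_iff {Γ : Ctx} {I : Ind} {t u : Tm} :
    WfFm D S Γ (Fm.lt I t u) ↔ HasType D Γ t I.ty ∧ HasType D Γ u I.ty := by
  constructor
  · rintro ⟨h⟩; simpa [PredSym.arity] using h
  · intro h; exact .atom (by simpa [PredSym.arity] using h)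

theorem WfFm.imp_iff {Γ : Ctx} {φ ψ : Fm S.Pred} :
    WfFm D S Γ (.imp φ ψ) ↔ WfFm D S Γ φ ∧ WfFm D S Γ ψ :=
  ⟨by rintro ⟨⟩; constructor <;> assumption, fun h => .imp h.1 h.2⟩

theorem WfFm.and_iff {Γ : Ctx} {φ ψ : Fm S.Pred} :
    WfFm D S Γ (.and φ ψ) ↔ WfFm D S Γ φ ∧ WfFm D S Γ ψ :=
  ⟨by rintro ⟨⟩; constructor <;> assumption, fun h => .and h.1 h.2⟩

theorem WfFm.or_iff {Γ : Ctx} {φ ψ : Fm S.Pred} :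
    WfFm D S Γ (.or φ ψ) ↔ WfFm D S Γ φ ∧ WfFm D S Γ ψ :=
  ⟨by rintro ⟨⟩; constructor <;> assumption, fun h => .or h.1 h.2⟩

theorem WfFm.all_iff {Γ : Ctx} {τ : Ty} {φ : Fm S.Pred} :
    WfFm D S Γ (.all τ φ) ↔ WfFm D S (τ :: Γ) φ :=
  ⟨by rintro ⟨⟩; assumption, .all⟩

theorem WfFm.neg_iff {Γ : Ctx} {φ : Fm S.Pred} : WfFm D S Γ (Fm.neg φ) ↔ WfFm D S Γ φ :=
  ⟨by rintro ⟨⟩; assumption, fun h => .imp h .bot⟩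

theorem WfFm.iff_iff {Γ : Ctx} {φ ψ : Fm S.Pred} :
    WfFm D S Γ (Fm.iff φ ψ) ↔ WfFm D S Γ φ ∧ WfFm D S Γ ψ := by
  simp only [Fm.iff, WfFm.and_iff, WfFm.imp_iff]; tauto

theorem WfSet.insert {Γ : Ctx} {φ : Fm S.Pred} {Ψ : Set (Fm S.Pred)} (hΨ : WfSet D S Γ Ψ)
    (hφ : WfFm D S Γ φ) : WfSet D S Γ (insert φ Ψ) := by
  rintro ψ (rfl | h)
  · exact hφ
  · exact hΨ ψ h

theorem WfSet.wk_one (hD : D.Stable) {Γ : Ctx} {τ : Ty} {Ψ : Set (Fm S.Pred)}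
    (hΨ : WfSet D S Γ Ψ) : WfSet D S (τ :: Γ) (wkSet 1 Ψ) := by
  rintro _ ⟨ψ, h, rfl⟩
  exact (hΨ ψ h).subst hD Typed.wk_one

theorem WfSet.wk_two (hD : D.Stable) {Γ : Ctx} {τ σ : Ty} {Ψ : Set (Fm S.Pred)}
    (hΨ : WfSet D S Γ Ψ) : WfSet D S (τ :: σ :: Γ) (wkSet 2 Ψ) := by
  rintro _ ⟨ψ, h, rfl⟩
  exact (hΨ ψ h).subst hD Typed.wk_two

theorem wkSet_two {P : Type*} (Ψ : Set (Fm P)) : wkSet 2 Ψ = wkSet 1 (wkSet 1 Ψ) := by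
  simp only [wkSet, Set.image_image, Fm.wk, Fm.subst_subst, cmp_sb_nil]
  rfl

/-! ## Substitution and cut in HOL -/

theorem HOL.wf {Γ : Ctx} {Ψ : Set (Fm S.Pred)} {φ : Fm S.Pred} (h : HOL D S Γ Ψ φ) :
    WfHOL D S Γ Ψ φ := by
  cases h <;> assumption

/-- `HOL` is stable under well-typed substitutions that send every hypothesis into `Q`, for
a notion `Q` of derivability from the new hypotheses. -/
theorem HOL.subst_of (hD : D.Stable) (Q : Ctx → Set (Fm S.Pred) → Fm S.Pred → Prop)
    (hQ : ∀ {Δ Θ ψ}, WfSet D S Δ Θ → WfFm D S Δ ψ → Q Δ Θ ψ → HOL D S Δ Θ ψ)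
    (hmem : ∀ {Δ Θ ψ}, WfSet D S Δ Θ → ψ ∈ Θ → Q Δ Θ ψ)
    (hins : ∀ {Δ Θ ψ χ}, WfSet D S Δ Θ → WfFm D S Δ χ → Q Δ Θ ψ → Q Δ (insert χ Θ) ψ)
    (hwk : ∀ {Δ Θ ψ} (τ : Ty), WfSet D S Δ Θ → Q Δ Θ ψ → Q (τ :: Δ) (wkSet 1 Θ) (ψ.wk 1))
    {Γ : Ctx} {Ψ : Set (Fm S.Pred)} {φ : Fm S.Pred} (h : HOL D S Γ Ψ φ) :
    ∀ {Δ : Ctx} {Θ : Set (Fm S.Pred)} {s : ℕ → Tm}, Typed D Γ Δ s → WfSet D S Δ Θ →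
      (∀ ψ ∈ Ψ, Q Δ Θ (ψ.subst s)) → HOL D S Δ Θ (φ.subst s) := by
  -- `hI` and `hW` carry the condition on hypotheses into premises that add a hypothesis or a
  -- variable.
  have hI : ∀ {Δ : Ctx} {Ψ Θ : Set (Fm S.Pred)} {s : ℕ → Tm} {χ : Fm S.Pred},
      WfSet D S Δ Θ → WfFm D S Δ (χ.subst s) → (∀ ψ ∈ Ψ, Q Δ Θ (ψ.subst s)) →
      ∀ ψ ∈ insert χ Ψ, Q Δ (insert (χ.subst s) Θ) (ψ.subst s) := by
    rintro Δ Ψ Θ s χ hΘ hχ h ψ (rfl | hψ)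
    · exact hmem (hΘ.insert hχ) (Set.mem_insert _ _)
    · exact hins hΘ hχ (h ψ hψ)
  have hW : ∀ {Δ : Ctx} {Ψ Θ : Set (Fm S.Pred)} {s : ℕ → Tm} (τ : Ty),
      WfSet D S Δ Θ → (∀ ψ ∈ Ψ, Q Δ Θ (ψ.subst s)) →
      ∀ ψ ∈ wkSet 1 Ψ, Q (τ :: Δ) (wkSet 1 Θ) (ψ.subst (up s)) := by
    rintro Δ Ψ Θ s τ hΘ h _ ⟨ψ, hψ, rfl⟩
    have := hwk τ hΘ (h ψ hψ)
    simpa [Fm.wk, up_eq] using this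
  have inst : ∀ (φ : Fm S.Pred) (t : Tm) (s : ℕ → Tm),
      (φ.inst₁ 0 t).subst s = (φ.subst (up s)).inst₁ 0 (t.subst s) := by
    intro φ t s; simp [Fm.inst₁]
  induction h with
  | ax hw hm => intro Δ Θ s hs hΘ hΨ; exact hQ hΘ (hw.2.subst hD hs) (hΨ _ hm)
  | conv hw ht hu hc =>
    intro Δ Θ s hs hΘ hΨ
    exact .conv ⟨hΘ, hw.2.subst hD hs⟩ (ht.subst hD hs) (hu.subst hD hs) (hc.subst s)
  | subst hw hφ _ _ ih₁ ih₂ =>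
    intro Δ Θ s hs hΘ hΨ
    have hw' := hw.2.subst hD hs
    have h₁ := ih₁ hs hΘ hΨ
    have h₂ := ih₂ hs hΘ hΨ
    rw [inst] at hw' h₁ ⊢
    exact .subst ⟨hΘ, hw'⟩ (hφ.subst hD (hs.up hD _)) h₁ h₂
  | impI hw _ ih =>
    intro Δ Θ s hs hΘ hΨ
    have hψ := (WfFm.imp_iff.1 hw.2).1.subst hD hs
    exact .impI ⟨hΘ, hw.2.subst hD hs⟩ (ih hs (hΘ.insert hψ) (hI hΘ hψ hΨ))
  | allI hw _ ih =>
    intro Δ Θ s hs hΘ hΨ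
    exact .allI ⟨hΘ, hw.2.subst hD hs⟩ (ih (hs.up hD _) (hΘ.wk_one hD) (hW _ hΘ hΨ))
  | allE hw _ ht ih =>
    intro Δ Θ s hs hΘ hΨ
    have hw' := hw.2.subst hD hs
    rw [inst] at hw' ⊢
    exact .allE ⟨hΘ, hw'⟩ (ih hs hΘ hΨ) (ht.subst hD hs)
  | exI hw ht _ ih =>
    intro Δ Θ s hs hΘ hΨ
    have h := ih hs hΘ hΨ
    rw [inst] at h
    exact .exI ⟨hΘ, hw.2.subst hD hs⟩ (ht.subst hD hs) h
  | @exE Γ Ψ σ φ χ hw h₁ h₂ ih₁ ih₂ =>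
    intro Δ Θ s hs hΘ hΨ
    refine .exE ⟨hΘ, hw.2.subst hD hs⟩ (ih₁ hs hΘ hΨ) ?_
    have hφ : WfFm D S (σ :: Δ) (φ.subst (up s)) :=
      (h₂.wf.1 _ (Set.mem_insert _ _)).subst hD (hs.up hD _)
    have := ih₂ (hs.up hD σ) ((hΘ.wk_one hD).insert hφ) (hI (hΘ.wk_one hD) hφ (hW σ hΘ hΨ))
    simpa [Fm.wk, up_eq] using this
  | orE hw h₁ h₂ h₃ ih₁ ih₂ ih₃ =>
    intro Δ Θ s hs hΘ hΨ
    have hψ := WfFm.or_iff.1 (h₁.wf.2.subst hD hs)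
    exact .orE ⟨hΘ, hw.2.subst hD hs⟩ (ih₁ hs hΘ hΨ)
      (ih₂ hs (hΘ.insert hψ.1) (hI hΘ hψ.1 hΨ)) (ih₃ hs (hΘ.insert hψ.2) (hI hΘ hψ.2 hΨ))
  | bool hw _ _ ih₁ ih₂ =>
    intro Δ Θ s hs hΘ hΨ
    have h₁ := ih₁ hs hΘ hΨ
    have h₂ := ih₂ hs hΘ hΨ
    rw [inst] at h₁ h₂
    exact .bool ⟨hΘ, hw.2.subst hD hs⟩ h₁ h₂
  | @nat Γ Ψ φ hw _ h₂ ih₁ ih₂ =>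
    intro Δ Θ s hs hΘ hΨ
    have h₁ := ih₁ hs hΘ hΨ
    rw [inst] at h₁
    refine .nat ⟨hΘ, hw.2.subst hD hs⟩ h₁ ?_
    have hφ := (h₂.wf.1 _ (Set.mem_insert _ _)).subst hD (hs.up hD _)
    have := ih₂ (hs.up hD .nat) ((hΘ.wk_one hD).insert hφ) (hI (hΘ.wk_one hD) hφ (hW _ hΘ hΨ))
    simpa [Fm.inst₁, up_eq, Tm.subst] using this
  | @list Γ Ψ τ φ hw _ h₂ ih₁ ih₂ =>
    intro Δ Θ s hs hΘ hΨ
    have h₁ := ih₁ hs hΘ hΨ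
    rw [inst] at h₁
    refine .list ⟨hΘ, hw.2.subst hD hs⟩ h₁ ?_
    have hs' := (hs.up hD τ).up hD (.list τ)
    have hφ := (h₂.wf.1 _ (Set.mem_insert _ _)).subst hD hs'
    have hΘ' := hΘ.wk_two hD (τ := .list τ) (σ := τ)
    -- List induction binds head and tail together, while `Q` is closed under weakening by one
    -- variable; hence the shift by two is split.
    have := ih₂ hs' (hΘ'.insert hφ) (hI hΘ' hφ (by
      rw [wkSet_two, wkSet_two]; exact hW _ (hΘ.wk_one hD) (hW _ hΘ hΨ)))
    have hsh : cmp (sb [] 1) (sb [] 1) = sb [] 2 := rfl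
    simpa [Fm.inst₁, up_eq, Tm.subst, hsh, drop_two] using this
  | sig hw hm hc =>
    intro Δ Θ s hs hΘ hΨ
    have hw' := hw.2.subst hD hs
    -- Axioms are closed, so their instances are the axioms themselves.
    rw [hc.subst_closed] at hw' ⊢
    exact .sig ⟨hΘ, hw'⟩ hm hc
  | impE hw _ _ ih₁ ih₂ =>
    intro Δ Θ s hs hΘ hΨ
    exact .impE ⟨hΘ, hw.2.subst hD hs⟩ (ih₁ hs hΘ hΨ) (ih₂ hs hΘ hΨ)
  | botE hw _ ih =>
    intro Δ Θ s hs hΘ hΨ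
    exact .botE ⟨hΘ, hw.2.subst hD hs⟩ (ih hs hΘ hΨ)
  | andI hw _ _ ih₁ ih₂ =>
    intro Δ Θ s hs hΘ hΨ
    exact .andI ⟨hΘ, hw.2.subst hD hs⟩ (ih₁ hs hΘ hΨ) (ih₂ hs hΘ hΨ)
  | andE₁ hw _ ih =>
    intro Δ Θ s hs hΘ hΨ
    exact .andE₁ ⟨hΘ, hw.2.subst hD hs⟩ (ih hs hΘ hΨ)
  | andE₂ hw _ ih =>
    intro Δ Θ s hs hΘ hΨ
    exact .andE₂ ⟨hΘ, hw.2.subst hD hs⟩ (ih hs hΘ hΨ)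
  | orI₁ hw _ ih =>
    intro Δ Θ s hs hΘ hΨ
    exact .orI₁ ⟨hΘ, hw.2.subst hD hs⟩ (ih hs hΘ hΨ)
  | orI₂ hw _ ih =>
    intro Δ Θ s hs hΘ hΨ
    exact .orI₂ ⟨hΘ, hw.2.subst hD hs⟩ (ih hs hΘ hΨ)
  | injSucc hw _ ih =>
    intro Δ Θ s hs hΘ hΨ
    exact .injSucc ⟨hΘ, hw.2.subst hD hs⟩ (ih hs hΘ hΨ)
  | injCons₁ hw _ ih =>
    intro Δ Θ s hs hΘ hΨ
    exact .injCons₁ ⟨hΘ, hw.2.subst hD hs⟩ (ih hs hΘ hΨ)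
  | injCons₂ hw _ ih =>
    intro Δ Θ s hs hΘ hΨ
    exact .injCons₂ ⟨hΘ, hw.2.subst hD hs⟩ (ih hs hΘ hΨ)
  | topI hw => intro Δ Θ s hs hΘ hΨ; exact .topI ⟨hΘ, hw.2.subst hD hs⟩
  | ncBool hw => intro Δ Θ s hs hΘ hΨ; exact .ncBool ⟨hΘ, hw.2.subst hD hs⟩
  | ncNat hw => intro Δ Θ s hs hΘ hΨ; exact .ncNat ⟨hΘ, hw.2.subst hD hs⟩
  | ncList hw => intro Δ Θ s hs hΘ hΨ; exact .ncList ⟨hΘ, hw.2.subst hD hs⟩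
  | ltZero hw => intro Δ Θ s hs hΘ hΨ; exact .ltZero ⟨hΘ, hw.2.subst hD hs⟩
  | ltSucc hw => intro Δ Θ s hs hΘ hΨ; exact .ltSucc ⟨hΘ, hw.2.subst hD hs⟩
  | zeroLe hw => intro Δ Θ s hs hΘ hΨ; exact .zeroLe ⟨hΘ, hw.2.subst hD hs⟩
  | succLe hw => intro Δ Θ s hs hΘ hΨ; exact .succLe ⟨hΘ, hw.2.subst hD hs⟩
  | ltNil hw => intro Δ Θ s hs hΘ hΨ; exact .ltNil ⟨hΘ, hw.2.subst hD hs⟩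
  | ltCons hw => intro Δ Θ s hs hΘ hΨ; exact .ltCons ⟨hΘ, hw.2.subst hD hs⟩
  | nilLe hw => intro Δ Θ s hs hΘ hΨ; exact .nilLe ⟨hΘ, hw.2.subst hD hs⟩
  | consLe hw => intro Δ Θ s hs hΘ hΨ; exact .consLe ⟨hΘ, hw.2.subst hD hs⟩

/-- Weakening of the hypotheses and substitution. -/
theorem HOL.subst_mono (hD : D.Stable) {Γ Δ : Ctx} {Ψ Θ : Set (Fm S.Pred)} {φ : Fm S.Pred}
    {s : ℕ → Tm} (h : HOL D S Γ Ψ φ) (hs : Typed D Γ Δ s) (hΘ : WfSet D S Δ Θ)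
    (hΨ : ∀ ψ ∈ Ψ, ψ.subst s ∈ Θ) : HOL D S Δ Θ (φ.subst s) :=
  -- With `Q` taken as membership, all side conditions are immediate; the result is the weakening
  -- that the next choice of `Q` requires.
  h.subst_of hD (fun _ Θ ψ => ψ ∈ Θ) (fun h₁ h₂ h₃ => .ax ⟨h₁, h₂⟩ h₃) (fun _ h => h)
    (fun _ _ h => Set.mem_insert_of_mem _ h) (fun _ _ h => Set.mem_image_of_mem _ h) hs hΘ hΨ

theorem HOL.mono (hD : D.Stable) {Γ : Ctx} {Ψ Θ : Set (Fm S.Pred)} {φ : Fm S.Pred}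
    (h : HOL D S Γ Ψ φ) (hΘ : WfSet D S Γ Θ) (hΨ : Ψ ⊆ Θ) : HOL D S Γ Θ φ := by
  simpa using h.subst_mono hD Typed.var hΘ (fun ψ h => by simpa using hΨ h)

/-! ### Points of a context -/

/-- A well-typed substitution from `Γ` to `Δ` under which the hypotheses `Ψ` follow from `Θ`. -/
structure Env (D : Guard) (S : Sig) (Γ : Ctx) (Ψ : Set (Fm S.Pred)) (Δ : Ctx)
    (Θ : Set (Fm S.Pred)) (s : ℕ → Tm) : Prop where
  wf : WfSet D S Δ Θ
  ty : Typed D Γ Δ s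
  hyp : ∀ ψ ∈ Ψ, HOL D S Δ Θ (ψ.subst s)

section

variable {Γ Δ Δ' : Ctx} {Ψ Θ Θ' : Set (Fm S.Pred)} {φ : Fm S.Pred} {s r : ℕ → Tm}

/-- Substitution and cut. -/
theorem HOL.at (hD : D.Stable) (h : HOL D S Γ Ψ φ) (E : Env D S Γ Ψ Δ Θ s) :
    HOL D S Δ Θ (φ.subst s) :=
  -- Now `Q` is derivability, which turns substitution into cut; stability under a new hypothesis or
  -- variable is the weakening already proved.
  h.subst_of hD (fun Δ Θ ψ => HOL D S Δ Θ ψ) (fun _ _ h => h)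
    (fun h₁ h₂ => .ax ⟨h₁, h₁ _ h₂⟩ h₂)
    (fun h₁ h₂ h => h.mono hD (h₁.insert h₂) (Set.subset_insert _ _))
    (fun _ h₁ h => h.subst_mono hD Typed.wk_one (h₁.wk_one hD)
      (fun _ h => Set.mem_image_of_mem _ h)) E.ty E.wf E.hyp

theorem Env.id (hΨ : WfSet D S Γ Ψ) : Env D S Γ Ψ Γ Ψ Tm.var :=
  ⟨hΨ, Typed.var, fun ψ h => by simpa using HOL.ax ⟨hΨ, hΨ ψ h⟩ h⟩

theorem Env.comp (hD : D.Stable) (E : Env D S Γ Ψ Δ Θ s) (F : Env D S Δ Θ Δ' Θ' r) :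
    Env D S Γ Ψ Δ' Θ' (cmp s r) :=
  ⟨F.wf, E.ty.comp hD F.ty, fun ψ h => by simpa using (E.hyp ψ h).at hD F⟩

theorem Env.insert (E : Env D S Γ Ψ Δ Θ s) (h : HOL D S Δ Θ (φ.subst s)) :
    Env D S Γ (insert φ Ψ) Δ Θ s := by
  refine ⟨E.wf, E.ty, ?_⟩
  rintro ψ (rfl | hψ)
  · exact h
  · exact E.hyp ψ hψ

theorem Env.insert₂ {ψ : Fm S.Pred} (E : Env D S Γ Ψ Δ Θ s) (h : HOL D S Δ Θ (φ.subst s))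
    (h' : HOL D S Δ Θ (ψ.subst s)) : Env D S Γ (Insert.insert φ (Insert.insert ψ Ψ)) Δ Θ s :=
  Env.insert (Env.insert E h') h

theorem Env.wk (E : Env D S Γ Ψ Δ Θ s) {Γ' : Ctx} {s' : ℕ → Tm} (k : ℕ) (h : Typed D Γ' Δ s')
    (hs : drop k s' = s) : Env D S Γ' (wkSet k Ψ) Δ Θ s' := by
  refine ⟨E.wf, h, ?_⟩
  rintro _ ⟨ψ, hψ, rfl⟩
  simpa [Fm.wk, hs] using E.hyp ψ hψ

theorem Env.cons (E : Env D S Γ Ψ Δ Θ s) {u : Tm} {τ : Ty} (hu : HasType D Δ u τ) :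
    Env D S (τ :: Γ) (wkSet 1 Ψ) Δ Θ (u ∷ s) :=
  E.wk 1 (E.ty.scons hu) rfl

theorem Env.of_insert (E : Env D S Γ (Insert.insert φ Ψ) Δ Θ s) :
    Env D S Γ Ψ Δ Θ s ∧ HOL D S Δ Θ (φ.subst s) :=
  ⟨⟨E.wf, E.ty, fun ψ h => E.hyp ψ (Set.mem_insert_of_mem _ h)⟩, E.hyp _ (Set.mem_insert _ _)⟩

/-- With `Env.cons`, identifies points of an extended context with a point and a typed term. Binders
in premises are interpreted in this way. -/
theorem Env.of_wk {τ : Ty} (E : Env D S (τ :: Γ) (wkSet 1 Ψ) Δ Θ s) :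
    ∃ u s', s = u ∷ s' ∧ Env D S Γ Ψ Δ Θ s' ∧ HasType D Δ u τ :=
  ⟨s 0, drop 1 s, (scons_eta s).symm, ⟨E.wf, E.ty.tail, fun ψ h => by
    simpa [Fm.wk] using E.hyp _ (Set.mem_image_of_mem _ h)⟩, E.ty.head⟩

/-- The identity is the generic point, so validity at all points includes derivability itself. -/
theorem HOL.of_points (hΨ : WfSet D S Γ Ψ)
    (h : ∀ Δ Θ s, Env D S Γ Ψ Δ Θ s → HOL D S Δ Θ (φ.subst s)) : HOL D S Γ Ψ φ := by
  simpa using h _ _ _ (Env.id hΨ)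

end

/-! ## Derived rules of HOL at the points of a context -/

section

variable {Γ Δ : Ctx} {Ψ Θ : Set (Fm S.Pred)} {φ ψ χ : Fm S.Pred} {s e : ℕ → Tm} {τ σ : Ty}
  {a b c t u v : Tm}

/-- The instance is recorded as a longer environment, so iterated eliminations leave no nested
substitutions. `e` need not be typed: well-typedness of the instance comes from that of the
universal assertion. -/
theorem HOL.elim_all (hD : D.Stable) (h : HOL D S Δ Θ ((Fm.all τ φ).subst e))
    (ha : HasType D Δ a τ) : HOL D S Δ Θ (φ.subst (a ∷ e)) := by
  have hw : WfFm D S (τ :: Δ) (φ.subst (up e)) := WfFm.all_iff.1 h.wf.2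
  have hi : (φ.subst (up e)).inst₁ 0 a = φ.subst (a ∷ e) := by simp [Fm.inst₁, sb_nil_zero]
  have hw' : WfFm D S Δ (φ.subst (a ∷ e)) := by
    simpa [Fm.inst₁] using hw.subst hD (Typed.var.scons ha)
  rw [← hi] at hw' ⊢
  exact .allE ⟨h.wf.1, hw'⟩ h ha

theorem HOL.elim_imp (h : HOL D S Δ Θ (.imp φ ψ)) (h' : HOL D S Δ Θ φ) : HOL D S Δ Θ ψ :=
  .impE ⟨h.wf.1, (WfFm.imp_iff.1 h.wf.2).2⟩ h h'

theorem HOL.left (h : HOL D S Δ Θ (.and φ ψ)) : HOL D S Δ Θ φ :=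
  .andE₁ ⟨h.wf.1, (WfFm.and_iff.1 h.wf.2).1⟩ h

theorem HOL.right (h : HOL D S Δ Θ (.and φ ψ)) : HOL D S Δ Θ ψ :=
  .andE₂ ⟨h.wf.1, (WfFm.and_iff.1 h.wf.2).2⟩ h

theorem HOL.intro_and (h : HOL D S Δ Θ φ) (h' : HOL D S Δ Θ ψ) : HOL D S Δ Θ (.and φ ψ) :=
  .andI ⟨h.wf.1, .and h.wf.2 h'.wf.2⟩ h h'

theorem HOL.mp (h : HOL D S Δ Θ (Fm.iff φ ψ)) (h' : HOL D S Δ Θ φ) : HOL D S Δ Θ ψ :=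
  HOL.elim_imp (HOL.left h) h'

theorem HOL.mpr (h : HOL D S Δ Θ (Fm.iff φ ψ)) (h' : HOL D S Δ Θ ψ) : HOL D S Δ Θ φ :=
  HOL.elim_imp (HOL.right h) h'

theorem HOL.absurd (h : HOL D S Δ Θ (Fm.neg φ)) (h' : HOL D S Δ Θ φ) (hψ : WfFm D S Δ ψ) :
    HOL D S Δ Θ ψ :=
  .botE ⟨h.wf.1, hψ⟩ (HOL.elim_imp h h')

/-- A point satisfying the additional hypothesis `φ` is a point of the old hypotheses at which `φ`
is derivable. A metalevel implication valid at all points therefore discharges `φ`. -/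
theorem HOL.intro_imp (hΨ : WfSet D S Γ Ψ) (hφ : WfFm D S Γ φ) (hψ : WfFm D S Γ ψ)
    (h : ∀ Δ Θ s, Env D S Γ Ψ Δ Θ s → HOL D S Δ Θ (φ.subst s) → HOL D S Δ Θ (ψ.subst s)) :
    HOL D S Γ Ψ (.imp φ ψ) :=
  .impI ⟨hΨ, .imp hφ hψ⟩ (HOL.of_points (hΨ.insert hφ) fun Δ Θ s E =>
    h Δ Θ s E.of_insert.1 E.of_insert.2)

theorem HOL.intro_all_imp (hD : D.Stable) (hΨ : WfSet D S Γ Ψ)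
    (hw : WfFm D S Γ (.all τ (.imp φ ψ)))
    (h : ∀ Δ Θ s a, Env D S Γ Ψ Δ Θ s → HasType D Δ a τ → HOL D S Δ Θ (φ.subst (a ∷ s)) →
      HOL D S Δ Θ (ψ.subst (a ∷ s))) :
    HOL D S Γ Ψ (.all τ (.imp φ ψ)) := by
  have hw' := WfFm.imp_iff.1 (WfFm.all_iff.1 hw)
  refine .allI ⟨hΨ, hw⟩ (HOL.intro_imp (hΨ.wk_one hD) hw'.1 hw'.2 fun Δ Θ s E => ?_)
  obtain ⟨u, s', rfl, E', hu⟩ := E.of_wk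
  exact h Δ Θ s' u E' hu

theorem HOL.intro_all_all_imp (hD : D.Stable) (hΨ : WfSet D S Γ Ψ)
    (hw : WfFm D S Γ (.all τ (.all σ (.imp φ ψ))))
    (h : ∀ Δ Θ s a b, Env D S Γ Ψ Δ Θ s → HasType D Δ a τ → HasType D Δ b σ →
      HOL D S Δ Θ (φ.subst (b ∷ a ∷ s)) → HOL D S Δ Θ (ψ.subst (b ∷ a ∷ s))) :
    HOL D S Γ Ψ (.all τ (.all σ (.imp φ ψ))) := by
  refine .allI ⟨hΨ, hw⟩ (HOL.intro_all_imp hD (hΨ.wk_one hD) (WfFm.all_iff.1 hw)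
    fun Δ Θ s b E => ?_)
  obtain ⟨u, s', rfl, E', hu⟩ := E.of_wk
  exact h Δ Θ s' u b E' hu

theorem HOL.elim_or (h : HOL D S Γ Ψ (.or φ ψ)) (hχ : WfFm D S Γ χ)
    (h₁ : ∀ Δ Θ s, Env D S Γ Ψ Δ Θ s → HOL D S Δ Θ (φ.subst s) → HOL D S Δ Θ (χ.subst s))
    (h₂ : ∀ Δ Θ s, Env D S Γ Ψ Δ Θ s → HOL D S Δ Θ (ψ.subst s) → HOL D S Δ Θ (χ.subst s)) :
    HOL D S Γ Ψ χ := by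
  obtain ⟨hΨ, hw⟩ := h.wf
  rw [WfFm.or_iff] at hw
  exact .orE ⟨hΨ, hχ⟩ h
    (HOL.of_points (hΨ.insert hw.1) fun Δ Θ s E => h₁ Δ Θ s E.of_insert.1 E.of_insert.2)
    (HOL.of_points (hΨ.insert hw.2) fun Δ Θ s E => h₂ Δ Θ s E.of_insert.1 E.of_insert.2)

/-! ### Equality -/

theorem HOL.of_conv (hΘ : WfSet D S Δ Θ) (ht : HasType D Δ t τ) (hu : HasType D Δ u τ)
    (h : Conv t u) : HOL D S Δ Θ (Fm.eq τ t u) :=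
  .conv ⟨hΘ, WfFm.eq_iff.2 ⟨ht, hu⟩⟩ ht hu h

theorem HOL.refl (hΘ : WfSet D S Δ Θ) (ht : HasType D Δ t τ) : HOL D S Δ Θ (Fm.eq τ t t) :=
  .of_conv hΘ ht ht (.refl _)

theorem HOL.eq_types (h : HOL D S Δ Θ (Fm.eq τ a b)) : HasType D Δ a τ ∧ HasType D Δ b τ :=
  WfFm.eq_iff.1 h.wf.2

/-- Replacement of equals at the head of an environment. -/
theorem HOL.rw_head (hD : D.Stable) (hφ : WfFm D S (τ :: Γ) φ) (hs : Typed D Γ Δ s)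
    (h : HOL D S Δ Θ (Fm.eq τ a b)) (h' : HOL D S Δ Θ (φ.subst (a ∷ s))) :
    HOL D S Δ Θ (φ.subst (b ∷ s)) := by
  have hi : ∀ a, (φ.subst (up s)).inst₁ 0 a = φ.subst (a ∷ s) := fun a => by
    simp [Fm.inst₁, sb_nil_zero]
  rw [← hi] at h' ⊢
  refine .subst ⟨h.wf.1, ?_⟩ (hφ.subst hD (hs.up hD τ)) h' h
  rw [hi]
  exact hφ.subst hD (hs.scons h.eq_types.2)

theorem HOL.symm (hD : D.Stable) (h : HOL D S Δ Θ (Fm.eq τ a b)) : HOL D S Δ Θ (Fm.eq τ b a) := by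
  have ha := h.eq_types.1
  have := HOL.rw_head hD (φ := Fm.eq τ (.var 0) (.var 1))
    (WfFm.eq_iff.2 ⟨.var rfl, .var rfl⟩) (Typed.var.scons ha) h
  simpa [Tm.subst] using this (by simpa [Tm.subst] using HOL.refl h.wf.1 ha)

theorem HOL.trans (hD : D.Stable) (h : HOL D S Δ Θ (Fm.eq τ a b)) (h' : HOL D S Δ Θ (Fm.eq τ b c)) :
    HOL D S Δ Θ (Fm.eq τ a c) := by
  have := HOL.rw_head hD (φ := Fm.eq τ (.var 1) (.var 0))
    (WfFm.eq_iff.2 ⟨.var rfl, .var rfl⟩) (Typed.var.scons h.eq_types.1) h'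
  simpa [Tm.subst] using this (by simpa [Tm.subst] using h)

/-- Replacement of equals at the second entry of an environment. -/
theorem HOL.rw_second (hD : D.Stable) (hφ : WfFm D S (σ :: τ :: Γ) φ) (hs : Typed D Γ Δ s)
    (hc : HasType D Δ c σ) (h : HOL D S Δ Θ (Fm.eq τ a b))
    (h' : HOL D S Δ Θ (φ.subst (c ∷ a ∷ s))) : HOL D S Δ Θ (φ.subst (c ∷ b ∷ s)) := by
  -- Exchanging the two innermost variables reduces the claim to replacement at the head.
  have hsw : Typed D (σ :: τ :: Γ) (τ :: σ :: Γ) (.var 1 ∷ .var 0 ∷ sb [] 2) :=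
    (Typed.wk_two.scons (.var rfl)).scons (.var rfl)
  have := HOL.rw_head hD (hφ.subst hD hsw) (hs.scons hc) h
  simp only [Fm.subst_subst, cmp_scons, Tm.subst, scons_one, scons_zero, cmp_sb_nil, drop_two,
    drop_one] at this
  exact this h'

/-- Oriented for backward use: the equations lead from redexes to contracta, the goal concerns the
redexes, and the premises of a rule speak of the contracta. -/
theorem HOL.rw₂ (hD : D.Stable) {τ₁ τ₂ : Ty} {a₁ b₁ a₂ b₂ : Tm}
    (hφ : WfFm D S (τ₂ :: τ₁ :: Γ) φ) (hs : Typed D Γ Δ s)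
    (h₁ : HOL D S Δ Θ (Fm.eq τ₁ a₁ b₁)) (h₂ : HOL D S Δ Θ (Fm.eq τ₂ a₂ b₂))
    (h : HOL D S Δ Θ (φ.subst (b₂ ∷ b₁ ∷ s))) : HOL D S Δ Θ (φ.subst (a₂ ∷ a₁ ∷ s)) :=
  HOL.rw_head hD hφ (hs.scons h₁.eq_types.1) (HOL.symm hD h₂)
    (HOL.rw_second hD hφ hs h₂.eq_types.2 (HOL.symm hD h₁) h)

/-- Leibniz replacement in the predicate c[a] = c[x] of x, starting from reflexivity; the left side
is shifted so that it does not depend on x. -/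
theorem HOL.congr (hD : D.Stable) (hc : HasType D (τ :: Γ) c σ) (hs : Typed D Γ Δ s)
    (h : HOL D S Δ Θ (Fm.eq τ a b)) :
    HOL D S Δ Θ (Fm.eq σ (c.subst (a ∷ s)) (c.subst (b ∷ s))) := by
  have hca := hc.subst hD (hs.scons h.eq_types.1)
  have := HOL.rw_head hD
    (φ := Fm.eq σ ((c.subst (a ∷ s)).subst (sb [] 1)) (c.subst (up s))) (τ := τ) (s := Tm.var)
    (WfFm.eq_iff.2 ⟨hca.subst hD Typed.wk_one, hc.subst hD (hs.up hD τ)⟩) Typed.var h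
  simp only [Fm.subst_eq, Tm.subst_subst, cmp_assoc, cmp_scons, cmp_up_scons, cmp_sb_nil, drop_one,
    cmp_right_var, Tm.subst_var] at this
  exact this (HOL.refl h.wf.1 hca)

/-! ### Case distinctions -/

/-- Congruence replaces the scrutinee by its constructor form, and one reduction step finishes. The
congruence uses a case distinction on three variables, with the branches loaded into the
environment. The five lemmas that follow have the same proof. -/
theorem HOL.caseB_tt (hD : D.Stable) (h : HOL D S Δ Θ (Fm.eq .bool t .tt)) (hu : HasType D Δ u σ)
    (hv : HasType D Δ v σ) : HOL D S Δ Θ (Fm.eq σ (.caseB t u v) u) := by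
  have := HOL.congr hD (c := .caseB (.var 0) (.var 1) (.var 2)) (σ := σ) (Γ := [σ, σ])
    (.caseB (.var rfl) (.var rfl) (.var rfl))
    ((Typed.scons (Typed.scons (s := Tm.var) (Γ := []) (by simp [Typed]) hv) hu)) h
  exact HOL.trans hD this (.of_conv h.wf.1 (.caseB .tt hu hv) hu (.rel _ _ (.caseB_tt _ _)))

theorem HOL.caseB_ff (hD : D.Stable) (h : HOL D S Δ Θ (Fm.eq .bool t .ff)) (hu : HasType D Δ u σ)
    (hv : HasType D Δ v σ) : HOL D S Δ Θ (Fm.eq σ (.caseB t u v) v) := by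
  have := HOL.congr hD (c := .caseB (.var 0) (.var 1) (.var 2)) (σ := σ) (Γ := [σ, σ])
    (.caseB (.var rfl) (.var rfl) (.var rfl))
    ((Typed.scons (Typed.scons (s := Tm.var) (Γ := []) (by simp [Typed]) hv) hu)) h
  exact HOL.trans hD this (.of_conv h.wf.1 (.caseB .ff hu hv) hv (.rel _ _ (.caseB_ff _ _)))

theorem HOL.caseN_zero (hD : D.Stable) (h : HOL D S Δ Θ (Fm.eq .nat t .zero))
    (hu : HasType D Δ u σ) (hv : HasType D Δ v (.arr .nat σ)) :
    HOL D S Δ Θ (Fm.eq σ (.caseN t u v) u) := by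
  have := HOL.congr hD (c := .caseN (.var 0) (.var 1) (.var 2)) (σ := σ) (Γ := [σ, .arr .nat σ])
    (.caseN (.var rfl) (.var rfl) (.var rfl))
    ((Typed.scons (Typed.scons (s := Tm.var) (Γ := []) (by simp [Typed]) hv) hu)) h
  exact HOL.trans hD this (.of_conv h.wf.1 (.caseN .zero hu hv) hu (.rel _ _ (.caseN_zero _ _)))

theorem HOL.caseN_succ (hD : D.Stable) (h : HOL D S Δ Θ (Fm.eq .nat t (.succ a)))
    (ha : HasType D Δ a .nat) (hu : HasType D Δ u σ) (hv : HasType D Δ v (.arr .nat σ)) :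
    HOL D S Δ Θ (Fm.eq σ (.caseN t u v) (.app v a)) := by
  have := HOL.congr hD (c := .caseN (.var 0) (.var 1) (.var 2)) (σ := σ) (Γ := [σ, .arr .nat σ])
    (.caseN (.var rfl) (.var rfl) (.var rfl))
    ((Typed.scons (Typed.scons (s := Tm.var) (Γ := []) (by simp [Typed]) hv) hu)) h
  exact HOL.trans hD this (.of_conv h.wf.1 (.caseN (.succ ha) hu hv) (.app hv ha)
    (.rel _ _ (.caseN_succ _ _ _)))

theorem HOL.caseL_nil (hD : D.Stable) (h : HOL D S Δ Θ (Fm.eq (.list τ) t .nil))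
    (hu : HasType D Δ u σ) (hv : HasType D Δ v (.arr τ (.arr (.list τ) σ))) :
    HOL D S Δ Θ (Fm.eq σ (.caseL t u v) u) := by
  have := HOL.congr hD (c := .caseL (.var 0) (.var 1) (.var 2)) (σ := σ)
    (Γ := [σ, .arr τ (.arr (.list τ) σ)]) (.caseL (.var rfl) (.var rfl) (.var rfl))
    ((Typed.scons (Typed.scons (s := Tm.var) (Γ := []) (by simp [Typed]) hv) hu)) h
  exact HOL.trans hD this (.of_conv h.wf.1 (.caseL .nil hu hv) hu (.rel _ _ (.caseL_nil _ _)))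

theorem HOL.caseL_cons (hD : D.Stable) (h : HOL D S Δ Θ (Fm.eq (.list τ) t (.cons a b)))
    (ha : HasType D Δ a τ) (hb : HasType D Δ b (.list τ))
    (hu : HasType D Δ u σ) (hv : HasType D Δ v (.arr τ (.arr (.list τ) σ))) :
    HOL D S Δ Θ (Fm.eq σ (.caseL t u v) (.app (.app v a) b)) := by
  have := HOL.congr hD (c := .caseL (.var 0) (.var 1) (.var 2)) (σ := σ)
    (Γ := [σ, .arr τ (.arr (.list τ) σ)]) (.caseL (.var rfl) (.var rfl) (.var rfl))
    ((Typed.scons (Typed.scons (s := Tm.var) (Γ := []) (by simp [Typed]) hv) hu)) h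
  exact HOL.trans hD this (.of_conv h.wf.1 (.caseL (.cons ha hb) hu hv) (.app (.app hv ha) hb)
    (.rel _ _ (.caseL_cons _ _ _ _)))

/-! ### Structural induction and case analysis -/

/-- The constructor `0` or `[]`. -/
def Ind.base : Ind → Tm
  | .nat => .zero
  | .list _ => .nil

/-- `y` is `S x`, or `h :: x` for some `h`. -/
inductive IsSucc (D : Guard) (Δ : Ctx) : Ind → Tm → Tm → Prop
  | succ {x : Tm} : HasType D Δ x .nat → IsSucc D Δ .nat x (.succ x)
  | cons {τ : Ty} {h x : Tm} : HasType D Δ h τ → HasType D Δ x (.list τ) →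
      IsSucc D Δ (.list τ) x (.cons h x)

variable {I : Ind} {x y : Tm}

theorem HasType.base : HasType D Δ I.base I.ty := by
  cases I <;> constructor

theorem IsSucc.typed (h : IsSucc D Δ I x y) : HasType D Δ x I.ty ∧ HasType D Δ y I.ty := by
  cases h with
  | succ hx => exact ⟨hx, .succ hx⟩
  | cons hh hx => exact ⟨hx, .cons hh hx⟩

theorem IsSucc.subst (hD : D.Stable) (h : IsSucc D Δ I x y) {Δ' : Ctx} {r : ℕ → Tm}
    (hr : Typed D Δ Δ' r) : IsSucc D Δ' I (x.subst r) (y.subst r) := by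
  cases h with
  | succ hx => exact .succ (hx.subst hD hr)
  | cons hh hx => exact .cons (hh.subst hD hr) (hx.subst hD hr)

theorem Ind.base_subst (I : Ind) (s : ℕ → Tm) : I.base.subst s = I.base := by
  cases I <;> rfl

theorem Ind.base_isConstr (I : Ind) : I.base.IsConstr := by
  cases I <;> constructor

theorem IsSucc.isConstr (h : IsSucc D Δ I x y) : y.IsConstr := by
  cases h <;> constructor

/-- Unifies the two induction rules: `IsSucc` hides the head of a list, which is irrelevant to
sizes. Stating both cases at points frees later inductions from weakening. -/
theorem HOL.induction (hD : D.Stable) (hΨ : WfSet D S Γ Ψ) (hφ : WfFm D S (I.ty :: Γ) φ)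
    (h₀ : ∀ Δ Θ s, Env D S Γ Ψ Δ Θ s → HOL D S Δ Θ (φ.subst (I.base ∷ s)))
    (h₁ : ∀ Δ Θ s x y, Env D S Γ Ψ Δ Θ s → IsSucc D Δ I x y → HOL D S Δ Θ (φ.subst (x ∷ s)) →
      HOL D S Δ Θ (φ.subst (y ∷ s))) :
    HOL D S Γ Ψ (.all I.ty φ) := by
  have hbase : HOL D S Γ Ψ (φ.inst₁ 0 I.base) := by
    refine HOL.of_points hΨ fun Δ Θ s E => ?_
    simpa [Fm.inst₁, Ind.base_subst] using h₀ Δ Θ s E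
  cases I with
  | nat =>
    refine .nat ⟨hΨ, .all hφ⟩ hbase ?_
    have hw : WfFm D S (.nat :: Γ) (φ.inst₁ 1 (.var 0)) := by
      simpa [Fm.inst₁] using hφ.subst hD (Typed.wk_one.scons (.var rfl))
    refine HOL.of_points ((hΨ.wk_one hD).insert hw) fun Δ Θ s E => ?_
    obtain ⟨E', h⟩ := E.of_insert
    obtain ⟨u, s, rfl, E', hu⟩ := E'.of_wk
    simpa [Fm.inst₁, Tm.subst] using h₁ Δ Θ s _ _ E' (.succ hu)
      (by simpa [Fm.inst₁, Tm.subst] using h)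
  | list τ =>
    refine .list ⟨hΨ, .all hφ⟩ hbase ?_
    have hw : WfFm D S (.list τ :: τ :: Γ) (φ.inst₁ 2 (.var 0)) := by
      simpa [Fm.inst₁] using hφ.subst hD (Typed.wk_two.scons (.var rfl))
    refine HOL.of_points ((hΨ.wk_two hD).insert hw) fun Δ Θ s E => ?_
    obtain ⟨E', h⟩ := E.of_insert
    rw [wkSet_two] at E'
    obtain ⟨u, s, rfl, E', hu⟩ := E'.of_wk
    obtain ⟨v, s, rfl, E', hv⟩ := E'.of_wk
    simpa [Fm.inst₁, Tm.subst] using h₁ Δ Θ s _ _ E' (.cons hv hu)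
      (by simpa [Fm.inst₁, Tm.subst] using h)

/-- Constructor forms of the data types. -/
inductive Val (D : Guard) (Δ : Ctx) : Ty → Tm → Prop
  | tt : Val D Δ .bool .tt
  | ff : Val D Δ .bool .ff
  | zero : Val D Δ .nat .zero
  | succ {x : Tm} : HasType D Δ x .nat → Val D Δ .nat (.succ x)
  | nil {τ : Ty} : Val D Δ (.list τ) .nil
  | cons {τ : Ty} {h x : Tm} : HasType D Δ h τ → HasType D Δ x (.list τ) →
      Val D Δ (.list τ) (.cons h x)

/-- The types over which case distinctions are possible. -/
inductive Ty.IsData : Ty → Prop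
  | bool : IsData .bool
  | ind (I : Ind) : IsData I.ty

theorem Val.ind (h : Val D Δ I.ty t) : t = I.base ∨ ∃ x, IsSucc D Δ I x t := by
  cases I with
  | nat =>
    cases h with
    | zero => exact .inl rfl
    | succ h => exact .inr ⟨_, .succ h⟩
  | list τ =>
    cases h with
    | nil => exact .inl rfl
    | cons h h' => exact .inr ⟨_, .cons h h'⟩

theorem Val.of_base : Val D Δ I.ty I.base := by
  cases I <;> constructor

theorem IsSucc.val (h : IsSucc D Δ I x y) : Val D Δ I.ty y := by
  cases h <;> constructor <;> assumption

theorem Val.subst (hD : D.Stable) (h : Val D Δ τ c) {Δ' : Ctx} {r : ℕ → Tm}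
    (hr : Typed D Δ Δ' r) : Val D Δ' τ (c.subst r) := by
  cases h <;> constructor <;> (apply HasType.subst hD <;> assumption)

/-- Case analysis on the value of a term. -/
theorem HOL.cases_val (hD : D.Stable) (hτ : τ.IsData) (hΨ : WfSet D S Γ Ψ) (hχ : WfFm D S Γ χ)
    (ht : HasType D Γ t τ)
    (h : ∀ Δ Θ s c, Env D S Γ Ψ Δ Θ s → Val D Δ τ c → HOL D S Δ Θ (Fm.eq τ (t.subst s) c) →
      HOL D S Δ Θ (χ.subst s)) : HOL D S Γ Ψ χ := by
  -- Induction needs a variable, so `t` is generalized: t = y ⇒ χ is proved for all y, then y is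
  -- taken to be `t` and the equation is reflexivity.
  let φ : Fm S.Pred := .imp (Fm.eq τ (t.wk 1) (.var 0)) (χ.wk 1)
  have hφ : WfFm D S (τ :: Γ) φ :=
    .imp (WfFm.eq_iff.2 ⟨ht.subst hD Typed.wk_one, .var rfl⟩) (hχ.subst hD Typed.wk_one)
  have key : ∀ Δ Θ s c, Env D S Γ Ψ Δ Θ s → Val D Δ τ c → HasType D Δ c τ →
      HOL D S Δ Θ (φ.subst (c ∷ s)) := by
    intro Δ Θ s c E hv hc
    refine HOL.intro_imp E.wf ?_ (hφ.subst hD (E.ty.scons hc) |> WfFm.imp_iff.1 |>.2) ?_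
    · exact (hφ.subst hD (E.ty.scons hc) |> WfFm.imp_iff.1 |>.1)
    · intro Δ' Θ' r F he
      have := h Δ' Θ' (cmp s r) (c.subst r) (E.comp hD F) (hv.subst hD F.ty)
      simp [Fm.wk, Tm.wk, Tm.subst] at this he ⊢
      exact this he
  have hall : HOL D S Γ Ψ (.all τ φ) := by
    cases hτ with
    | bool =>
      refine .bool ⟨hΨ, .all hφ⟩ ?_ ?_ <;> refine HOL.of_points hΨ fun Δ Θ s E => ?_
      · simpa [Fm.inst₁, Tm.subst] using key Δ Θ s _ E .tt .tt
      · simpa [Fm.inst₁, Tm.subst] using key Δ Θ s _ E .ff .ff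
    | ind I =>
      -- Only the outermost constructor matters, so the induction degenerates to a case distinction.
      refine HOL.induction hD hΨ hφ (fun Δ Θ s E => key Δ Θ s _ E .of_base .base) ?_
      intro Δ Θ s x y E hxy _
      exact key Δ Θ s _ E hxy.val hxy.typed.2
  have := HOL.elim_imp (HOL.elim_all hD (e := Tm.var) (by simpa using hall) ht)
  simp [Fm.wk, Tm.wk, Tm.subst] at this
  exact this (HOL.refl hΨ ht)

theorem HOL.cases_val₂ (hD : D.Stable) (hτ : τ.IsData) (hσ : σ.IsData) (hΨ : WfSet D S Γ Ψ)
    (hχ : WfFm D S Γ χ) (ht : HasType D Γ t τ) (hu : HasType D Γ u σ)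
    (h : ∀ Δ Θ s c d, Env D S Γ Ψ Δ Θ s → Val D Δ τ c → Val D Δ σ d →
      HOL D S Δ Θ (Fm.eq τ (t.subst s) c) → HOL D S Δ Θ (Fm.eq σ (u.subst s) d) →
      HOL D S Δ Θ (χ.subst s)) : HOL D S Γ Ψ χ := by
  refine HOL.cases_val hD hτ hΨ hχ ht fun Δ Θ s c E hc h₁ => ?_
  refine HOL.cases_val hD hσ E.wf (hχ.subst hD E.ty) (hu.subst hD E.ty) fun Δ' Θ' r d F hd h₂ => ?_
  have h₁ := h₁.at hD F
  simp at h₁ h₂ ⊢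
  exact h Δ' Θ' (cmp s r) _ d (E.comp hD F) (hc.subst hD F.ty) hd h₁ h₂

end

/-! ### Unfolding of recursive definitions -/

section

variable {Γ Δ : Ctx} {Ψ Θ : Set (Fm S.Pred)} {φ ψ χ : Fm S.Pred} {s : ℕ → Tm} {τ σ : Ty}
  {I I₁ I₂ : Ind} {a b c x y t e a' b' : Tm}

theorem Typed.nil : Typed D [] Δ s := by simp [Typed]

theorem Tm.subst_letrec (e : Tm) (s : ℕ → Tm) :
    (Tm.letrec e).subst s = .letrec (e.subst (up (up s))) := rfl

/-- A recursive function applied to any argument is equal to its unfolding. -/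
theorem HOL.letrec_unfold (hD : D.Stable) (hΨ : WfSet D S Γ Ψ)
    (he : HasType D (I.ty :: .arr I.ty σ :: Γ) e σ) (hL : HasType D Γ (.letrec e) (.arr I.ty σ))
    (hx : HasType D Γ x I.ty) :
    HOL D S Γ Ψ (Fm.eq σ (.app (.letrec e) x) (e.subst (x ∷ .letrec e ∷ Tm.var))) := by
  have hs := Typed.var.scons hL
  -- Reduction unfolds a recursive function only on a constructor form, so `x` is first replaced by
  -- its value `c`.
  refine HOL.cases_val hD (.ind I) hΨ (WfFm.eq_iff.2 ⟨.app hL hx, he.subst hD (hs.scons hx)⟩) hx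
    fun Δ Θ s c E hc h => ?_
  have hc' := h.eq_types.2
  have hL' := hL.subst hD E.ty
  have hs' := E.ty.scons hL'
  have hconstr : c.IsConstr := by
    obtain rfl | ⟨x, hx⟩ := hc.ind
    · exact I.base_isConstr
    · exact hx.isConstr
  -- The unfolding equation, a μ-step for `c`, is transported back along c = x.
  have key := HOL.rw_head hD (φ := Fm.eq σ (.app (.var 1) (.var 0)) e)
    (WfFm.eq_iff.2 ⟨.app (.var rfl) (.var rfl), he⟩) hs' (HOL.symm hD h)
  have := key (HOL.of_conv E.wf (.app hL' hc') (he.subst hD (hs'.scons hc')) (.rel _ _ (by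
    have := Step.mu (e.subst (up (up s))) c hconstr
    simpa [Tm.subst, sb_nil_zero, Tm.subst_letrec] using this)))
  simpa [Tm.subst] using this

/-! ### Comparison of sizes -/

theorem HOL.le_congr (hD : D.Stable) (h₁ : HOL D S Δ Θ (Fm.eq I.ty a a'))
    (h₂ : HOL D S Δ Θ (Fm.eq I.ty b b')) (h : HOL D S Δ Θ (Fm.le I a b)) :
    HOL D S Δ Θ (Fm.le I a' b') := by
  have := HOL.rw₂ hD (φ := Fm.le I (.var 1) (.var 0)) (Γ := []) (s := Tm.var)
    (WfFm.le_iff.2 ⟨.var rfl, .var rfl⟩) .nil (HOL.symm hD h₁) (HOL.symm hD h₂)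
  simpa [Tm.subst] using this (by simpa [Tm.subst] using h)

theorem HOL.lt_congr (hD : D.Stable) (h₁ : HOL D S Δ Θ (Fm.eq I.ty a a'))
    (h₂ : HOL D S Δ Θ (Fm.eq I.ty b b')) (h : HOL D S Δ Θ (Fm.lt I a b)) :
    HOL D S Δ Θ (Fm.lt I a' b') := by
  have := HOL.rw₂ hD (φ := Fm.lt I (.var 1) (.var 0)) (Γ := []) (s := Tm.var)
    (WfFm.lt_iff.2 ⟨.var rfl, .var rfl⟩) .nil (HOL.symm hD h₁) (HOL.symm hD h₂)
  simpa [Tm.subst] using this (by simpa [Tm.subst] using h)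

theorem HOL.not_lt_base (hΘ : WfSet D S Δ Θ) (ha : HasType D Δ a I.ty) :
    HOL D S Δ Θ (Fm.neg (Fm.lt I a I.base)) := by
  have hw : WfHOL D S Δ Θ (Fm.neg (Fm.lt I a I.base)) :=
    ⟨hΘ, WfFm.neg_iff.2 (WfFm.lt_iff.2 ⟨ha, .base⟩)⟩
  cases I with
  | nat => exact .ltZero hw
  | list τ => exact .ltNil hw

theorem HOL.base_le (hΘ : WfSet D S Δ Θ) (ha : HasType D Δ a I.ty) :
    HOL D S Δ Θ (Fm.le I I.base a) := by
  have hw : WfHOL D S Δ Θ (Fm.le I I.base a) := ⟨hΘ, WfFm.le_iff.2 ⟨.base, ha⟩⟩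
  cases I with
  | nat => exact .zeroLe hw
  | list τ => exact .nilLe hw

theorem HOL.lt_succ (hΘ : WfSet D S Δ Θ) (ha : HasType D Δ a I.ty) (h : IsSucc D Δ I x y) :
    HOL D S Δ Θ (Fm.iff (Fm.lt I a y) (Fm.le I a x)) := by
  have hw : WfHOL D S Δ Θ (Fm.iff (Fm.lt I a y) (Fm.le I a x)) :=
    ⟨hΘ, WfFm.iff_iff.2 ⟨WfFm.lt_iff.2 ⟨ha, h.typed.2⟩, WfFm.le_iff.2 ⟨ha, h.typed.1⟩⟩⟩
  cases h with
  | succ => exact .ltSucc hw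
  | cons => exact .ltCons hw

theorem HOL.succ_le (hΘ : WfSet D S Δ Θ) (ha : HasType D Δ a I.ty) (h : IsSucc D Δ I x y) :
    HOL D S Δ Θ (Fm.iff (Fm.le I y a) (Fm.lt I x a)) := by
  have hw : WfHOL D S Δ Θ (Fm.iff (Fm.le I y a) (Fm.lt I x a)) :=
    ⟨hΘ, WfFm.iff_iff.2 ⟨WfFm.le_iff.2 ⟨h.typed.2, ha⟩, WfFm.lt_iff.2 ⟨h.typed.1, ha⟩⟩⟩
  cases h with
  | succ => exact .succLe hw
  | cons => exact .consLe hw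

/-- Both sides are equivalent to |x| < |y'|, by the clauses for a successor on the left of ≤ and on
the right of <. -/
theorem HOL.succ_le_succ (hΘ : WfSet D S Δ Θ) {x' y' : Tm} (h : IsSucc D Δ I x y)
    (h' : IsSucc D Δ I x' y') : HOL D S Δ Θ (Fm.le I y y') ↔ HOL D S Δ Θ (Fm.le I x x') :=
  have h₁ := HOL.succ_le hΘ h'.typed.2 h
  have h₂ := HOL.lt_succ hΘ h.typed.1 h'
  ⟨fun h => HOL.mp h₂ (HOL.mp h₁ h), fun h => HOL.mpr h₁ (HOL.mpr h₂ h)⟩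

theorem HOL.le_types (h : HOL D S Δ Θ (Fm.le I a b)) : HasType D Δ a I.ty ∧ HasType D Δ b I.ty :=
  WfFm.le_iff.1 h.wf.2

theorem HOL.lt_types (h : HOL D S Δ Θ (Fm.lt I a b)) : HasType D Δ a I.ty ∧ HasType D Δ b I.ty :=
  WfFm.lt_iff.1 h.wf.2

/-- The hypothesis amounts to `x` being strictly smaller than the base constructor. -/
theorem HOL.le_base_absurd (h : IsSucc D Δ I x y) (h' : HOL D S Δ Θ (Fm.le I y I.base))
    (hχ : WfFm D S Δ χ) : HOL D S Δ Θ χ :=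
  HOL.absurd (HOL.not_lt_base h'.wf.1 h.typed.1) (HOL.mp (HOL.succ_le h'.wf.1 .base h) h') hχ

theorem HOL.le_refl (hD : D.Stable) (hΘ : WfSet D S Δ Θ) (ha : HasType D Δ a I.ty) :
    HOL D S Δ Θ (Fm.le I a a) := by
  have := HOL.induction hD hΘ (φ := Fm.le I (.var 0) (.var 0)) (I := I)
    (WfFm.le_iff.2 ⟨.var rfl, .var rfl⟩)
    (fun Δ Θ s E => by simpa [Tm.subst] using HOL.base_le E.wf .base)
    (fun Δ Θ s x y E h ih => by
      simp [Tm.subst] at ih ⊢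
      exact (HOL.succ_le_succ E.wf h h).2 ih)
  have := HOL.elim_all hD (e := Tm.var) (by simpa using this) ha
  simpa [Tm.subst] using this

/-- Structural induction on the upper bound `c`, with the other two terms universally quantified.
Case analysis on these allows one constructor to be removed from all three terms at once. -/
theorem HOL.le_trans (hD : D.Stable) (h : HOL D S Γ Ψ (Fm.le I a b))
    (h' : HOL D S Γ Ψ (Fm.le I b c)) : HOL D S Γ Ψ (Fm.le I a c) := by
  have hΨ := h.wf.1
  have hw : WfFm D S (I.ty :: Γ) (.all I.ty (.all I.ty (.imp (.and (Fm.le I (.var 1) (.var 0))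
      (Fm.le I (.var 0) (.var 2))) (Fm.le I (.var 1) (.var 2))))) := by
    simp only [WfFm.all_iff, WfFm.imp_iff, WfFm.and_iff, WfFm.le_iff]
    exact ⟨⟨⟨.var rfl, .var rfl⟩, .var rfl, .var rfl⟩, .var rfl, .var rfl⟩
  have := HOL.induction hD hΨ hw ?_ ?_
  · have := HOL.elim_imp (HOL.elim_all hD (HOL.elim_all hD (HOL.elim_all hD (e := Tm.var)
      (by simpa using this) h'.le_types.2) h.le_types.1) h.le_types.2)
    simp [Tm.subst, Fm.subst] at this
    exact this (HOL.intro_and h h')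
  -- At the base constructor, `b` must have the base value too, and then the first comparison is the
  -- claim.
  · intro Δ Θ s E
    refine HOL.intro_all_all_imp hD E.wf (hw.subst hD (E.ty.scons .base) :) ?_
    intro Δ Θ s' a b F ha hb h
    simp [Tm.subst, Fm.subst, up_eq, Ind.base_subst] at h ⊢
    have hl := h.left
    have hr := h.right
    refine HOL.cases_val hD (.ind I) F.wf (WfFm.le_iff.2 ⟨ha, .base⟩) hb fun Δ Θ r v G hv hbv => ?_
    have hl := hl.at hD G
    have hr := hr.at hD G
    simp [Ind.base_subst] at hl hr ⊢
    obtain rfl | ⟨x, hx⟩ := hv.ind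
    · exact HOL.le_congr hD (HOL.refl G.wf (ha.subst hD G.ty)) hbv hl
    · exact HOL.le_base_absurd hx (HOL.le_congr hD hbv (HOL.refl G.wf .base) hr)
        (WfFm.le_iff.2 ⟨ha.subst hD G.ty, .base⟩)
  · intro Δ Θ s x y E hxy ih
    refine HOL.intro_all_all_imp hD E.wf (hw.subst hD (E.ty.scons hxy.typed.2) :) ?_
    intro Δ Θ s' a b F ha hb h
    have ih := ih.at hD F
    have hxy := hxy.subst hD F.ty
    simp [Tm.subst, Fm.subst, up_eq] at h ⊢
    have hl := h.left
    have hr := h.right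
    refine HOL.cases_val₂ hD (.ind I) (.ind I) F.wf (WfFm.le_iff.2 ⟨ha, hxy.typed.2⟩) ha hb
      fun Δ Θ r v w G hv hw hav hbw => ?_
    have hl := hl.at hD G
    have hr := hr.at hD G
    have ih := ih.at hD G
    have hxy := hxy.subst hD G.ty
    simp at hl hr hxy ih ⊢
    have hy := hxy.typed.2
    have hl := HOL.le_congr hD hav hbw hl
    have hr := HOL.le_congr hD hbw (HOL.refl G.wf hy) hr
    refine HOL.le_congr hD (HOL.symm hD hav) (HOL.refl G.wf hy) ?_
    -- A base value on the left is below everything; a base value in the middle then contradicts the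
    -- first comparison. In the remaining case the induction hypothesis applies to the three
    -- predecessors.
    obtain rfl | ⟨v', hv'⟩ := hv.ind
    · exact HOL.base_le G.wf hy
    · obtain rfl | ⟨w', hw'⟩ := hw.ind
      · exact HOL.le_base_absurd hv' hl (WfFm.le_iff.2 ⟨hv'.typed.2, hy⟩)
      · rw [HOL.succ_le_succ G.wf hv' hw'] at hl
        rw [HOL.succ_le_succ G.wf hw' hxy] at hr
        rw [HOL.succ_le_succ G.wf hv' hxy]
        have := HOL.elim_imp (HOL.elim_all hD (HOL.elim_all hD ih hv'.typed.1) hw'.typed.1)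
        simp [Tm.subst, Fm.subst] at this
        exact this (HOL.intro_and hl hr)

/-- When `b` and `c` are successors of v' and w', the hypotheses become |a| ≤ |v'| ≤ |w'|, and |a| ≤
|w'| is the claim. A base value for either contradicts a hypothesis. -/
theorem HOL.lt_of_lt_of_le (hD : D.Stable) (h : HOL D S Γ Ψ (Fm.lt I a b))
    (h' : HOL D S Γ Ψ (Fm.le I b c)) : HOL D S Γ Ψ (Fm.lt I a c) := by
  have hΨ := h.wf.1
  obtain ⟨hb, hc⟩ := h'.le_types
  have ha := h.lt_types.1
  refine HOL.cases_val₂ hD (.ind I) (.ind I) hΨ (WfFm.lt_iff.2 ⟨ha, hc⟩) hb hc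
    fun Δ Θ r v w G hv hw hbv hcw => ?_
  have ha := ha.subst hD G.ty
  have h := h.at hD G
  have h' := h'.at hD G
  simp at h h' ⊢
  have h := HOL.lt_congr hD (HOL.refl G.wf ha) hbv h
  have h' := HOL.le_congr hD hbv hcw h'
  refine HOL.lt_congr hD (HOL.refl G.wf ha) (HOL.symm hD hcw) ?_
  have hlt : WfFm D S Δ (Fm.lt I (a.subst r) w) := WfFm.lt_iff.2 ⟨ha, hcw.eq_types.2⟩
  obtain rfl | ⟨v', hv'⟩ := hv.ind
  · exact HOL.absurd (HOL.not_lt_base G.wf ha) h hlt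
  · obtain rfl | ⟨w', hw'⟩ := hw.ind
    · exact HOL.le_base_absurd hv' h' hlt
    · rw [HOL.succ_le_succ G.wf hv' hw'] at h'
      exact HOL.mpr (HOL.lt_succ G.wf ha hw')
        (HOL.le_trans hD (HOL.mp (HOL.lt_succ G.wf ha hv') h) h')

/-! ### Induction on sizes -/

/-- `∀ m. |m| < |x| ⇒ χ[m/x]` over `Γ, x`. -/
def smaller (I : Ind) (χ : Fm S.Pred) : Fm S.Pred :=
  .all I.ty (.imp (Fm.lt I (.var 0) (.var 1)) (χ.subst (sb [.var 0] 2)))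

/-- `∀ m₁ m₂. (|m₁|, |m₂|) < (|x₁|, |x₂|) ⇒ χ[m₁/x₁][m₂/x₂]` over `Γ, x₁, x₂`. -/
def smaller₂ (I₁ I₂ : Ind) (χ : Fm S.Pred) : Fm S.Pred :=
  .all I₁.ty (.all I₂.ty (.imp (Fm.lt₂ I₁ I₂ (.var 1) (.var 0) (.var 3) (.var 2))
    (χ.subst (sb [.var 0, .var 1] 4))))

theorem WfFm.smaller (hD : D.Stable) (hχ : WfFm D S (I.ty :: Γ) χ) :
    WfFm D S (I.ty :: Γ) (smaller I χ) :=
  .all (.imp (WfFm.lt_iff.2 ⟨.var rfl, .var rfl⟩) (hχ.subst hD (by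
    simpa using Typed.wk_two.scons (.var rfl))))

theorem WfFm.smaller₂ (hD : D.Stable) (hχ : WfFm D S (I₂.ty :: I₁.ty :: Γ) χ) :
    WfFm D S (I₂.ty :: I₁.ty :: Γ) (smaller₂ I₁ I₂ χ) := by
  refine .all (.all (.imp ?_ (hχ.subst hD ?_)))
  · simp only [Fm.lt₂, WfFm.and_iff, WfFm.or_iff, WfFm.le_iff, WfFm.lt_iff]
    exact ⟨⟨⟨.var rfl, .var rfl⟩, .var rfl, .var rfl⟩, ⟨.var rfl, .var rfl⟩, .var rfl, .var rfl⟩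
  · simpa using ((Typed.wk [_, _, _, _]).scons (.var rfl)).scons (.var rfl)

/-- Course-of-values induction. -/
theorem HOL.strong_induction (hD : D.Stable) (hΨ : WfSet D S Γ Ψ) (hχ : WfFm D S (I.ty :: Γ) χ)
    (h : ∀ Δ Θ s x, Env D S Γ Ψ Δ Θ s → HasType D Δ x I.ty →
      HOL D S Δ Θ ((smaller I χ).subst (x ∷ s)) → HOL D S Δ Θ (χ.subst (x ∷ s)))
    (E : Env D S Γ Ψ Δ Θ s) (hx : HasType D Δ x I.ty) : HOL D S Δ Θ (χ.subst (x ∷ s)) := by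
  -- The structural induction is on the bound: the motive at x is `χ` for every m with |m| ≤ |x|.
  have hw : WfFm D S (I.ty :: Γ) (.all I.ty (.imp (Fm.le I (.var 0) (.var 1))
      (χ.subst (sb [.var 0] 2)))) :=
    .all (.imp (WfFm.le_iff.2 ⟨.var rfl, .var rfl⟩) (hχ.subst hD (by
      simpa using Typed.wk_two.scons (.var rfl))))
  -- Shared by both cases: anything smaller than `m` is smaller than the bound `y`, so `χ` below `y`
  -- gives `χ` at `m`.
  have step : ∀ Δ Θ s m y, Env D S Γ Ψ Δ Θ s → HasType D Δ m I.ty → HOL D S Δ Θ (Fm.le I m y) →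
      (∀ Δ' Θ' r k, Env D S Δ Θ Δ' Θ' r → HasType D Δ' k I.ty →
        HOL D S Δ' Θ' (Fm.lt I k (y.subst r)) → HOL D S Δ' Θ' (χ.subst (k ∷ cmp s r))) →
      HOL D S Δ Θ (χ.subst (m ∷ s)) := by
    intro Δ Θ s m y E hm hmy hlt
    refine h Δ Θ s m E hm ?_
    refine HOL.intro_all_imp hD E.wf ((WfFm.smaller hD hχ).subst hD (E.ty.scons hm) :) ?_
    intro Δ' Θ' r k F hk hkm
    have hmy := hmy.at hD F
    simp [Tm.subst, up_eq] at hkm hmy ⊢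
    exact hlt Δ' Θ' r k F hk (HOL.lt_of_lt_of_le hD hkm hmy)
  have := HOL.induction hD hΨ hw ?_ ?_
  · have := HOL.elim_imp (HOL.elim_all hD (HOL.elim_all hD (this.at hD E) hx) hx)
    simp [Tm.subst] at this
    exact this (HOL.le_refl hD E.wf hx)
  · intro Δ Θ s E
    refine HOL.intro_all_imp hD E.wf (hw.subst hD (E.ty.scons .base) :) ?_
    intro Δ' Θ' r m F hm hle
    simp [Tm.subst, up_eq, Ind.base_subst] at hle ⊢
    -- Nothing is smaller than the base constructor.
    refine step _ _ _ m _ (E.comp hD F) hm hle fun Δ Θ q k G hk hlt => ?_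
    rw [Ind.base_subst] at hlt
    exact HOL.absurd (HOL.not_lt_base G.wf hk) hlt
      (hχ.subst hD (((E.comp hD F).comp hD G).ty.scons hk))
  · intro Δ Θ s x y E hxy ih
    refine HOL.intro_all_imp hD E.wf (hw.subst hD (E.ty.scons hxy.typed.2) :) ?_
    intro Δ' Θ' r m F hm hle
    have ih := ih.at hD F
    have hxy := hxy.subst hD F.ty
    simp [Tm.subst, up_eq] at hle ⊢
    -- Being smaller than a successor is being at most as large as the predecessor, where the
    -- induction hypothesis applies.
    refine step _ _ _ m _ (E.comp hD F) hm hle fun Δ Θ q k G hk hlt => ?_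
    have ih := ih.at hD G
    have hkx := HOL.mp (HOL.lt_succ G.wf hk (hxy.subst hD G.ty)) hlt
    simp at hkx ih ⊢
    have := HOL.elim_imp (HOL.elim_all hD ih hk)
    simp [Tm.subst] at this
    exact this hkx

/-- `∀ m₁ m₂. |m₁| ≤ |x₁| ⇒ |m₂| ≤ |x₂| ⇒ χ[m₁/x₁][m₂/x₂]` over `Γ, x₁, x₂`. -/
def upto₂ (I₁ I₂ : Ind) (χ : Fm S.Pred) : Fm S.Pred :=
  .all I₁.ty (.all I₂.ty (.imp (.and (Fm.le I₁ (.var 1) (.var 3)) (Fm.le I₂ (.var 0) (.var 2)))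
    (χ.subst (sb [.var 0, .var 1] 4))))

theorem WfFm.upto₂ (hD : D.Stable) (hχ : WfFm D S (I₂.ty :: I₁.ty :: Γ) χ) :
    WfFm D S (I₂.ty :: I₁.ty :: Γ) (upto₂ I₁ I₂ χ) := by
  refine .all (.all (.imp ?_ (hχ.subst hD ?_)))
  · simp only [WfFm.and_iff, WfFm.le_iff]
    exact ⟨⟨.var rfl, .var rfl⟩, .var rfl, .var rfl⟩
  · simpa using ((Typed.wk [_, _, _, _]).scons (.var rfl)).scons (.var rfl)

theorem HOL.elim_upto₂ (hD : D.Stable) {m₁ m₂ x₁ x₂ : Tm}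
    (h : HOL D S Δ Θ ((upto₂ I₁ I₂ χ).subst (x₂ ∷ x₁ ∷ s)))
    (h₁ : HOL D S Δ Θ (Fm.le I₁ m₁ x₁)) (h₂ : HOL D S Δ Θ (Fm.le I₂ m₂ x₂)) :
    HOL D S Δ Θ (χ.subst (m₂ ∷ m₁ ∷ s)) := by
  have := HOL.elim_imp (HOL.elim_all hD (HOL.elim_all hD h h₁.le_types.1) h₂.le_types.1)
  simp [Tm.subst, Fm.subst] at this
  exact this (HOL.intro_and h₁ h₂)

/-- Simultaneous induction on the sizes of two arguments. -/
theorem HOL.strong_induction₂ (hD : D.Stable) (hΨ : WfSet D S Γ Ψ)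
    (hχ : WfFm D S (I₂.ty :: I₁.ty :: Γ) χ)
    (h : ∀ Δ Θ s x₁ x₂, Env D S Γ Ψ Δ Θ s → HasType D Δ x₁ I₁.ty → HasType D Δ x₂ I₂.ty →
      HOL D S Δ Θ ((smaller₂ I₁ I₂ χ).subst (x₂ ∷ x₁ ∷ s)) → HOL D S Δ Θ (χ.subst (x₂ ∷ x₁ ∷ s)))
    (E : Env D S Γ Ψ Δ Θ s) {x₁ x₂ : Tm} (hx₁ : HasType D Δ x₁ I₁.ty)
    (hx₂ : HasType D Δ x₂ I₂.ty) : HOL D S Δ Θ (χ.subst (x₂ ∷ x₁ ∷ s)) := by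
  have hw := WfFm.upto₂ hD hχ
  -- A smaller pair drops in the first component, with no bound needed on the second, or in the
  -- second with the first still bounded. The outer and inner inductions supply these two cases
  -- respectively.
  have step : ∀ Δ Θ s y₁ y₂, Env D S Γ Ψ Δ Θ s → HasType D Δ y₁ I₁.ty → HasType D Δ y₂ I₂.ty →
      (∀ Δ' Θ' r k₁ k₂, Env D S Δ Θ Δ' Θ' r → HasType D Δ' k₂ I₂.ty →
        HOL D S Δ' Θ' (Fm.lt I₁ k₁ (y₁.subst r)) →
        HOL D S Δ' Θ' (χ.subst (k₂ ∷ k₁ ∷ cmp s r))) →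
      (∀ Δ' Θ' r k₁ k₂, Env D S Δ Θ Δ' Θ' r → HOL D S Δ' Θ' (Fm.le I₁ k₁ (y₁.subst r)) →
        HOL D S Δ' Θ' (Fm.lt I₂ k₂ (y₂.subst r)) →
        HOL D S Δ' Θ' (χ.subst (k₂ ∷ k₁ ∷ cmp s r))) →
      HOL D S Δ Θ ((upto₂ I₁ I₂ χ).subst (y₂ ∷ y₁ ∷ s)) := by
    intro Δ Θ s y₁ y₂ E hy₁ hy₂ hlt₁ hlt₂
    refine HOL.intro_all_all_imp hD E.wf (hw.subst hD ((E.ty.scons hy₁).scons hy₂) :) ?_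
    intro Δ Θ r m₁ m₂ F hm₁ hm₂ hle
    simp [Tm.subst, Fm.subst, up_eq] at hle ⊢
    have E' := E.comp hD F
    refine h _ _ _ _ _ E' hm₁ hm₂ ?_
    refine HOL.intro_all_all_imp hD F.wf
      ((WfFm.smaller₂ hD hχ).subst hD ((E'.ty.scons hm₁).scons hm₂) :) ?_
    intro Δ Θ q k₁ k₂ G hk₁ hk₂ hlt
    have hle := hle.at hD G
    simp [Tm.subst, Fm.subst, up_eq] at hle hlt ⊢
    -- The disjunction in the order on pairs tells which component drops strictly.
    refine HOL.elim_or hlt.right (hχ.subst hD (((E.comp hD (F.comp hD G)).ty.scons hk₁).scons hk₂)) ?_ ?_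
    · intro Δ Θ p H h₁
      have hle := hle.at hD H
      simp [Fm.subst] at h₁ hle ⊢
      have := hlt₁ Δ Θ (cmp r (cmp q p)) (k₁.subst p) (k₂.subst p) (F.comp hD (G.comp hD H))
        (hk₂.subst hD H.ty) (HOL.lt_of_lt_of_le hD h₁ hle.left)
      simpa using this
    · intro Δ Θ p H h₁
      have hle := hle.at hD H
      have hlt := hlt.at hD H
      simp [Fm.subst, Fm.lt₂] at h₁ hle hlt ⊢
      have := hlt₂ Δ Θ (cmp r (cmp q p)) (k₁.subst p) (k₂.subst p) (F.comp hD (G.comp hD H))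
        (HOL.le_trans hD hlt.left.left hle.left) (HOL.lt_of_lt_of_le hD h₁ hle.right)
      simpa using this
  -- Inner induction on the second bound, for a fixed first bound.
  have inner : ∀ Δ Θ s y₁, Env D S Γ Ψ Δ Θ s → HasType D Δ y₁ I₁.ty →
      (∀ Δ' Θ' r k₁ k₂, Env D S Δ Θ Δ' Θ' r → HasType D Δ' k₂ I₂.ty →
        HOL D S Δ' Θ' (Fm.lt I₁ k₁ (y₁.subst r)) →
        HOL D S Δ' Θ' (χ.subst (k₂ ∷ k₁ ∷ cmp s r))) →
      HOL D S Δ Θ ((Fm.all I₂.ty (upto₂ I₁ I₂ χ)).subst (y₁ ∷ s)) := by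
    intro Δ Θ s y₁ E hy₁ hlt₁
    refine HOL.induction hD E.wf (hw.subst hD ((E.ty.scons hy₁).up hD _)) ?_ ?_
    · intro Δ Θ r F
      simp
      refine step _ _ _ _ _ (E.comp hD F) (hy₁.subst hD F.ty) .base ?_ ?_
      · intro Δ Θ q k₁ k₂ G hk₂ hlt
        simpa using hlt₁ Δ Θ (cmp r q) k₁ k₂ (F.comp hD G) hk₂ (by simpa using hlt)
      · intro Δ Θ q k₁ k₂ G hle hlt
        rw [Ind.base_subst] at hlt
        exact HOL.absurd (HOL.not_lt_base G.wf hlt.lt_types.1) hlt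
          (hχ.subst hD ((((E.comp hD F).comp hD G).ty.scons hle.le_types.1).scons
            hlt.lt_types.1))
    · intro Δ Θ r x y F hxy ih
      simp at ih ⊢
      refine step _ _ _ _ _ (E.comp hD F) (hy₁.subst hD F.ty) hxy.typed.2 ?_ ?_
      · intro Δ Θ q k₁ k₂ G hk₂ hlt
        simpa using hlt₁ Δ Θ (cmp r q) k₁ k₂ (F.comp hD G) hk₂ (by simpa using hlt)
      · intro Δ Θ q k₁ k₂ G hle hlt
        have ih := ih.at hD G
        simp at ih hle ⊢
        exact HOL.elim_upto₂ hD ih hle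
          (HOL.mp (HOL.lt_succ G.wf hlt.lt_types.1 (hxy.subst hD G.ty)) hlt)
  -- Outer induction on the first bound. The second bound stays universally quantified in its
  -- motive, so it may grow when the first component drops.
  have := HOL.induction hD hΨ (WfFm.all hw) ?_ ?_
  · have := HOL.elim_all hD (HOL.elim_all hD (this.at hD E) hx₁) hx₂
    exact HOL.elim_upto₂ hD this (HOL.le_refl hD E.wf hx₁) (HOL.le_refl hD E.wf hx₂)
  · intro Δ Θ s E
    refine inner Δ Θ s _ E .base fun Δ Θ r k₁ k₂ F hk₂ hlt => ?_
    rw [Ind.base_subst] at hlt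
    exact HOL.absurd (HOL.not_lt_base F.wf hlt.lt_types.1) hlt
      (hχ.subst hD (((E.comp hD F).ty.scons hlt.lt_types.1).scons hk₂))
  · intro Δ Θ s x y E hxy ih
    refine inner Δ Θ s _ E hxy.typed.2 fun Δ Θ r k₁ k₂ F hk₂ hlt => ?_
    have ih := ih.at hD F
    simp only [Fm.subst_subst, cmp_scons] at ih
    -- The second bound is chosen to be `k₂` itself.
    exact HOL.elim_upto₂ hD (HOL.elim_all hD ih hk₂)
      (HOL.mp (HOL.lt_succ F.wf hlt.lt_types.1 (hxy.subst hD F.ty)) hlt)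
      (HOL.le_refl hD F.wf hk₂)

end

/-! ### Well-formedness, inversion and reduction at a point -/

section

variable {Γ Δ : Ctx} {Ψ Θ : Set (Fm S.Pred)} {φ φ' ψ χ : Fm S.Pred} {s : ℕ → Tm} {τ σ τ₁ τ₂ : Ty}
  {σ₁ σ₂ : Ty} {I I₁ I₂ : Ind} {a b c x y t e u v t₁ t₂ a₁ a₂ : Tm}

theorem UHOL.wf (h : UHOL D S Γ Ψ t σ φ) : WfUHOL D S Γ Ψ t σ φ := by
  cases h <;> assumption

theorem RHOL.wf (h : RHOL D S Γ Ψ t₁ σ₁ t₂ σ₂ φ) : WfRHOL D S Γ Ψ t₁ σ₁ t₂ σ₂ φ := by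
  cases h <;> assumption

theorem HasType.lam_inv (h : HasType D Γ (.lam τ t) (.arr τ₁ σ)) : HasType D (τ :: Γ) t σ := by
  cases h; assumption

theorem HasType.letrec_inv (h : HasType D Γ (.letrec e) (.arr I.ty σ)) :
    HasType D (I.ty :: .arr I.ty σ :: Γ) e σ := by
  -- The typing derivation brings its own inductive type; the equation of arrow types identifies the
  -- underlying types.
  generalize hT : Ty.arr I.ty σ = T at h
  cases h with
  | letrec h _ =>
    injection hT with h₁ h₂
    rw [h₁, h₂]; exact h

theorem WfFm.inst₁ (hD : D.Stable) (h : WfFm D S (σ :: Γ) φ) (ht : HasType D Γ t σ) :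
    WfFm D S Γ (φ.inst₁ 0 t) :=
  h.subst hD (by simpa [sb_nil_zero] using Typed.var.scons ht)

theorem WfFm.inst₂ (hD : D.Stable) (h : WfFm D S (σ₂ :: σ₁ :: Γ) φ) (h₁ : HasType D Γ t₁ σ₁)
    (h₂ : HasType D Γ t₂ σ₂) : WfFm D S Γ (φ.inst₂ 0 t₁ t₂) :=
  h.subst hD (by simpa [sb_nil_zero] using (Typed.var.scons h₁).scons h₂)

/-! ### Reduction at a point -/

theorem HOL.beta (hD : D.Stable) (ht : HasType D (τ :: Γ) t σ) (E : Env D S Γ Ψ Δ Θ s)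
    (ha : HasType D Δ a τ) :
    HOL D S Δ Θ (Fm.eq σ (.app ((Tm.lam τ t).subst s) a) (t.subst (a ∷ s))) := by
  refine .of_conv E.wf (.app (ht.lam.subst hD E.ty) ha) (ht.subst hD (E.ty.scons ha)) (.rel _ _ ?_)
  have := Step.beta τ (t.subst (up s)) a
  simpa [sb_nil_zero, Tm.subst] using this

theorem HOL.letrec_at (hD : D.Stable) (h : HasType D Γ (.letrec e) (.arr I.ty σ))
    (E : Env D S Γ Ψ Δ Θ s) (hx : HasType D Δ x I.ty) :
    HOL D S Δ Θ (Fm.eq σ (.app ((Tm.letrec e).subst s) x)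
      (e.subst (x ∷ (Tm.letrec e).subst s ∷ s))) := by
  have := HOL.letrec_unfold hD E.wf (h.letrec_inv.subst hD ((E.ty.up hD _).up hD _))
    (h.subst hD E.ty) hx
  simpa [Tm.subst_letrec] using this

/-! ### Functional assertions -/

theorem HOL.elim_funU (hD : D.Stable) (h : HOL D S Δ Θ ((funU τ φ' φ).subst (t ∷ s)))
    (ha : HasType D Δ a τ) (h' : HOL D S Δ Θ (φ'.subst (a ∷ s))) :
    HOL D S Δ Θ (φ.subst (.app t a ∷ a ∷ s)) := by
  have := HOL.elim_imp (HOL.elim_all hD h ha)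
  simp [Tm.subst] at this
  exact this h'

theorem HOL.elim_funLR (hD : D.Stable) (h : HOL D S Δ Θ ((funLR τ₁ τ₂ φ' φ).subst (t₂ ∷ t₁ ∷ s)))
    (ha₁ : HasType D Δ a₁ τ₁) (ha₂ : HasType D Δ a₂ τ₂)
    (h' : HOL D S Δ Θ (φ'.subst (a₂ ∷ a₁ ∷ s))) :
    HOL D S Δ Θ (φ.subst (.app t₂ a₂ ∷ .app t₁ a₁ ∷ a₂ ∷ a₁ ∷ s)) := by
  have := HOL.elim_imp (HOL.elim_all hD (HOL.elim_all hD h ha₁) ha₂)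
  simp [Tm.subst] at this
  exact this h'

theorem HOL.elim_funL (hD : D.Stable) (h : HOL D S Δ Θ ((funL τ₁ φ' φ).subst (t₂ ∷ t₁ ∷ s)))
    (ha : HasType D Δ a τ₁) (h' : HOL D S Δ Θ (φ'.subst (a ∷ s))) :
    HOL D S Δ Θ (φ.subst (t₂ ∷ .app t₁ a ∷ a ∷ s)) := by
  have := HOL.elim_imp (HOL.elim_all hD h ha)
  simp [Tm.subst] at this
  exact this h'

theorem HOL.elim_funR (hD : D.Stable) (h : HOL D S Δ Θ ((funR τ₂ φ' φ).subst (t₂ ∷ t₁ ∷ s)))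
    (ha : HasType D Δ a τ₂) (h' : HOL D S Δ Θ (φ'.subst (a ∷ s))) :
    HOL D S Δ Θ (φ.subst (.app t₂ a ∷ t₁ ∷ a ∷ s)) := by
  have := HOL.elim_imp (HOL.elim_all hD h ha)
  simp [Tm.subst] at this
  exact this h'

/-- The form in which abstraction and recursion are verified: the term is applied to an arbitrary
argument at an arbitrary point. The relational variants below serve the same purpose. -/
theorem HOL.intro_funU (hD : D.Stable) (hw : WfUHOL D S Γ Ψ t σ (funU τ φ' φ))
    (h : ∀ Δ Θ s a, Env D S Γ Ψ Δ Θ s → HasType D Δ a τ → HOL D S Δ Θ (φ'.subst (a ∷ s)) →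
      HOL D S Δ Θ (φ.subst (.app (t.subst s) a ∷ a ∷ s))) :
    HOL D S Γ Ψ ((funU τ φ' φ).inst₁ 0 t) := by
  refine HOL.intro_all_imp hD hw.1 (hw.2.2.inst₁ hD hw.2.1 :) fun Δ Θ s a E ha h' => ?_
  simp [Tm.subst, up_eq] at h' ⊢
  exact h Δ Θ s a E ha h'

theorem HOL.intro_funLR (hD : D.Stable) (hw : WfRHOL D S Γ Ψ t₁ σ₁ t₂ σ₂ (funLR τ₁ τ₂ φ' φ))
    (h : ∀ Δ Θ s a₁ a₂, Env D S Γ Ψ Δ Θ s → HasType D Δ a₁ τ₁ → HasType D Δ a₂ τ₂ →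
      HOL D S Δ Θ (φ'.subst (a₂ ∷ a₁ ∷ s)) →
      HOL D S Δ Θ (φ.subst (.app (t₂.subst s) a₂ ∷ .app (t₁.subst s) a₁ ∷ a₂ ∷ a₁ ∷ s))) :
    HOL D S Γ Ψ ((funLR τ₁ τ₂ φ' φ).inst₂ 0 t₁ t₂) := by
  refine HOL.intro_all_all_imp hD hw.1 (hw.2.2.2.inst₂ hD hw.2.1 hw.2.2.1 :)
    fun Δ Θ s a₁ a₂ E h₁ h₂ h' => ?_
  simp [Tm.subst, up_eq] at h' ⊢
  exact h Δ Θ s a₁ a₂ E h₁ h₂ h'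

theorem HOL.intro_funL (hD : D.Stable) (hw : WfRHOL D S Γ Ψ t₁ σ₁ t₂ σ₂ (funL τ₁ φ' φ))
    (h : ∀ Δ Θ s a, Env D S Γ Ψ Δ Θ s → HasType D Δ a τ₁ → HOL D S Δ Θ (φ'.subst (a ∷ s)) →
      HOL D S Δ Θ (φ.subst (t₂.subst s ∷ .app (t₁.subst s) a ∷ a ∷ s))) :
    HOL D S Γ Ψ ((funL τ₁ φ' φ).inst₂ 0 t₁ t₂) := by
  refine HOL.intro_all_imp hD hw.1 (hw.2.2.2.inst₂ hD hw.2.1 hw.2.2.1 :) fun Δ Θ s a E ha h' => ?_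
  simp [Tm.subst, up_eq] at h' ⊢
  exact h Δ Θ s a E ha h'

theorem HOL.intro_funR (hD : D.Stable) (hw : WfRHOL D S Γ Ψ t₁ σ₁ t₂ σ₂ (funR τ₂ φ' φ))
    (h : ∀ Δ Θ s a, Env D S Γ Ψ Δ Θ s → HasType D Δ a τ₂ → HOL D S Δ Θ (φ'.subst (a ∷ s)) →
      HOL D S Δ Θ (φ.subst (.app (t₂.subst s) a ∷ t₁.subst s ∷ a ∷ s))) :
    HOL D S Γ Ψ ((funR τ₂ φ' φ).inst₂ 0 t₁ t₂) := by
  refine HOL.intro_all_imp hD hw.1 (hw.2.2.2.inst₂ hD hw.2.1 hw.2.2.1 :) fun Δ Θ s a E ha h' => ?_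
  simp [Tm.subst, up_eq] at h' ⊢
  exact h Δ Θ s a E ha h'

/-- Functional assertions about a term `t : I → σ`, by induction on the size of the argument. -/
theorem HOL.intro_funU_rec (hD : D.Stable) (hw : WfUHOL D S Γ Ψ t (.arr I.ty σ) (funU I.ty φ' φ))
    (hφ' : WfFm D S (I.ty :: Γ) φ') (hφ : WfFm D S (σ :: I.ty :: Γ) φ)
    (h : ∀ Δ Θ s x, Env D S Γ Ψ Δ Θ s → HasType D Δ x I.ty →
      Env D S (.arr I.ty σ :: I.ty :: Γ)
        (insert (φ'.subst (sb [.var 1] 2))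
          (insert (.all I.ty (.imp (Fm.lt I (.var 0) (.var 2)) (.imp (φ'.subst (sb [.var 0] 3))
              (φ.subst (sb [.app (.var 1) (.var 0), .var 0] 3)))))
            (wkSet 2 Ψ))) Δ Θ (t.subst s ∷ x ∷ s) →
      HOL D S Δ Θ (φ.subst (.app (t.subst s) x ∷ x ∷ s))) :
    HOL D S Γ Ψ ((funU I.ty φ' φ).inst₁ 0 t) := by
  refine HOL.intro_funU hD hw fun Δ Θ s a E ha h' => ?_
  -- The precondition belongs to the motive, as the hypothesis on smaller arguments in the rule is
  -- itself conditional on φ'.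
  have hχ : WfFm D S (I.ty :: Γ) (.imp φ' (φ.subst (.app (t.subst (sb [] 1)) (.var 0) ∷ Tm.var))) :=
    .imp hφ' (hφ.subst hD
      (Typed.var.scons (.app (hw.2.1.subst hD Typed.wk_one) (.var rfl))))
  have := HOL.strong_induction hD hw.1 hχ ?_ E ha
  · have := HOL.elim_imp this h'
    simpa [Tm.subst] using this
  · intro Δ Θ s x E hx hsm
    have hw' := WfFm.imp_iff.1 (hχ.subst hD (E.ty.scons hx))
    refine HOL.intro_imp E.wf hw'.1 hw'.2 fun Δ Θ r F h' => ?_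
    have hsm := hsm.at hD F
    have hx := hx.subst hD F.ty
    have E := E.comp hD F
    have := h Δ Θ (cmp s r) (x.subst r) E hx ?_
    · simpa [Tm.subst] using this
    -- The variable f is interpreted by `t` itself; the course-of-values hypothesis then becomes the
    -- rule's hypothesis about f.
    · refine Env.insert (Env.insert
        (E.wk 2 ((E.ty.scons hx).scons (hw.2.1.subst hD E.ty)) rfl) ?_) ?_
      · simpa [smaller, Fm.subst, Tm.subst, up_eq] using hsm
      · simpa [Tm.subst] using h'

/-- Simultaneous induction on both sizes, with `t₁` and `t₂` as the values of the two function
variables; its order on pairs is that of the two-sided recursion rule. -/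
theorem HOL.intro_funLR_rec (hD : D.Stable)
    (hw : WfRHOL D S Γ Ψ t₁ (.arr I₁.ty σ₁) t₂ (.arr I₂.ty σ₂) (funLR I₁.ty I₂.ty φ' φ))
    (hφ' : WfFm D S (I₂.ty :: I₁.ty :: Γ) φ') (hφ : WfFm D S (σ₂ :: σ₁ :: I₂.ty :: I₁.ty :: Γ) φ)
    (h : ∀ Δ Θ s x₁ x₂, Env D S Γ Ψ Δ Θ s → HasType D Δ x₁ I₁.ty → HasType D Δ x₂ I₂.ty →
      Env D S (.arr I₂.ty σ₂ :: .arr I₁.ty σ₁ :: I₂.ty :: I₁.ty :: Γ)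
        (insert (φ'.subst (sb [.var 2, .var 3] 4))
          (insert (.all I₁.ty (.all I₂.ty
              (.imp (Fm.lt₂ I₁ I₂ (.var 1) (.var 0) (.var 5) (.var 4))
                (.imp (φ'.subst (sb [.var 0, .var 1] 6))
                  (φ.subst (sb [.app (.var 2) (.var 0), .app (.var 3) (.var 1),
                    .var 0, .var 1] 6))))))
            (wkSet 4 Ψ))) Δ Θ (t₂.subst s ∷ t₁.subst s ∷ x₂ ∷ x₁ ∷ s) →
      HOL D S Δ Θ (φ.subst (.app (t₂.subst s) x₂ ∷ .app (t₁.subst s) x₁ ∷ x₂ ∷ x₁ ∷ s))) :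
    HOL D S Γ Ψ ((funLR I₁.ty I₂.ty φ' φ).inst₂ 0 t₁ t₂) := by
  refine HOL.intro_funLR hD hw fun Δ Θ s a₁ a₂ E ha₁ ha₂ h' => ?_
  have hχ : WfFm D S (I₂.ty :: I₁.ty :: Γ) (.imp φ' (φ.subst
      (.app (t₂.subst (sb [] 2)) (.var 0) ∷ .app (t₁.subst (sb [] 2)) (.var 1) ∷ Tm.var))) :=
    .imp hφ' (hφ.subst hD
      ((Typed.var.scons (.app (hw.2.1.subst hD Typed.wk_two) (.var rfl))).scons
        (.app (hw.2.2.1.subst hD Typed.wk_two) (.var rfl))))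
  have := HOL.strong_induction₂ hD hw.1 hχ ?_ E ha₁ ha₂
  · have := HOL.elim_imp this h'
    simpa [Tm.subst] using this
  · intro Δ Θ s x₁ x₂ E hx₁ hx₂ hsm
    have hw' := WfFm.imp_iff.1 (hχ.subst hD ((E.ty.scons hx₁).scons hx₂))
    refine HOL.intro_imp E.wf hw'.1 hw'.2 fun Δ Θ r F h' => ?_
    have hsm := hsm.at hD F
    have hx₁ := hx₁.subst hD F.ty
    have hx₂ := hx₂.subst hD F.ty
    have E := E.comp hD F
    have := h Δ Θ (cmp s r) (x₁.subst r) (x₂.subst r) E hx₁ hx₂ ?_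
    · simpa [Tm.subst] using this
    · refine Env.insert (Env.insert (E.wk 4 ((((E.ty.scons hx₁).scons hx₂).scons
        (hw.2.1.subst hD E.ty)).scons (hw.2.2.1.subst hD E.ty)) rfl) ?_) ?_
      · simpa [smaller₂, Fm.subst, Tm.subst, up_eq] using hsm
      · simpa [Tm.subst] using h'

/-- Only the left argument varies, so one-argument induction suffices and `t₂` is a parameter of the
motive. -/
theorem HOL.intro_funL_rec (hD : D.Stable)
    (hw : WfRHOL D S Γ Ψ t₁ (.arr I₁.ty σ₁) t₂ σ₂ (funL I₁.ty φ' φ))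
    (hφ' : WfFm D S (I₁.ty :: Γ) φ') (hφ : WfFm D S (σ₂ :: σ₁ :: I₁.ty :: Γ) φ)
    (h : ∀ Δ Θ s x, Env D S Γ Ψ Δ Θ s → HasType D Δ x I₁.ty →
      Env D S (.arr I₁.ty σ₁ :: I₁.ty :: Γ)
        (insert (φ'.subst (sb [.var 1] 2))
          (insert (.all I₁.ty (.imp (Fm.lt I₁ (.var 0) (.var 2)) (.imp (φ'.subst (sb [.var 0] 3))
              (φ.subst (sb [t₂.wk 3, .app (.var 1) (.var 0), .var 0] 3)))))
            (wkSet 2 Ψ))) Δ Θ (t₁.subst s ∷ x ∷ s) →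
      HOL D S Δ Θ (φ.subst (t₂.subst s ∷ .app (t₁.subst s) x ∷ x ∷ s))) :
    HOL D S Γ Ψ ((funL I₁.ty φ' φ).inst₂ 0 t₁ t₂) := by
  refine HOL.intro_funL hD hw fun Δ Θ s a E ha h' => ?_
  have hχ : WfFm D S (I₁.ty :: Γ) (.imp φ' (φ.subst
      (t₂.subst (sb [] 1) ∷ .app (t₁.subst (sb [] 1)) (.var 0) ∷ Tm.var))) :=
    .imp hφ' (hφ.subst hD
      ((Typed.var.scons (.app (hw.2.1.subst hD Typed.wk_one) (.var rfl))).scons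
        (hw.2.2.1.subst hD Typed.wk_one)))
  have := HOL.strong_induction hD hw.1 hχ ?_ E ha
  · have := HOL.elim_imp this h'
    simpa [Tm.subst] using this
  · intro Δ Θ s x E hx hsm
    have hw' := WfFm.imp_iff.1 (hχ.subst hD (E.ty.scons hx))
    refine HOL.intro_imp E.wf hw'.1 hw'.2 fun Δ Θ r F h' => ?_
    have hsm := hsm.at hD F
    have hx := hx.subst hD F.ty
    have E := E.comp hD F
    have := h Δ Θ (cmp s r) (x.subst r) E hx ?_
    · simpa [Tm.subst] using this
    · refine Env.insert (Env.insert
        (E.wk 2 ((E.ty.scons hx).scons (hw.2.1.subst hD E.ty)) rfl) ?_) ?_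
      · simpa [smaller, Fm.subst, Tm.subst, Tm.wk, up_eq] using hsm
      · simpa [Tm.subst] using h'

theorem HOL.intro_funR_rec (hD : D.Stable)
    (hw : WfRHOL D S Γ Ψ t₁ σ₁ t₂ (.arr I₂.ty σ₂) (funR I₂.ty φ' φ))
    (hφ' : WfFm D S (I₂.ty :: Γ) φ') (hφ : WfFm D S (σ₂ :: σ₁ :: I₂.ty :: Γ) φ)
    (h : ∀ Δ Θ s x, Env D S Γ Ψ Δ Θ s → HasType D Δ x I₂.ty →
      Env D S (.arr I₂.ty σ₂ :: I₂.ty :: Γ)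
        (insert (φ'.subst (sb [.var 1] 2))
          (insert (.all I₂.ty (.imp (Fm.lt I₂ (.var 0) (.var 2)) (.imp (φ'.subst (sb [.var 0] 3))
              (φ.subst (sb [.app (.var 1) (.var 0), t₁.wk 3, .var 0] 3)))))
            (wkSet 2 Ψ))) Δ Θ (t₂.subst s ∷ x ∷ s) →
      HOL D S Δ Θ (φ.subst (.app (t₂.subst s) x ∷ t₁.subst s ∷ x ∷ s))) :
    HOL D S Γ Ψ ((funR I₂.ty φ' φ).inst₂ 0 t₁ t₂) := by
  refine HOL.intro_funR hD hw fun Δ Θ s a E ha h' => ?_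
  have hχ : WfFm D S (I₂.ty :: Γ) (.imp φ' (φ.subst
      (.app (t₂.subst (sb [] 1)) (.var 0) ∷ t₁.subst (sb [] 1) ∷ Tm.var))) :=
    .imp hφ' (hφ.subst hD
      ((Typed.var.scons (hw.2.1.subst hD Typed.wk_one)).scons
        (.app (hw.2.2.1.subst hD Typed.wk_one) (.var rfl))))
  have := HOL.strong_induction hD hw.1 hχ ?_ E ha
  · have := HOL.elim_imp this h'
    simpa [Tm.subst] using this
  · intro Δ Θ s x E hx hsm
    have hw' := WfFm.imp_iff.1 (hχ.subst hD (E.ty.scons hx))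
    refine HOL.intro_imp E.wf hw'.1 hw'.2 fun Δ Θ r F h' => ?_
    have hsm := hsm.at hD F
    have hx := hx.subst hD F.ty
    have E := E.comp hD F
    have := h Δ Θ (cmp s r) (x.subst r) E hx ?_
    · simpa [Tm.subst] using this
    · refine Env.insert (Env.insert
        (E.wk 2 ((E.ty.scons hx).scons (hw.2.2.1.subst hD E.ty)) rfl) ?_) ?_
      · simpa [smaller, Fm.subst, Tm.subst, Tm.wk, up_eq] using hsm
      · simpa [Tm.subst] using h'

end

/-! ## Soundness of UHOL -/

/-- `φ[t/r]` holds at all points of `Γ | Ψ`. -/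
def USem (D : Guard) (S : Sig) (Γ : Ctx) (Ψ : Set (Fm S.Pred)) (t : Tm) (φ : Fm S.Pred) : Prop :=
  ∀ Δ Θ s, Env D S Γ Ψ Δ Θ s → HOL D S Δ Θ (φ.subst (t.subst s ∷ s))

section

variable {Γ : Ctx} {Ψ : Set (Fm S.Pred)} {φ : Fm S.Pred} {t : Tm} {σ : Ty}

theorem USem.of_hol (hD : D.Stable) (h : HOL D S Γ Ψ (φ.inst₁ 0 t)) : USem D S Γ Ψ t φ :=
  fun Δ Θ s E => by simpa [Fm.inst₁] using h.at hD E

/-- Rule induction: a premise is used at a point extended by the bound variables and the new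
hypotheses, and the resulting assertion is moved back along the equation between the term and its
contractum. -/
theorem UHOL.sound (hD : D.Stable) (h : UHOL D S Γ Ψ t σ φ) : USem D S Γ Ψ t φ := by
  induction h with
  | var _ h | tt _ h | ff _ h | zero _ h | nil _ h => exact .of_hol hD h
  | @abs Γ Ψ t τ σ φ' φ hw h ih =>
    refine .of_hol hD (HOL.intro_funU hD hw fun Δ Θ s a E ha h' => ?_)
    have E' := (E.cons ha).insert h'
    exact HOL.rw_head hD h.wf.2.2 E'.ty (HOL.symm hD (HOL.beta hD h.wf.2.1 E ha))
      (ih Δ Θ _ E')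
  | @app Γ Ψ t u τ σ φ' φ hw hφ h₁ h₂ ih₁ ih₂ =>
    intro Δ Θ s E
    have := HOL.elim_funU hD (ih₁ Δ Θ s E) (h₂.wf.2.1.subst hD E.ty) (ih₂ Δ Θ s E)
    simpa [Tm.subst, Tm.wk] using this
  | succ hw h₁ h₂ ih =>
    intro Δ Θ s E
    have := HOL.elim_imp (HOL.elim_all hD (h₂.at hD E) (h₁.wf.2.1.subst hD E.ty))
    simp [Tm.subst, Fm.inst₁] at this
    exact this (ih Δ Θ s E)
  | cons hw h₁ h₂ h₃ ih₁ ih₂ | pair hw h₁ h₂ h₃ ih₁ ih₂ =>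
    intro Δ Θ s E
    have := HOL.elim_imp (HOL.elim_all hD (HOL.elim_all hD (h₃.at hD E)
      (h₁.wf.2.1.subst hD E.ty)) (h₂.wf.2.1.subst hD E.ty))
    simp [Tm.subst, Fm.subst, Fm.inst₁] at this
    exact HOL.elim_imp (this (ih₁ Δ Θ s E)) (ih₂ Δ Θ s E)
  | proj₁ hw h ih | proj₂ hw h ih =>
    intro Δ Θ s E
    simpa [Tm.subst, Fm.inst₁] using ih Δ Θ s E
  | sub hw h₁ h₂ ih =>
    refine .of_hol hD (HOL.elim_imp h₂ ?_)
    refine HOL.of_points hw.1 fun Δ Θ s E => ?_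
    simpa [Fm.inst₁] using ih Δ Θ s E
  | @boolCase Γ Ψ t u v σ φ hw ht h₁ h₂ ih₁ ih₂ =>
    refine .of_hol hD (HOL.cases_val hD .bool hw.1 (hw.2.2.inst₁ hD hw.2.1) ht
      fun Δ Θ s c E hc h => ?_)
    have hu := h₁.wf.2.1.subst hD E.ty
    have hv := h₂.wf.2.1.subst hD E.ty
    simp only [Fm.inst₁, Fm.subst_subst, sb_cons, cmp_scons, cmp_sb_nil, drop_zero]
    cases hc with
    | tt =>
      exact HOL.rw_head hD hw.2.2 E.ty (HOL.symm hD (HOL.caseB_tt hD h hu hv))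
        (ih₁ Δ Θ s (E.insert h))
    | ff =>
      exact HOL.rw_head hD hw.2.2 E.ty (HOL.symm hD (HOL.caseB_ff hD h hu hv))
        (ih₂ Δ Θ s (E.insert h))
  | @natCase Γ Ψ t u v σ φ hw ht h₁ h₂ ih₁ ih₂ =>
    refine .of_hol hD (HOL.cases_val hD (.ind .nat) hw.1 (hw.2.2.inst₁ hD hw.2.1) ht
      fun Δ Θ s c E hc h => ?_)
    have hu := h₁.wf.2.1.subst hD E.ty
    have hv := h₂.wf.2.1.subst hD E.ty
    simp only [Fm.inst₁, Fm.subst_subst, sb_cons, cmp_scons, cmp_sb_nil, drop_zero]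
    cases hc with
    | zero =>
      exact HOL.rw_head hD hw.2.2 E.ty (HOL.symm hD (HOL.caseN_zero hD h hu hv))
        (ih₁ Δ Θ s (E.insert h))
    | succ hx =>
      refine HOL.rw_head hD hw.2.2 E.ty (HOL.symm hD (HOL.caseN_succ hD h hx hu hv)) ?_
      have := HOL.elim_imp (HOL.elim_all hD (ih₂ Δ Θ s E) hx)
      simp [Tm.subst, Tm.wk, Fm.inst₁] at this
      exact this h
  | @listCase Γ Ψ t u v τ σ φ hw ht h₁ h₂ ih₁ ih₂ =>
    refine .of_hol hD (HOL.cases_val hD (.ind (.list τ)) hw.1 (hw.2.2.inst₁ hD hw.2.1) ht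
      fun Δ Θ s c E hc h => ?_)
    have hu := h₁.wf.2.1.subst hD E.ty
    have hv := h₂.wf.2.1.subst hD E.ty
    simp only [Fm.inst₁, Fm.subst_subst, sb_cons, cmp_scons, cmp_sb_nil, drop_zero]
    cases hc with
    | nil =>
      exact HOL.rw_head hD hw.2.2 E.ty (HOL.symm hD (HOL.caseL_nil hD h hu hv))
        (ih₁ Δ Θ s (E.insert h))
    | cons hx hy =>
      refine HOL.rw_head hD hw.2.2 E.ty (HOL.symm hD (HOL.caseL_cons hD h hx hy hu hv)) ?_
      have := HOL.elim_imp (HOL.elim_all hD (HOL.elim_all hD (ih₂ Δ Θ s E) hx) hy)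
      simp [Tm.subst, Tm.wk, Fm.inst₁] at this
      exact this h
  | @letrec Γ Ψ e σ φ' φ I hw hφ' hφ hd h ih =>
    refine .of_hol hD (HOL.intro_funU_rec hD hw hφ' hφ fun Δ Θ s x E hx F => ?_)
    -- After unfolding, the goal concerns the body with f and x replaced, which is the premise at
    -- the point `F`.
    refine HOL.rw_head hD hφ (E.ty.scons hx) (HOL.symm hD (HOL.letrec_at hD hw.2.1 E hx)) ?_
    have := ih Δ Θ _ F
    simpa [Tm.subst] using this

end

/-! ## Soundness of RHOL -/

/-- `φ[t₁/r₁][t₂/r₂]` holds at all points of `Γ | Ψ`. -/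
def RSem (D : Guard) (S : Sig) (Γ : Ctx) (Ψ : Set (Fm S.Pred)) (t₁ t₂ : Tm) (φ : Fm S.Pred) :
    Prop :=
  ∀ Δ Θ s, Env D S Γ Ψ Δ Θ s → HOL D S Δ Θ (φ.subst (t₂.subst s ∷ t₁.subst s ∷ s))

section

variable {Γ Δ : Ctx} {Ψ Θ : Set (Fm S.Pred)} {φ χ : Fm S.Pred} {s : ℕ → Tm}
  {τ τ₁ τ₂ σ₁ σ₂ : Ty} {t u x h l t₁ t₂ r₁ r₂ x₁ x₂ h₁ h₂ l₁ l₂ : Tm}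

theorem RSem.of_hol (hD : D.Stable) (h : HOL D S Γ Ψ (φ.inst₂ 0 t₁ t₂)) :
    RSem D S Γ Ψ t₁ t₂ φ :=
  fun Δ Θ s E => by simpa [Fm.inst₂] using h.at hD E

theorem RSem.hol (h : RSem D S Γ Ψ t₁ t₂ φ) (hΨ : WfSet D S Γ Ψ) :
    HOL D S Γ Ψ (φ.inst₂ 0 t₁ t₂) :=
  HOL.of_points hΨ fun Δ Θ s E => by simpa [Fm.inst₂] using h Δ Θ s E

theorem RSem.of_cases (hD : D.Stable) (hτ : τ.IsData) (hw : WfRHOL D S Γ Ψ t₁ σ₁ t₂ σ₂ φ)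
    (ht : HasType D Γ t τ)
    (h : ∀ Δ Θ s c, Env D S Γ Ψ Δ Θ s → Val D Δ τ c → HOL D S Δ Θ (Fm.eq τ (t.subst s) c) →
      HOL D S Δ Θ (φ.subst (t₂.subst s ∷ t₁.subst s ∷ s))) : RSem D S Γ Ψ t₁ t₂ φ :=
  .of_hol hD (HOL.cases_val hD hτ hw.1 (hw.2.2.2.inst₂ hD hw.2.1 hw.2.2.1) ht
    fun Δ Θ s c E hc e => by simpa [Fm.inst₂] using h Δ Θ s c E hc e)

theorem RSem.of_cases₂ (hD : D.Stable) (hτ₁ : τ₁.IsData) (hτ₂ : τ₂.IsData)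
    (hw : WfRHOL D S Γ Ψ t₁ σ₁ t₂ σ₂ φ) (ht : HasType D Γ t τ₁) (hu : HasType D Γ u τ₂)
    (h : ∀ Δ Θ s c d, Env D S Γ Ψ Δ Θ s → Val D Δ τ₁ c → Val D Δ τ₂ d →
      HOL D S Δ Θ (Fm.eq τ₁ (t.subst s) c) → HOL D S Δ Θ (Fm.eq τ₂ (u.subst s) d) →
      HOL D S Δ Θ (φ.subst (t₂.subst s ∷ t₁.subst s ∷ s))) : RSem D S Γ Ψ t₁ t₂ φ :=
  .of_hol hD (HOL.cases_val₂ hD hτ₁ hτ₂ hw.1 (hw.2.2.2.inst₂ hD hw.2.1 hw.2.2.1) ht hu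
    fun Δ Θ s c d E hc hd e e' => by simpa [Fm.inst₂] using h Δ Θ s c d E hc hd e e')

/-! ### Elimination of the assertions on branches -/

theorem HOL.elim_branchNatL (hD : D.Stable)
    (H : HOL D S Δ Θ ((branchNatL t₁ φ).subst (r₂ ∷ r₁ ∷ s))) (hx : HasType D Δ x .nat)
    (e : HOL D S Δ Θ (Fm.eq .nat (t₁.subst s) (.succ x))) :
    HOL D S Δ Θ (φ.subst (r₂ ∷ .app r₁ x ∷ s)) := by
  have := HOL.elim_imp (HOL.elim_all hD H hx)
  simp [Tm.subst, Tm.wk, Fm.inst₂] at this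
  exact this e

theorem HOL.elim_branchNatR (hD : D.Stable)
    (H : HOL D S Δ Θ ((branchNatR t₂ φ).subst (r₂ ∷ r₁ ∷ s))) (hx : HasType D Δ x .nat)
    (e : HOL D S Δ Θ (Fm.eq .nat (t₂.subst s) (.succ x))) :
    HOL D S Δ Θ (φ.subst (.app r₂ x ∷ r₁ ∷ s)) := by
  have := HOL.elim_imp (HOL.elim_all hD H hx)
  simp [Tm.subst, Tm.wk, Fm.inst₂] at this
  exact this e

theorem HOL.elim_branchListL (hD : D.Stable)
    (H : HOL D S Δ Θ ((branchListL τ₁ t₁ φ).subst (r₂ ∷ r₁ ∷ s))) (hh : HasType D Δ h τ₁)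
    (hl : HasType D Δ l (.list τ₁))
    (e : HOL D S Δ Θ (Fm.eq (.list τ₁) (t₁.subst s) (.cons h l))) :
    HOL D S Δ Θ (φ.subst (r₂ ∷ .app (.app r₁ h) l ∷ s)) := by
  have := HOL.elim_imp (HOL.elim_all hD (HOL.elim_all hD H hh) hl)
  simp [Tm.subst, Tm.wk, Fm.inst₂] at this
  exact this e

theorem HOL.elim_branchListR (hD : D.Stable)
    (H : HOL D S Δ Θ ((branchListR τ₂ t₂ φ).subst (r₂ ∷ r₁ ∷ s))) (hh : HasType D Δ h τ₂)
    (hl : HasType D Δ l (.list τ₂))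
    (e : HOL D S Δ Θ (Fm.eq (.list τ₂) (t₂.subst s) (.cons h l))) :
    HOL D S Δ Θ (φ.subst (.app (.app r₂ h) l ∷ r₁ ∷ s)) := by
  have := HOL.elim_imp (HOL.elim_all hD (HOL.elim_all hD H hh) hl)
  simp [Tm.subst, Tm.wk, Fm.inst₂] at this
  exact this e

theorem HOL.elim_branchNatNat (hD : D.Stable)
    (H : HOL D S Δ Θ ((branchNatNat t₁ t₂ φ).subst (r₂ ∷ r₁ ∷ s)))
    (hx₁ : HasType D Δ x₁ .nat) (hx₂ : HasType D Δ x₂ .nat)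
    (e₁ : HOL D S Δ Θ (Fm.eq .nat (t₁.subst s) (.succ x₁)))
    (e₂ : HOL D S Δ Θ (Fm.eq .nat (t₂.subst s) (.succ x₂))) :
    HOL D S Δ Θ (φ.subst (.app r₂ x₂ ∷ .app r₁ x₁ ∷ s)) := by
  have := HOL.elim_imp (HOL.elim_all hD (HOL.elim_all hD H hx₁) hx₂)
  simp [Tm.subst, Tm.wk, Fm.subst, Fm.inst₂] at this
  exact HOL.elim_imp (this e₁) e₂

theorem HOL.elim_branchListList (hD : D.Stable)
    (H : HOL D S Δ Θ ((branchListList τ₁ τ₂ t₁ t₂ φ).subst (r₂ ∷ r₁ ∷ s)))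
    (hh₁ : HasType D Δ h₁ τ₁) (hl₁ : HasType D Δ l₁ (.list τ₁))
    (hh₂ : HasType D Δ h₂ τ₂) (hl₂ : HasType D Δ l₂ (.list τ₂))
    (e₁ : HOL D S Δ Θ (Fm.eq (.list τ₁) (t₁.subst s) (.cons h₁ l₁)))
    (e₂ : HOL D S Δ Θ (Fm.eq (.list τ₂) (t₂.subst s) (.cons h₂ l₂))) :
    HOL D S Δ Θ (φ.subst (.app (.app r₂ h₂) l₂ ∷ .app (.app r₁ h₁) l₁ ∷ s)) := by
  have := HOL.elim_imp (HOL.elim_all hD (HOL.elim_all hD (HOL.elim_all hD (HOL.elim_all hD H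
    hh₁) hh₂) hl₁) hl₂)
  simp [Tm.subst, Tm.wk, Fm.subst, Fm.inst₂] at this
  exact HOL.elim_imp (this e₁) e₂

theorem HOL.elim_branchNatList (hD : D.Stable)
    (H : HOL D S Δ Θ ((branchNatList τ₂ t₁ t₂ φ).subst (r₂ ∷ r₁ ∷ s)))
    (hx₁ : HasType D Δ x₁ .nat) (hh₂ : HasType D Δ h₂ τ₂) (hl₂ : HasType D Δ l₂ (.list τ₂))
    (e₁ : HOL D S Δ Θ (Fm.eq .nat (t₁.subst s) (.succ x₁)))
    (e₂ : HOL D S Δ Θ (Fm.eq (.list τ₂) (t₂.subst s) (.cons h₂ l₂))) :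
    HOL D S Δ Θ (φ.subst (.app (.app r₂ h₂) l₂ ∷ .app r₁ x₁ ∷ s)) := by
  have := HOL.elim_imp (HOL.elim_all hD (HOL.elim_all hD (HOL.elim_all hD H hx₁) hh₂) hl₂)
  simp [Tm.subst, Tm.wk, Fm.subst, Fm.inst₂] at this
  exact HOL.elim_imp (this e₁) e₂

theorem HOL.elim_branchListNat (hD : D.Stable)
    (H : HOL D S Δ Θ ((branchListNat τ₁ t₁ t₂ φ).subst (r₂ ∷ r₁ ∷ s)))
    (hh₁ : HasType D Δ h₁ τ₁) (hl₁ : HasType D Δ l₁ (.list τ₁)) (hx₂ : HasType D Δ x₂ .nat)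
    (e₁ : HOL D S Δ Θ (Fm.eq (.list τ₁) (t₁.subst s) (.cons h₁ l₁)))
    (e₂ : HOL D S Δ Θ (Fm.eq .nat (t₂.subst s) (.succ x₂))) :
    HOL D S Δ Θ (φ.subst (.app r₂ x₂ ∷ .app (.app r₁ h₁) l₁ ∷ s)) := by
  have := HOL.elim_imp (HOL.elim_all hD (HOL.elim_all hD (HOL.elim_all hD H hh₁) hl₁) hx₂)
  simp [Tm.subst, Tm.wk, Fm.subst, Fm.inst₂] at this
  exact HOL.elim_imp (this e₁) e₂

/-! ### Non-overlap of constructors -/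

/-- The asynchronous rules express the false branch through t ≠ tt, whereas case analysis provides t
= ff. -/
theorem HOL.not_tt (hD : D.Stable) (e : HOL D S Δ Θ (Fm.eq .bool t .ff)) :
    HOL D S Δ Θ (Fm.neg (Fm.eq .bool t .tt)) := by
  have hw : WfFm D S Δ (Fm.eq .bool t .tt) := WfFm.eq_iff.2 ⟨e.eq_types.1, .tt⟩
  refine HOL.intro_imp e.wf.1 hw .bot fun Δ Θ s E h => ?_
  exact HOL.elim_imp (.ncBool ⟨E.wf, WfFm.neg_iff.2 (WfFm.eq_iff.2 ⟨.tt, .ff⟩)⟩)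
    (HOL.trans hD (HOL.symm hD h) (e.at hD E))

theorem HOL.absurd_bool (hD : D.Stable) (e : HOL D S Δ Θ (Fm.eq .bool t .tt))
    (e' : HOL D S Δ Θ (Fm.eq .bool t .ff)) (hχ : WfFm D S Δ χ) : HOL D S Δ Θ χ :=
  HOL.absurd (HOL.not_tt hD e') e hχ

theorem HOL.absurd_nat (hD : D.Stable) (e : HOL D S Δ Θ (Fm.eq .nat t .zero))
    (e' : HOL D S Δ Θ (Fm.eq .nat t (.succ x))) (hχ : WfFm D S Δ χ) : HOL D S Δ Θ χ :=
  have h := HOL.trans hD (HOL.symm hD e) e'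
  HOL.absurd (.ncNat ⟨e.wf.1, WfFm.neg_iff.2 h.wf.2⟩) h hχ

theorem HOL.absurd_list (hD : D.Stable) (e : HOL D S Δ Θ (Fm.eq (.list τ) t .nil))
    (e' : HOL D S Δ Θ (Fm.eq (.list τ) t (.cons h l))) (hχ : WfFm D S Δ χ) : HOL D S Δ Θ χ :=
  have h := HOL.trans hD (HOL.symm hD e) e'
  HOL.absurd (.ncList ⟨e.wf.1, WfFm.neg_iff.2 h.wf.2⟩) h hχ

/-- Two booleans with the same value. -/
def sameBool {P : Type*} (t u : Tm) : Fm P :=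
  .or (.and (Fm.eq .bool t .tt) (Fm.eq .bool u .tt)) (.and (Fm.eq .bool t .ff) (Fm.eq .bool u .ff))

/-- Each disjunct clashes with one of the two values, which rules out mismatched branches in the
synchronous rule. -/
theorem HOL.sameBool_tt_ff (hD : D.Stable) (H : HOL D S Δ Θ (sameBool t u))
    (e : HOL D S Δ Θ (Fm.eq .bool t .tt)) (e' : HOL D S Δ Θ (Fm.eq .bool u .ff))
    (hχ : WfFm D S Δ χ) : HOL D S Δ Θ χ :=
  HOL.elim_or H hχ
    (fun _ _ _ E h => HOL.absurd_bool hD (HOL.right h) (e'.at hD E) (hχ.subst hD E.ty))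
    (fun _ _ _ E h => HOL.absurd_bool hD (e.at hD E) (HOL.left h) (hχ.subst hD E.ty))

theorem HOL.sameBool_ff_tt (hD : D.Stable) (H : HOL D S Δ Θ (sameBool t u))
    (e : HOL D S Δ Θ (Fm.eq .bool t .ff)) (e' : HOL D S Δ Θ (Fm.eq .bool u .tt))
    (hχ : WfFm D S Δ χ) : HOL D S Δ Θ χ :=
  HOL.elim_or H hχ
    (fun _ _ _ E h => HOL.absurd_bool hD (HOL.left h) (e.at hD E) (hχ.subst hD E.ty))
    (fun _ _ _ E h => HOL.absurd_bool hD (e'.at hD E) (HOL.right h) (hχ.subst hD E.ty))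

end

/-- Rule induction as in the unary case, with both terms replaced along equations. A one-sided rule
uses reflexivity on the other side, and UHOL premises are interpreted by `UHOL.sound`. -/
theorem RHOL.sound (hD : D.Stable) {Γ : Ctx} {Ψ : Set (Fm S.Pred)} {t₁ t₂ : Tm} {σ₁ σ₂ : Ty}
    {φ : Fm S.Pred} (h : RHOL D S Γ Ψ t₁ σ₁ t₂ σ₂ φ) : RSem D S Γ Ψ t₁ t₂ φ := by
  induction h with
  | var _ h | tt _ h | ff _ h | zero _ h | nil _ h | ttL _ h | ffL _ h | zeroL _ h | nilL _ h
  | ttR _ h | ffR _ h | zeroR _ h | nilR _ h => exact .of_hol hD h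
  | @abs Γ Ψ t₁ τ₁ σ₁ t₂ τ₂ σ₂ φ' φ hw h ih =>
    refine .of_hol hD (HOL.intro_funLR hD hw fun Δ Θ s a₁ a₂ E ha₁ ha₂ h' => ?_)
    have F := (E.wk 2 ((E.ty.scons ha₁).scons ha₂) rfl).insert h'
    refine HOL.rw₂ hD h.wf.2.2.2 F.ty (HOL.beta hD hw.2.1.lam_inv E ha₁)
      (HOL.beta hD hw.2.2.1.lam_inv E ha₂) ?_
    have := ih Δ Θ _ F
    simpa [Tm.subst] using this
  | @app Γ Ψ t₁ u₁ τ₁ σ₁ t₂ u₂ τ₂ σ₂ φ' φ hw hφ h₁ h₂ ih₁ ih₂ =>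
    intro Δ Θ s E
    have := HOL.elim_funLR hD (ih₁ Δ Θ s E) (h₂.wf.2.1.subst hD E.ty)
      (h₂.wf.2.2.1.subst hD E.ty) (ih₂ Δ Θ s E)
    simpa [Tm.subst, Tm.wk] using this
  | succ hw h₁ h₂ ih =>
    intro Δ Θ s E
    have := HOL.elim_imp (HOL.elim_all hD (HOL.elim_all hD (h₂.at hD E)
      (h₁.wf.2.1.subst hD E.ty)) (h₁.wf.2.2.1.subst hD E.ty))
    simp [Tm.subst, Fm.inst₂] at this
    exact this (ih Δ Θ s E)
  | cons hw h₁ h₂ h₃ ih₁ ih₂ | pair hw h₁ h₂ h₃ ih₁ ih₂ =>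
    intro Δ Θ s E
    have := HOL.elim_imp (HOL.elim_all hD (HOL.elim_all hD (HOL.elim_all hD (HOL.elim_all hD
      (h₃.at hD E) (h₁.wf.2.1.subst hD E.ty)) (h₁.wf.2.2.1.subst hD E.ty))
      (h₂.wf.2.1.subst hD E.ty)) (h₂.wf.2.2.1.subst hD E.ty))
    simp [Tm.subst, Fm.subst, Fm.inst₂] at this
    exact HOL.elim_imp (this (ih₁ Δ Θ s E)) (ih₂ Δ Θ s E)
  | proj₁ hw h ih | proj₂ hw h ih | proj₁L hw h ih | proj₂L hw h ih | proj₁R hw h ih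
  | proj₂R hw h ih =>
    intro Δ Θ s E
    simpa [Tm.subst, Fm.inst₂] using ih Δ Θ s E
  | sub hw h₁ h₂ ih => exact .of_hol hD (HOL.elim_imp h₂ (ih.hol hw.1))
  | andI hw h₁ h₂ ih₁ ih₂ =>
    intro Δ Θ s E
    exact HOL.intro_and (ih₁ Δ Θ s E) (ih₂ Δ Θ s E)
  | impI hw h ih => exact .of_hol hD (.impI ⟨hw.1, hw.2.2.2.inst₂ hD hw.2.1 hw.2.2.1⟩ (ih.hol h.wf.1))
  | uholL hw h | uholR hw h =>
    intro Δ Θ s E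
    simpa [Tm.subst, Tm.wk, Fm.inst₂] using h.sound hD Δ Θ s E
  | @absL Γ Ψ t₁ τ₁ σ₁ t₂ σ₂ φ' φ hw h ih =>
    refine .of_hol hD (HOL.intro_funL hD hw fun Δ Θ s a E ha h' => ?_)
    have F := (E.cons ha).insert h'
    refine HOL.rw₂ hD h.wf.2.2.2 F.ty (HOL.beta hD hw.2.1.lam_inv E ha)
      (HOL.refl E.wf (hw.2.2.1.subst hD E.ty)) ?_
    simpa [Tm.wk] using ih Δ Θ _ F
  | @absR Γ Ψ t₁ σ₁ t₂ τ₂ σ₂ φ' φ hw h ih =>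
    refine .of_hol hD (HOL.intro_funR hD hw fun Δ Θ s a E ha h' => ?_)
    have F := (E.cons ha).insert h'
    refine HOL.rw₂ hD h.wf.2.2.2 F.ty (HOL.refl E.wf (hw.2.1.subst hD E.ty))
      (HOL.beta hD hw.2.2.1.lam_inv E ha) ?_
    simpa [Tm.wk] using ih Δ Θ _ F
  | appL hw hφ h₁ h₂ ih₁ =>
    intro Δ Θ s E
    have := HOL.elim_funL hD (ih₁ Δ Θ s E) (h₂.wf.2.1.subst hD E.ty) (h₂.sound hD Δ Θ s E)
    simpa [Tm.subst, Tm.wk] using this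
  | appR hw hφ h₁ h₂ ih₁ =>
    intro Δ Θ s E
    have := HOL.elim_funR hD (ih₁ Δ Θ s E) (h₂.wf.2.1.subst hD E.ty) (h₂.sound hD Δ Θ s E)
    simpa [Tm.subst, Tm.wk] using this
  | varL hw hφ h | varR hw hφ h =>
    intro Δ Θ s E
    -- The assertion ignores the other term, so its instance is that of a hypothesis in Ψ.
    simpa [Tm.subst, Fm.inst₁] using E.hyp _ h
  | succL hw h₁ h₂ ih | succR hw h₁ h₂ ih =>
    intro Δ Θ s E
    have := HOL.elim_imp (HOL.elim_all hD (HOL.elim_all hD (h₂.at hD E)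
      (h₁.wf.2.1.subst hD E.ty)) (h₁.wf.2.2.1.subst hD E.ty))
    simp [Tm.subst, Fm.inst₂] at this
    exact this (ih Δ Θ s E)
  | consL hw h₁ h₂ h₃ ih₁ ih₂ | pairL hw h₁ h₂ h₃ ih₁ ih₂ =>
    intro Δ Θ s E
    have := HOL.elim_imp (HOL.elim_all hD (HOL.elim_all hD (HOL.elim_all hD
      (h₃.at hD E) (h₁.wf.2.1.subst hD E.ty)) (h₁.wf.2.2.1.subst hD E.ty))
      (h₂.wf.2.1.subst hD E.ty))
    simp [Tm.subst, Fm.subst, Fm.inst₂] at this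
    exact HOL.elim_imp (this (ih₁ Δ Θ s E)) (ih₂ Δ Θ s E)
  | consR hw h₁ h₂ h₃ ih₁ ih₂ | pairR hw h₁ h₂ h₃ ih₁ ih₂ =>
    intro Δ Θ s E
    have := HOL.elim_imp (HOL.elim_all hD (HOL.elim_all hD (HOL.elim_all hD
      (h₃.at hD E) (h₁.wf.2.1.subst hD E.ty)) (h₁.wf.2.2.1.subst hD E.ty))
      (h₂.wf.2.2.1.subst hD E.ty))
    simp [Tm.subst, Fm.subst, Fm.inst₂] at this
    exact HOL.elim_imp (this (ih₁ Δ Θ s E)) (ih₂ Δ Θ s E)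
  | @boolCase Γ Ψ t₁ u₁ v₁ σ₁ t₂ u₂ v₂ σ₂ φ hw h₀ h₁ h₂ ih₀ ih₁ ih₂ =>
    refine .of_cases₂ hD .bool .bool hw h₀.wf.2.1 h₀.wf.2.2.1 fun Δ Θ s c d E hc hd e₁ e₂ => ?_
    have U₁ := h₁.wf.2.1.subst hD E.ty
    have V₁ := h₂.wf.2.1.subst hD E.ty
    have U₂ := h₁.wf.2.2.1.subst hD E.ty
    have V₂ := h₂.wf.2.2.1.subst hD E.ty
    have H : HOL D S Δ Θ (sameBool (t₁.subst s) (t₂.subst s)) := ih₀ Δ Θ s E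
    have hχ := hw.2.2.2.subst hD
      ((E.ty.scons (hw.2.1.subst hD E.ty)).scons (hw.2.2.1.subst hD E.ty))
    cases hc <;> cases hd
    · exact HOL.rw₂ hD hw.2.2.2 E.ty (HOL.caseB_tt hD e₁ U₁ V₁) (HOL.caseB_tt hD e₂ U₂ V₂)
        (ih₁ Δ Θ s (E.insert₂ e₁ e₂))
    -- Branches with different constructors are excluded by the premise on the scrutinees.
    · exact HOL.sameBool_tt_ff hD H e₁ e₂ hχ
    · exact HOL.sameBool_ff_tt hD H e₁ e₂ hχ
    · exact HOL.rw₂ hD hw.2.2.2 E.ty (HOL.caseB_ff hD e₁ U₁ V₁) (HOL.caseB_ff hD e₂ U₂ V₂)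
        (ih₂ Δ Θ s (E.insert₂ e₁ e₂))
  | @natCase Γ Ψ t₁ u₁ v₁ σ₁ t₂ u₂ v₂ σ₂ φ hw h₀ h₁ h₂ ih₀ ih₁ ih₂ =>
    refine .of_cases₂ hD (.ind .nat) (.ind .nat) hw h₀.wf.2.1 h₀.wf.2.2.1
      fun Δ Θ s c d E hc hd e₁ e₂ => ?_
    have U₁ := h₁.wf.2.1.subst hD E.ty
    have V₁ := h₂.wf.2.1.subst hD E.ty
    have U₂ := h₁.wf.2.2.1.subst hD E.ty
    have V₂ := h₂.wf.2.2.1.subst hD E.ty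
    have H := ih₀ Δ Θ s E
    have hχ := hw.2.2.2.subst hD
      ((E.ty.scons (hw.2.1.subst hD E.ty)).scons (hw.2.2.1.subst hD E.ty))
    simp only [Fm.subst_iff, Fm.subst_eq, Tm.subst, scons_one, scons_zero] at H
    cases hc <;> cases hd
    · exact HOL.rw₂ hD hw.2.2.2 E.ty (HOL.caseN_zero hD e₁ U₁ V₁) (HOL.caseN_zero hD e₂ U₂ V₂)
        (ih₁ Δ Θ s (E.insert₂ e₁ e₂))
    -- The equivalence in the first premise makes both scrutinees zero, against the second being a
    -- successor.
    · exact HOL.absurd_nat hD (HOL.mp H e₁) e₂ hχ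
    · exact HOL.absurd_nat hD (HOL.mpr H e₂) e₁ hχ
    · rename_i x₁ X₁ x₂ X₂
      exact HOL.rw₂ hD hw.2.2.2 E.ty (HOL.caseN_succ hD e₁ X₁ U₁ V₁)
        (HOL.caseN_succ hD e₂ X₂ U₂ V₂) (HOL.elim_branchNatNat hD (ih₂ Δ Θ s E) X₁ X₂ e₁ e₂)
  | @listCase Γ Ψ t₁ u₁ v₁ τ₁ σ₁ t₂ u₂ v₂ τ₂ σ₂ φ hw h₀ h₁ h₂ ih₀ ih₁ ih₂ =>
    refine .of_cases₂ hD (.ind (.list τ₁)) (.ind (.list τ₂)) hw h₀.wf.2.1 h₀.wf.2.2.1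
      fun Δ Θ s c d E hc hd e₁ e₂ => ?_
    have U₁ := h₁.wf.2.1.subst hD E.ty
    have V₁ := h₂.wf.2.1.subst hD E.ty
    have U₂ := h₁.wf.2.2.1.subst hD E.ty
    have V₂ := h₂.wf.2.2.1.subst hD E.ty
    have H := ih₀ Δ Θ s E
    have hχ := hw.2.2.2.subst hD
      ((E.ty.scons (hw.2.1.subst hD E.ty)).scons (hw.2.2.1.subst hD E.ty))
    simp only [Fm.subst_iff, Fm.subst_eq, Tm.subst, scons_one, scons_zero] at H
    cases hc <;> cases hd
    · exact HOL.rw₂ hD hw.2.2.2 E.ty (HOL.caseL_nil hD e₁ U₁ V₁) (HOL.caseL_nil hD e₂ U₂ V₂)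
        (ih₁ Δ Θ s (E.insert₂ e₁ e₂))
    · exact HOL.absurd_list hD (HOL.mp H e₁) e₂ hχ
    · exact HOL.absurd_list hD (HOL.mpr H e₂) e₁ hχ
    · rename_i _ _ X₁ Y₁ _ _ X₂ Y₂
      exact HOL.rw₂ hD hw.2.2.2 E.ty (HOL.caseL_cons hD e₁ X₁ Y₁ U₁ V₁)
        (HOL.caseL_cons hD e₂ X₂ Y₂ U₂ V₂)
        (HOL.elim_branchListList hD (ih₂ Δ Θ s E) X₁ Y₁ X₂ Y₂ e₁ e₂)
  | @boolCaseL Γ Ψ t₁ u₁ v₁ σ₁ t₂ σ₂ φ hw ht h₁ h₂ ih₁ ih₂ =>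
    refine .of_cases hD .bool hw ht fun Δ Θ s c E hc e => ?_
    have U := h₁.wf.2.1.subst hD E.ty
    have V := h₂.wf.2.1.subst hD E.ty
    have R := HOL.refl E.wf (hw.2.2.1.subst hD E.ty)
    cases hc
    · exact HOL.rw₂ hD hw.2.2.2 E.ty (HOL.caseB_tt hD e U V) R (ih₁ Δ Θ s (E.insert e))
    · exact HOL.rw₂ hD hw.2.2.2 E.ty (HOL.caseB_ff hD e U V) R (ih₂ Δ Θ s (E.insert e))
  | @natCaseL Γ Ψ t₁ u₁ v₁ σ₁ t₂ σ₂ φ hw ht h₁ h₂ ih₁ ih₂ =>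
    refine .of_cases hD (.ind .nat) hw ht fun Δ Θ s c E hc e => ?_
    have U := h₁.wf.2.1.subst hD E.ty
    have V := h₂.wf.2.1.subst hD E.ty
    have R := HOL.refl E.wf (hw.2.2.1.subst hD E.ty)
    cases hc
    · exact HOL.rw₂ hD hw.2.2.2 E.ty (HOL.caseN_zero hD e U V) R (ih₁ Δ Θ s (E.insert e))
    · rename_i x X
      exact HOL.rw₂ hD hw.2.2.2 E.ty (HOL.caseN_succ hD e X U V) R
        (HOL.elim_branchNatL hD (ih₂ Δ Θ s E) X e)
  | @listCaseL Γ Ψ t₁ u₁ v₁ τ₁ σ₁ t₂ σ₂ φ hw ht h₁ h₂ ih₁ ih₂ =>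
    refine .of_cases hD (.ind (.list τ₁)) hw ht fun Δ Θ s c E hc e => ?_
    have U := h₁.wf.2.1.subst hD E.ty
    have V := h₂.wf.2.1.subst hD E.ty
    have R := HOL.refl E.wf (hw.2.2.1.subst hD E.ty)
    cases hc
    · exact HOL.rw₂ hD hw.2.2.2 E.ty (HOL.caseL_nil hD e U V) R (ih₁ Δ Θ s (E.insert e))
    · rename_i _ _ X Y
      exact HOL.rw₂ hD hw.2.2.2 E.ty (HOL.caseL_cons hD e X Y U V) R
        (HOL.elim_branchListL hD (ih₂ Δ Θ s E) X Y e)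
  | @boolCaseR Γ Ψ t₁ σ₁ t₂ u₂ v₂ σ₂ φ hw ht h₁ h₂ ih₁ ih₂ =>
    refine .of_cases hD .bool hw ht fun Δ Θ s c E hc e => ?_
    have U := h₁.wf.2.2.1.subst hD E.ty
    have V := h₂.wf.2.2.1.subst hD E.ty
    have R := HOL.refl E.wf (hw.2.1.subst hD E.ty)
    cases hc
    · exact HOL.rw₂ hD hw.2.2.2 E.ty R (HOL.caseB_tt hD e U V) (ih₁ Δ Θ s (E.insert e))
    · exact HOL.rw₂ hD hw.2.2.2 E.ty R (HOL.caseB_ff hD e U V) (ih₂ Δ Θ s (E.insert e))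
  | @natCaseR Γ Ψ t₁ σ₁ t₂ u₂ v₂ σ₂ φ hw ht h₁ h₂ ih₁ ih₂ =>
    refine .of_cases hD (.ind .nat) hw ht fun Δ Θ s c E hc e => ?_
    have U := h₁.wf.2.2.1.subst hD E.ty
    have V := h₂.wf.2.2.1.subst hD E.ty
    have R := HOL.refl E.wf (hw.2.1.subst hD E.ty)
    cases hc
    · exact HOL.rw₂ hD hw.2.2.2 E.ty R (HOL.caseN_zero hD e U V) (ih₁ Δ Θ s (E.insert e))
    · rename_i x X
      exact HOL.rw₂ hD hw.2.2.2 E.ty R (HOL.caseN_succ hD e X U V)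
        (HOL.elim_branchNatR hD (ih₂ Δ Θ s E) X e)
  | @listCaseR Γ Ψ t₁ σ₁ t₂ u₂ v₂ τ₂ σ₂ φ hw ht h₁ h₂ ih₁ ih₂ =>
    refine .of_cases hD (.ind (.list τ₂)) hw ht fun Δ Θ s c E hc e => ?_
    have U := h₁.wf.2.2.1.subst hD E.ty
    have V := h₂.wf.2.2.1.subst hD E.ty
    have R := HOL.refl E.wf (hw.2.1.subst hD E.ty)
    cases hc
    · exact HOL.rw₂ hD hw.2.2.2 E.ty R (HOL.caseL_nil hD e U V) (ih₁ Δ Θ s (E.insert e))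
    · rename_i _ _ X Y
      exact HOL.rw₂ hD hw.2.2.2 E.ty R (HOL.caseL_cons hD e X Y U V)
        (HOL.elim_branchListR hD (ih₂ Δ Θ s E) X Y e)
  | @boolBoolCase Γ Ψ t₁ u₁ v₁ σ₁ t₂ u₂ v₂ σ₂ φ hw h₀ h₁ h₂ h₃ h₄ _ ih₁ ih₂ ih₃ ih₄ =>
    -- Here and in the other asynchronous rules, the first premise supplies the types of the
    -- scrutinees, and every pair of constructors has its own premise.
    refine .of_cases₂ hD .bool .bool hw h₀.wf.2.1 h₀.wf.2.2.1 fun Δ Θ s c d E hc hd e₁ e₂ => ?_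
    have U₁ := h₁.wf.2.1.subst hD E.ty
    have V₁ := h₄.wf.2.1.subst hD E.ty
    have U₂ := h₁.wf.2.2.1.subst hD E.ty
    have V₂ := h₄.wf.2.2.1.subst hD E.ty
    cases hc <;> cases hd
    · exact HOL.rw₂ hD hw.2.2.2 E.ty (HOL.caseB_tt hD e₁ U₁ V₁) (HOL.caseB_tt hD e₂ U₂ V₂)
        (ih₁ Δ Θ s (E.insert₂ e₁ e₂))
    · exact HOL.rw₂ hD hw.2.2.2 E.ty (HOL.caseB_tt hD e₁ U₁ V₁) (HOL.caseB_ff hD e₂ U₂ V₂)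
        (ih₃ Δ Θ s (E.insert₂ e₁ (HOL.not_tt hD e₂)))
    · exact HOL.rw₂ hD hw.2.2.2 E.ty (HOL.caseB_ff hD e₁ U₁ V₁) (HOL.caseB_tt hD e₂ U₂ V₂)
        (ih₂ Δ Θ s (E.insert₂ (HOL.not_tt hD e₁) e₂))
    · exact HOL.rw₂ hD hw.2.2.2 E.ty (HOL.caseB_ff hD e₁ U₁ V₁) (HOL.caseB_ff hD e₂ U₂ V₂)
        (ih₄ Δ Θ s (E.insert₂ (HOL.not_tt hD e₁) (HOL.not_tt hD e₂)))
  | @boolNatCase Γ Ψ t₁ u₁ v₁ σ₁ t₂ u₂ v₂ σ₂ φ hw h₀ h₁ h₂ h₃ h₄ _ ih₁ ih₂ ih₃ ih₄ =>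
    refine .of_cases₂ hD .bool (.ind .nat) hw h₀.wf.2.1 h₀.wf.2.2.1
      fun Δ Θ s c d E hc hd e₁ e₂ => ?_
    have U₁ := h₁.wf.2.1.subst hD E.ty
    have V₁ := h₄.wf.2.1.subst hD E.ty
    have U₂ := h₁.wf.2.2.1.subst hD E.ty
    have V₂ := h₄.wf.2.2.1.subst hD E.ty
    cases hc <;> cases hd
    · exact HOL.rw₂ hD hw.2.2.2 E.ty (HOL.caseB_tt hD e₁ U₁ V₁) (HOL.caseN_zero hD e₂ U₂ V₂)
        (ih₁ Δ Θ s (E.insert₂ e₁ e₂))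
    · rename_i x X
      exact HOL.rw₂ hD hw.2.2.2 E.ty (HOL.caseB_tt hD e₁ U₁ V₁) (HOL.caseN_succ hD e₂ X U₂ V₂)
        (HOL.elim_branchNatR hD (ih₃ Δ Θ s (E.insert e₁)) X e₂)
    · exact HOL.rw₂ hD hw.2.2.2 E.ty (HOL.caseB_ff hD e₁ U₁ V₁) (HOL.caseN_zero hD e₂ U₂ V₂)
        (ih₂ Δ Θ s (E.insert₂ (HOL.not_tt hD e₁) e₂))
    · rename_i x X
      exact HOL.rw₂ hD hw.2.2.2 E.ty (HOL.caseB_ff hD e₁ U₁ V₁) (HOL.caseN_succ hD e₂ X U₂ V₂)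
        (HOL.elim_branchNatR hD (ih₄ Δ Θ s (E.insert (HOL.not_tt hD e₁))) X e₂)
  | @boolListCase Γ Ψ t₁ u₁ v₁ σ₁ t₂ u₂ v₂ τ₂ σ₂ φ hw h₀ h₁ h₂ h₃ h₄ _ ih₁ ih₂ ih₃ ih₄ =>
    refine .of_cases₂ hD .bool (.ind (.list τ₂)) hw h₀.wf.2.1 h₀.wf.2.2.1
      fun Δ Θ s c d E hc hd e₁ e₂ => ?_
    have U₁ := h₁.wf.2.1.subst hD E.ty
    have V₁ := h₄.wf.2.1.subst hD E.ty
    have U₂ := h₁.wf.2.2.1.subst hD E.ty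
    have V₂ := h₄.wf.2.2.1.subst hD E.ty
    cases hc <;> cases hd
    · exact HOL.rw₂ hD hw.2.2.2 E.ty (HOL.caseB_tt hD e₁ U₁ V₁) (HOL.caseL_nil hD e₂ U₂ V₂)
        (ih₁ Δ Θ s (E.insert₂ e₁ e₂))
    · rename_i _ _ X Y
      exact HOL.rw₂ hD hw.2.2.2 E.ty (HOL.caseB_tt hD e₁ U₁ V₁)
        (HOL.caseL_cons hD e₂ X Y U₂ V₂)
        (HOL.elim_branchListR hD (ih₃ Δ Θ s (E.insert e₁)) X Y e₂)
    · exact HOL.rw₂ hD hw.2.2.2 E.ty (HOL.caseB_ff hD e₁ U₁ V₁) (HOL.caseL_nil hD e₂ U₂ V₂)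
        (ih₂ Δ Θ s (E.insert₂ (HOL.not_tt hD e₁) e₂))
    · rename_i _ _ X Y
      exact HOL.rw₂ hD hw.2.2.2 E.ty (HOL.caseB_ff hD e₁ U₁ V₁)
        (HOL.caseL_cons hD e₂ X Y U₂ V₂)
        (HOL.elim_branchListR hD (ih₄ Δ Θ s (E.insert (HOL.not_tt hD e₁))) X Y e₂)
  | @natBoolCase Γ Ψ t₁ u₁ v₁ σ₁ t₂ u₂ v₂ σ₂ φ hw h₀ h₁ h₂ h₃ h₄ _ ih₁ ih₂ ih₃ ih₄ =>
    refine .of_cases₂ hD (.ind .nat) .bool hw h₀.wf.2.1 h₀.wf.2.2.1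
      fun Δ Θ s c d E hc hd e₁ e₂ => ?_
    have U₁ := h₁.wf.2.1.subst hD E.ty
    have V₁ := h₄.wf.2.1.subst hD E.ty
    have U₂ := h₁.wf.2.2.1.subst hD E.ty
    have V₂ := h₄.wf.2.2.1.subst hD E.ty
    cases hc <;> cases hd
    · exact HOL.rw₂ hD hw.2.2.2 E.ty (HOL.caseN_zero hD e₁ U₁ V₁) (HOL.caseB_tt hD e₂ U₂ V₂)
        (ih₁ Δ Θ s (E.insert₂ e₁ e₂))
    · exact HOL.rw₂ hD hw.2.2.2 E.ty (HOL.caseN_zero hD e₁ U₁ V₁) (HOL.caseB_ff hD e₂ U₂ V₂)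
        (ih₂ Δ Θ s (E.insert₂ e₁ (HOL.not_tt hD e₂)))
    · rename_i x X
      exact HOL.rw₂ hD hw.2.2.2 E.ty (HOL.caseN_succ hD e₁ X U₁ V₁) (HOL.caseB_tt hD e₂ U₂ V₂)
        (HOL.elim_branchNatL hD (ih₃ Δ Θ s (E.insert e₂)) X e₁)
    · rename_i x X
      exact HOL.rw₂ hD hw.2.2.2 E.ty (HOL.caseN_succ hD e₁ X U₁ V₁) (HOL.caseB_ff hD e₂ U₂ V₂)
        (HOL.elim_branchNatL hD (ih₄ Δ Θ s (E.insert (HOL.not_tt hD e₂))) X e₁)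
  | @natNatCase Γ Ψ t₁ u₁ v₁ σ₁ t₂ u₂ v₂ σ₂ φ hw h₀ h₁ h₂ h₃ h₄ _ ih₁ ih₂ ih₃ ih₄ =>
    refine .of_cases₂ hD (.ind .nat) (.ind .nat) hw h₀.wf.2.1 h₀.wf.2.2.1
      fun Δ Θ s c d E hc hd e₁ e₂ => ?_
    have U₁ := h₁.wf.2.1.subst hD E.ty
    have V₁ := h₄.wf.2.1.subst hD E.ty
    have U₂ := h₁.wf.2.2.1.subst hD E.ty
    have V₂ := h₄.wf.2.2.1.subst hD E.ty
    cases hc <;> cases hd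
    · exact HOL.rw₂ hD hw.2.2.2 E.ty (HOL.caseN_zero hD e₁ U₁ V₁) (HOL.caseN_zero hD e₂ U₂ V₂)
        (ih₁ Δ Θ s (E.insert₂ e₁ e₂))
    · rename_i x X
      exact HOL.rw₂ hD hw.2.2.2 E.ty (HOL.caseN_zero hD e₁ U₁ V₁) (HOL.caseN_succ hD e₂ X U₂ V₂)
        (HOL.elim_branchNatR hD (ih₃ Δ Θ s (E.insert e₁)) X e₂)
    · rename_i x X
      exact HOL.rw₂ hD hw.2.2.2 E.ty (HOL.caseN_succ hD e₁ X U₁ V₁) (HOL.caseN_zero hD e₂ U₂ V₂)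
        (HOL.elim_branchNatL hD (ih₂ Δ Θ s (E.insert e₂)) X e₁)
    · rename_i x₁ X₁ x₂ X₂
      exact HOL.rw₂ hD hw.2.2.2 E.ty (HOL.caseN_succ hD e₁ X₁ U₁ V₁)
        (HOL.caseN_succ hD e₂ X₂ U₂ V₂) (HOL.elim_branchNatNat hD (ih₄ Δ Θ s E) X₁ X₂ e₁ e₂)
  | @natListCase Γ Ψ t₁ u₁ v₁ σ₁ t₂ u₂ v₂ τ₂ σ₂ φ hw h₀ h₁ h₂ h₃ h₄ _ ih₁ ih₂ ih₃ ih₄ =>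
    refine .of_cases₂ hD (.ind .nat) (.ind (.list τ₂)) hw h₀.wf.2.1 h₀.wf.2.2.1
      fun Δ Θ s c d E hc hd e₁ e₂ => ?_
    have U₁ := h₁.wf.2.1.subst hD E.ty
    have V₁ := h₄.wf.2.1.subst hD E.ty
    have U₂ := h₁.wf.2.2.1.subst hD E.ty
    have V₂ := h₄.wf.2.2.1.subst hD E.ty
    cases hc <;> cases hd
    · exact HOL.rw₂ hD hw.2.2.2 E.ty (HOL.caseN_zero hD e₁ U₁ V₁) (HOL.caseL_nil hD e₂ U₂ V₂)
        (ih₁ Δ Θ s (E.insert₂ e₁ e₂))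
    · rename_i _ _ X Y
      exact HOL.rw₂ hD hw.2.2.2 E.ty (HOL.caseN_zero hD e₁ U₁ V₁)
        (HOL.caseL_cons hD e₂ X Y U₂ V₂)
        (HOL.elim_branchListR hD (ih₃ Δ Θ s (E.insert e₁)) X Y e₂)
    · rename_i x X
      exact HOL.rw₂ hD hw.2.2.2 E.ty (HOL.caseN_succ hD e₁ X U₁ V₁) (HOL.caseL_nil hD e₂ U₂ V₂)
        (HOL.elim_branchNatL hD (ih₂ Δ Θ s (E.insert e₂)) X e₁)
    · rename_i x₁ X₁ _ _ X₂ Y₂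
      exact HOL.rw₂ hD hw.2.2.2 E.ty (HOL.caseN_succ hD e₁ X₁ U₁ V₁)
        (HOL.caseL_cons hD e₂ X₂ Y₂ U₂ V₂)
        (HOL.elim_branchNatList hD (ih₄ Δ Θ s E) X₁ X₂ Y₂ e₁ e₂)
  | @listBoolCase Γ Ψ t₁ u₁ v₁ τ₁ σ₁ t₂ u₂ v₂ σ₂ φ hw h₀ h₁ h₂ h₃ h₄ _ ih₁ ih₂ ih₃ ih₄ =>
    refine .of_cases₂ hD (.ind (.list τ₁)) .bool hw h₀.wf.2.1 h₀.wf.2.2.1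
      fun Δ Θ s c d E hc hd e₁ e₂ => ?_
    have U₁ := h₁.wf.2.1.subst hD E.ty
    have V₁ := h₄.wf.2.1.subst hD E.ty
    have U₂ := h₁.wf.2.2.1.subst hD E.ty
    have V₂ := h₄.wf.2.2.1.subst hD E.ty
    cases hc <;> cases hd
    · exact HOL.rw₂ hD hw.2.2.2 E.ty (HOL.caseL_nil hD e₁ U₁ V₁) (HOL.caseB_tt hD e₂ U₂ V₂)
        (ih₁ Δ Θ s (E.insert₂ e₁ e₂))
    · exact HOL.rw₂ hD hw.2.2.2 E.ty (HOL.caseL_nil hD e₁ U₁ V₁) (HOL.caseB_ff hD e₂ U₂ V₂)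
        (ih₂ Δ Θ s (E.insert₂ e₁ (HOL.not_tt hD e₂)))
    · rename_i _ _ X Y
      exact HOL.rw₂ hD hw.2.2.2 E.ty (HOL.caseL_cons hD e₁ X Y U₁ V₁)
        (HOL.caseB_tt hD e₂ U₂ V₂)
        (HOL.elim_branchListL hD (ih₃ Δ Θ s (E.insert e₂)) X Y e₁)
    · rename_i _ _ X Y
      exact HOL.rw₂ hD hw.2.2.2 E.ty (HOL.caseL_cons hD e₁ X Y U₁ V₁)
        (HOL.caseB_ff hD e₂ U₂ V₂)
        (HOL.elim_branchListL hD (ih₄ Δ Θ s (E.insert (HOL.not_tt hD e₂))) X Y e₁)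
  | @listNatCase Γ Ψ t₁ u₁ v₁ τ₁ σ₁ t₂ u₂ v₂ σ₂ φ hw h₀ h₁ h₂ h₃ h₄ _ ih₁ ih₂ ih₃ ih₄ =>
    refine .of_cases₂ hD (.ind (.list τ₁)) (.ind .nat) hw h₀.wf.2.1 h₀.wf.2.2.1
      fun Δ Θ s c d E hc hd e₁ e₂ => ?_
    have U₁ := h₁.wf.2.1.subst hD E.ty
    have V₁ := h₄.wf.2.1.subst hD E.ty
    have U₂ := h₁.wf.2.2.1.subst hD E.ty
    have V₂ := h₄.wf.2.2.1.subst hD E.ty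
    cases hc <;> cases hd
    · exact HOL.rw₂ hD hw.2.2.2 E.ty (HOL.caseL_nil hD e₁ U₁ V₁) (HOL.caseN_zero hD e₂ U₂ V₂)
        (ih₁ Δ Θ s (E.insert₂ e₁ e₂))
    · rename_i x X
      exact HOL.rw₂ hD hw.2.2.2 E.ty (HOL.caseL_nil hD e₁ U₁ V₁) (HOL.caseN_succ hD e₂ X U₂ V₂)
        (HOL.elim_branchNatR hD (ih₃ Δ Θ s (E.insert e₁)) X e₂)
    · rename_i _ _ X Y
      exact HOL.rw₂ hD hw.2.2.2 E.ty (HOL.caseL_cons hD e₁ X Y U₁ V₁)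
        (HOL.caseN_zero hD e₂ U₂ V₂)
        (HOL.elim_branchListL hD (ih₂ Δ Θ s (E.insert e₂)) X Y e₁)
    · rename_i _ _ X₁ Y₁ x₂ X₂
      exact HOL.rw₂ hD hw.2.2.2 E.ty (HOL.caseL_cons hD e₁ X₁ Y₁ U₁ V₁)
        (HOL.caseN_succ hD e₂ X₂ U₂ V₂)
        (HOL.elim_branchListNat hD (ih₄ Δ Θ s E) X₁ Y₁ X₂ e₁ e₂)
  | @listListCase Γ Ψ t₁ u₁ v₁ τ₁ σ₁ t₂ u₂ v₂ τ₂ σ₂ φ hw h₀ h₁ h₂ h₃ h₄ _ ih₁ ih₂ ih₃ ih₄ =>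
    refine .of_cases₂ hD (.ind (.list τ₁)) (.ind (.list τ₂)) hw h₀.wf.2.1 h₀.wf.2.2.1
      fun Δ Θ s c d E hc hd e₁ e₂ => ?_
    have U₁ := h₁.wf.2.1.subst hD E.ty
    have V₁ := h₄.wf.2.1.subst hD E.ty
    have U₂ := h₁.wf.2.2.1.subst hD E.ty
    have V₂ := h₄.wf.2.2.1.subst hD E.ty
    cases hc <;> cases hd
    · exact HOL.rw₂ hD hw.2.2.2 E.ty (HOL.caseL_nil hD e₁ U₁ V₁) (HOL.caseL_nil hD e₂ U₂ V₂)
        (ih₁ Δ Θ s (E.insert₂ e₁ e₂))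
    · rename_i _ _ X Y
      exact HOL.rw₂ hD hw.2.2.2 E.ty (HOL.caseL_nil hD e₁ U₁ V₁)
        (HOL.caseL_cons hD e₂ X Y U₂ V₂)
        (HOL.elim_branchListR hD (ih₃ Δ Θ s (E.insert e₁)) X Y e₂)
    · rename_i _ _ X Y
      exact HOL.rw₂ hD hw.2.2.2 E.ty (HOL.caseL_cons hD e₁ X Y U₁ V₁)
        (HOL.caseL_nil hD e₂ U₂ V₂)
        (HOL.elim_branchListL hD (ih₂ Δ Θ s (E.insert e₂)) X Y e₁)
    · rename_i _ _ X₁ Y₁ _ _ X₂ Y₂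
      exact HOL.rw₂ hD hw.2.2.2 E.ty (HOL.caseL_cons hD e₁ X₁ Y₁ U₁ V₁)
        (HOL.caseL_cons hD e₂ X₂ Y₂ U₂ V₂)
        (HOL.elim_branchListList hD (ih₄ Δ Θ s E) X₁ Y₁ X₂ Y₂ e₁ e₂)
  | @natCaseAlt Γ Ψ t₁ u₁ v₁ σ₁ t₂ u₂ v₂ σ₂ φ' φ hw h₀ h₁ h₂ ih₀ ih₁ ih₂ =>
    refine .of_cases₂ hD (.ind .nat) (.ind .nat) hw h₀.wf.2.1 h₀.wf.2.2.1
      fun Δ Θ s c d E hc hd e₁ e₂ => ?_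
    have U₁ := h₁.wf.2.1.subst hD E.ty
    have V₁ := h₂.wf.2.1.subst hD E.ty
    have U₂ := h₁.wf.2.2.1.subst hD E.ty
    have V₂ := h₂.wf.2.2.1.subst hD E.ty
    have hφ' := (WfFm.and_iff.1 h₀.wf.2.2.2).1
    have H := HOL.right (ih₀ Δ Θ s E)
    -- φ' is transported to the constructor forms before the split, so it provides the hypothesis of
    -- whichever branch is taken.
    have H' := HOL.rw₂ hD hφ' E.ty (HOL.symm hD e₁) (HOL.symm hD e₂) (HOL.left (ih₀ Δ Θ s E))
    have hχ := hw.2.2.2.subst hD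
      ((E.ty.scons (hw.2.1.subst hD E.ty)).scons (hw.2.2.1.subst hD E.ty))
    cases hc <;> cases hd
    · exact HOL.rw₂ hD hw.2.2.2 E.ty (HOL.caseN_zero hD e₁ U₁ V₁) (HOL.caseN_zero hD e₂ U₂ V₂)
        (ih₁ Δ Θ s (E.insert (by simpa [Fm.inst₂, Tm.subst] using H')))
    · exact HOL.absurd_nat hD (HOL.mp H e₁) e₂ hχ
    · exact HOL.absurd_nat hD (HOL.mpr H e₂) e₁ hχ
    · rename_i x₁ X₁ x₂ X₂
      refine HOL.rw₂ hD hw.2.2.2 E.ty (HOL.caseN_succ hD e₁ X₁ U₁ V₁)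
        (HOL.caseN_succ hD e₂ X₂ U₂ V₂) ?_
      have := HOL.elim_imp (HOL.elim_all hD (HOL.elim_all hD (ih₂ Δ Θ s E) X₁) X₂)
      simp [Tm.subst, Fm.inst₂] at this
      exact this H'
  | @listCaseAlt Γ Ψ t₁ u₁ v₁ τ₁ σ₁ t₂ u₂ v₂ τ₂ σ₂ φ' φ hw h₀ h₁ h₂ ih₀ ih₁ ih₂ =>
    refine .of_cases₂ hD (.ind (.list τ₁)) (.ind (.list τ₂)) hw h₀.wf.2.1 h₀.wf.2.2.1
      fun Δ Θ s c d E hc hd e₁ e₂ => ?_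
    have U₁ := h₁.wf.2.1.subst hD E.ty
    have V₁ := h₂.wf.2.1.subst hD E.ty
    have U₂ := h₁.wf.2.2.1.subst hD E.ty
    have V₂ := h₂.wf.2.2.1.subst hD E.ty
    have hφ' := (WfFm.and_iff.1 h₀.wf.2.2.2).1
    have H := HOL.right (ih₀ Δ Θ s E)
    have H' := HOL.rw₂ hD hφ' E.ty (HOL.symm hD e₁) (HOL.symm hD e₂) (HOL.left (ih₀ Δ Θ s E))
    have hχ := hw.2.2.2.subst hD
      ((E.ty.scons (hw.2.1.subst hD E.ty)).scons (hw.2.2.1.subst hD E.ty))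
    cases hc <;> cases hd
    · exact HOL.rw₂ hD hw.2.2.2 E.ty (HOL.caseL_nil hD e₁ U₁ V₁) (HOL.caseL_nil hD e₂ U₂ V₂)
        (ih₁ Δ Θ s (E.insert (by simpa [Fm.inst₂, Tm.subst] using H')))
    · exact HOL.absurd_list hD (HOL.mp H e₁) e₂ hχ
    · exact HOL.absurd_list hD (HOL.mpr H e₂) e₁ hχ
    · rename_i _ _ X₁ Y₁ _ _ X₂ Y₂
      refine HOL.rw₂ hD hw.2.2.2 E.ty (HOL.caseL_cons hD e₁ X₁ Y₁ U₁ V₁)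
        (HOL.caseL_cons hD e₂ X₂ Y₂ U₂ V₂) ?_
      have := HOL.elim_imp (HOL.elim_all hD (HOL.elim_all hD (HOL.elim_all hD (HOL.elim_all hD
        (ih₂ Δ Θ s E) X₁) X₂) Y₁) Y₂)
      simp [Tm.subst, Fm.inst₂] at this
      exact this H'
  | @letrec Γ Ψ e₁ σ₁ e₂ σ₂ φ' φ I₁ I₂ hw hφ' hφ _ _ h ih =>
    refine .of_hol hD (HOL.intro_funLR_rec hD hw hφ' hφ fun Δ Θ s x₁ x₂ E hx₁ hx₂ F => ?_)
    refine HOL.rw₂ hD hφ ((E.ty.scons hx₁).scons hx₂) (HOL.letrec_at hD hw.2.1 E hx₁)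
      (HOL.letrec_at hD hw.2.2.1 E hx₂) ?_
    -- The rule permutes the variables of the bodies to the order x₁, x₂, f₁, f₂; at the point `F`
    -- the permuted bodies are the unfoldings.
    have := ih Δ Θ _ F
    simpa [Tm.subst] using this
  | @letrecL Γ Ψ e₁ σ₁ t₂ σ₂ φ' φ I₁ hw hφ' hφ _ h ih =>
    refine .of_hol hD (HOL.intro_funL_rec hD hw hφ' hφ fun Δ Θ s x E hx F => ?_)
    refine HOL.rw₂ hD hφ (E.ty.scons hx) (HOL.letrec_at hD hw.2.1 E hx)
      (HOL.refl E.wf (hw.2.2.1.subst hD E.ty)) ?_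
    have := ih Δ Θ _ F
    simpa [Tm.subst, Tm.wk] using this
  | @letrecR Γ Ψ t₁ σ₁ e₂ σ₂ φ' φ I₂ hw hφ' hφ _ h ih =>
    refine .of_hol hD (HOL.intro_funR_rec hD hw hφ' hφ fun Δ Θ s x E hx F => ?_)
    refine HOL.rw₂ hD hφ (E.ty.scons hx) (HOL.refl E.wf (hw.2.1.subst hD E.ty))
      (HOL.letrec_at hD hw.2.2.1 E hx) ?_
    have := ih Δ Θ _ F
    simpa [Tm.subst, Tm.wk] using this

/-! ## Completeness -/

section

variable {Γ : Ctx} {Ψ : Set (Fm S.Pred)} {φ : Fm S.Pred} {t : Tm} {σ : Ty}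

theorem HOL.top (hΨ : WfSet D S Γ Ψ) : HOL D S Γ Ψ .top := .topI ⟨hΨ, .top⟩

/-- Assertions built from `⊤` by implications and universal quantifiers. -/
inductive Trivial (D : Guard) (S : Sig) : Ctx → Fm S.Pred → Prop
  | top {Γ : Ctx} : Trivial D S Γ .top
  | imp {Γ : Ctx} {φ ψ : Fm S.Pred} : WfFm D S Γ φ → Trivial D S Γ ψ → Trivial D S Γ (.imp φ ψ)
  | all {Γ : Ctx} {τ : Ty} {φ : Fm S.Pred} : Trivial D S (τ :: Γ) φ → Trivial D S Γ (.all τ φ)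

theorem Trivial.wf (h : Trivial D S Γ φ) : WfFm D S Γ φ := by
  induction h with
  | top => exact .top
  | imp h _ ih => exact .imp h ih
  | all _ ih => exact .all ih

theorem Trivial.hol (hD : D.Stable) (h : Trivial D S Γ φ) :
    ∀ {Ψ : Set (Fm S.Pred)}, WfSet D S Γ Ψ → HOL D S Γ Ψ φ := by
  induction h with
  | top => exact HOL.top
  | imp h h' ih => intro Ψ hΨ; exact .impI ⟨hΨ, .imp h h'.wf⟩ (ih (hΨ.insert h))
  | all h ih => intro Ψ hΨ; exact .allI ⟨hΨ, .all h.wf⟩ (ih (hΨ.wk_one hD))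

theorem Trivial.subst (hD : D.Stable) (h : Trivial D S Γ φ) :
    ∀ {Δ : Ctx} {s : ℕ → Tm}, Typed D Γ Δ s → Trivial D S Δ (φ.subst s) := by
  induction h with
  | top => intro Δ s _; exact .top
  | imp h _ ih => intro Δ s hs; exact .imp (h.subst hD hs) (ih hs)
  | all _ ih => intro Δ s hs; exact .all (ih (hs.up hD _))

/-- A trivial assertion may replace `⊤`, and conversely. -/
theorem UHOL.trivial (hD : D.Stable) {φ' : Fm S.Pred} (h : UHOL D S Γ Ψ t σ φ')
    (hφ : Trivial D S (σ :: Γ) φ) : UHOL D S Γ Ψ t σ φ := by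
  obtain ⟨hΨ, ht, hφ'⟩ := h.wf
  refine .sub ⟨hΨ, ht, hφ.wf⟩ h (Trivial.hol hD (.imp (hφ'.inst₁ hD ht) ?_) hΨ)
  exact hφ.subst hD (by simpa [sb_nil_zero] using Typed.var.scons ht)

/-- Every well-typed term satisfies `⊤` in UHOL. -/
theorem UHOL.top (hD : D.Stable) (h : HasType D Γ t σ) :
    ∀ {Δ : Ctx} {Ψ : Set (Fm S.Pred)} {ρ : ℕ → ℕ},
      (∀ n τ, Γ[n]? = some τ → Δ[ρ n]? = some τ) → WfSet D S Δ Ψ →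
      UHOL D S Δ Ψ (t.rename ρ) σ .top := by
  -- The statement allows a renaming because the recursion rule exchanges f and x in the body, so
  -- the induction hypothesis is needed for a renamed body.
  induction h with
  | var h => intro Δ Ψ ρ hρ hΨ; exact .var ⟨hΨ, .var (hρ _ _ h), .top⟩ (HOL.top hΨ)
  | tt => intro Δ Ψ ρ hρ hΨ; exact .tt ⟨hΨ, .tt, .top⟩ (HOL.top hΨ)
  | ff => intro Δ Ψ ρ hρ hΨ; exact .ff ⟨hΨ, .ff, .top⟩ (HOL.top hΨ)
  | zero => intro Δ Ψ ρ hρ hΨ; exact .zero ⟨hΨ, .zero, .top⟩ (HOL.top hΨ)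
  | nil => intro Δ Ψ ρ hρ hΨ; exact .nil ⟨hΨ, .nil, .top⟩ (HOL.top hΨ)
  | pair h₁ h₂ ih₁ ih₂ =>
    intro Δ Ψ ρ hρ hΨ
    exact .pair ⟨hΨ, .pair (h₁.rename hD hρ) (h₂.rename hD hρ), .top⟩ (ih₁ hρ hΨ) (ih₂ hρ hΨ)
      (Trivial.hol hD (.all (.all (.imp .top (.imp .top .top)))) hΨ)
  | cons h₁ h₂ ih₁ ih₂ =>
    intro Δ Ψ ρ hρ hΨ
    exact .cons ⟨hΨ, .cons (h₁.rename hD hρ) (h₂.rename hD hρ), .top⟩ (ih₁ hρ hΨ) (ih₂ hρ hΨ)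
      (Trivial.hol hD (.all (.all (.imp .top (.imp .top .top)))) hΨ)
  | succ h ih =>
    intro Δ Ψ ρ hρ hΨ
    exact .succ ⟨hΨ, .succ (h.rename hD hρ), .top⟩ (ih hρ hΨ)
      (Trivial.hol hD (.all (.imp .top .top)) hΨ)
  | proj₁ h ih =>
    intro Δ Ψ ρ hρ hΨ
    exact .proj₁ ⟨hΨ, .proj₁ (h.rename hD hρ), .top⟩ (ih hρ hΨ)
  | proj₂ h ih =>
    intro Δ Ψ ρ hρ hΨ
    exact .proj₂ ⟨hΨ, .proj₂ (h.rename hD hρ), .top⟩ (ih hρ hΨ)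
  | app h₁ h₂ ih₁ ih₂ =>
    intro Δ Ψ ρ hρ hΨ
    -- The rule expects ∀x. ⊤ ⇒ ⊤ of the function; subsumption derives it from ⊤.
    exact UHOL.app (φ' := .top) (φ := .top)
      ⟨hΨ, .app (h₁.rename hD hρ) (h₂.rename hD hρ), .top⟩ .top
      ((ih₁ hρ hΨ).trivial hD (.all (.imp .top .top))) (ih₂ hρ hΨ)
  | lam h ih =>
    intro Δ Ψ ρ hρ hΨ
    -- The rule yields ∀x. ⊤ ⇒ ⊤, which subsumption weakens to ⊤.
    refine UHOL.trivial hD (UHOL.abs (φ' := .top) (φ := .top)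
      ⟨hΨ, .lam (h.rename hD (Typed.shift hρ _)), .all (.imp .top .top)⟩ ?_) .top
    exact ih (Typed.shift hρ _) ((hΨ.wk_one hD).insert .top)
  | caseB h₁ h₂ h₃ ih₁ ih₂ ih₃ =>
    intro Δ Ψ ρ hρ hΨ
    have ht := h₁.rename hD hρ
    exact .boolCase ⟨hΨ, .caseB ht (h₂.rename hD hρ) (h₃.rename hD hρ), .top⟩ ht
      (ih₂ hρ (hΨ.insert (WfFm.eq_iff.2 ⟨ht, .tt⟩))) (ih₃ hρ (hΨ.insert (WfFm.eq_iff.2 ⟨ht, .ff⟩)))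
  | caseN h₁ h₂ h₃ ih₁ ih₂ ih₃ =>
    intro Δ Ψ ρ hρ hΨ
    have ht := h₁.rename hD hρ
    refine .natCase ⟨hΨ, .caseN ht (h₂.rename hD hρ) (h₃.rename hD hρ), .top⟩ ht
      (ih₂ hρ (hΨ.insert (WfFm.eq_iff.2 ⟨ht, .zero⟩))) ((ih₃ hρ hΨ).trivial hD ?_)
    exact .all (.imp (WfFm.eq_iff.2 ⟨ht.subst hD (Typed.wk [_, _]), .succ (.var rfl)⟩) .top)
  | caseL h₁ h₂ h₃ ih₁ ih₂ ih₃ =>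
    intro Δ Ψ ρ hρ hΨ
    have ht := h₁.rename hD hρ
    refine .listCase ⟨hΨ, .caseL ht (h₂.rename hD hρ) (h₃.rename hD hρ), .top⟩ ht
      (ih₂ hρ (hΨ.insert (WfFm.eq_iff.2 ⟨ht, .nil⟩))) ((ih₃ hρ hΨ).trivial hD ?_)
    exact .all (.all (.imp (WfFm.eq_iff.2 ⟨ht.subst hD (Typed.wk [_, _, _]),
      .cons (.var rfl) (.var rfl)⟩) .top))
  | @letrec Γ e I σ he hd ih =>
    intro Δ Ψ ρ hρ hΨ
    have hL := (HasType.letrec he hd).rename hD hρ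
    have hd' := hD Γ Δ (fun n => .var (ρ n)) (fun n τ h => .var (hρ n τ h)) I σ e he hd
    rw [upr_var, upr_var, ← Tm.rename_eq_subst] at hd'
    refine UHOL.trivial hD (UHOL.letrec (φ' := .top) (φ := .top)
      ⟨hΨ, hL, .all (.imp .top .top)⟩ .top .top hd' ?_) .top
    -- The exchange of f and x is absorbed into the renaming.
    have hsw : (e.rename (upr (upr ρ))).subst (sb [.var 1, .var 0] 2) =
        e.rename (fun n => match n with | 0 => 1 | 1 => 0 | n + 2 => ρ n + 2) := by
      rw [Tm.subst_rename, Tm.rename_eq_subst]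
      congr 1; funext n
      rcases n with _ | _ | n <;> rfl
    rw [hsw]
    refine ih ?_ (((hΨ.wk_two hD).insert ?_).insert .top)
    · intro n τ h
      rcases n with _ | _ | n
      · exact h
      · exact h
      · exact hρ n τ h
    · exact .all (.imp (WfFm.lt_iff.2 ⟨.var rfl, .var rfl⟩) (.imp .top .top))

end

/-- Subsumption admits arbitrary HOL reasoning about the two terms, so it suffices to relate them by
⊤; this follows from a unary derivation for `t₁` alone. -/
theorem RHOL.complete (hD : D.Stable) {Γ : Ctx} {Ψ : Set (Fm S.Pred)} {t₁ t₂ : Tm} {σ₁ σ₂ : Ty}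
    {φ : Fm S.Pred} (hw : WfRHOL D S Γ Ψ t₁ σ₁ t₂ σ₂ φ) (h : HOL D S Γ Ψ (φ.inst₂ 0 t₁ t₂)) :
    RHOL D S Γ Ψ t₁ σ₁ t₂ σ₂ φ := by
  have htop : UHOL D S Γ Ψ t₁ σ₁ .top := by
    have := UHOL.top (S := S) hD hw.2.1 (Δ := Γ) (Ψ := Ψ) (ρ := id) (fun _ _ h => h) hw.1
    rw [Tm.rename_eq_subst] at this
    exact t₁.subst_var ▸ this
  refine .sub hw (.uholL (φ := .top) ⟨hw.1, hw.2.1, hw.2.2.1, .top⟩ htop) ?_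
  exact .impI ⟨hw.1, .imp .top h.wf.2⟩
    (h.mono hD (hw.1.insert .top) (Set.subset_insert _ _))

end RelLogic

theorem mainTheorem1 (D : RelLogic.Guard) (hD : D.Stable) (S : RelLogic.Sig)
    (Γ : RelLogic.Ctx) (σ₁ σ₂ : RelLogic.Ty) (t₁ t₂ : RelLogic.Tm)
    (Ψ : Set (RelLogic.Fm S.Pred)) (φ : RelLogic.Fm S.Pred)
    (ht₁ : RelLogic.HasType D Γ t₁ σ₁) (ht₂ : RelLogic.HasType D Γ t₂ σ₂)
    (hΨ : RelLogic.WfSet D S Γ Ψ) (hφ : RelLogic.WfFm D S (σ₂ :: σ₁ :: Γ) φ) :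
    RelLogic.RHOL D S Γ Ψ t₁ σ₁ t₂ σ₂ φ ↔ RelLogic.HOL D S Γ Ψ (φ.inst₂ 0 t₁ t₂) :=
  ⟨fun h => (h.sound hD).hol hΨ, RelLogic.RHOL.complete hD ⟨hΨ, ht₁, ht₂, hφ⟩⟩
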